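/- **Conventions.** A *cycle* on a finite set is a total order of it up to cyclic rotation; $(o_1,\dots,o_n)$ denotes the cycle of the order $o_1,\dots,o_n$, and the empty set carries a unique cycle $()$. A *multicycle* $\mathsf O=\mathsf o_1\cdots\mathsf o_b$ ($b\ge 0$) on a finite set $O$ is an unordered family of cycles on pairwise disjoint, possibly empty sets with union $O$ (empty cycles may be repeated, and only their number is recorded). An isomorphism of multicycles is a bijection of the underlying sets that carries the family of cycles of the first (counted with multiplicity) to that of the second. A *hybrid collection* $E$ assigns functorially a set $E(\mathsf O,C;G)$ to each multicycle $\mathsf O$, finite set $C$ and $G\in\frac12\mathbb N$, where morphisms are isomorphisms of multicycles and bijections of the sets $C$. Elements of $O$ are called open inputs, those of $C$ closed inputs. If $u\in O'$ and $v\in O''$, with $u$ in the cycle $(u,s_1,\dots,s_m)$ of $\mathsf O'$ and $v$ in the cycle $(v,t_1,\dots,t_n)$ of $\mathsf O''$, the multicycle $\mathsf O'\,{}_u\!\circ_v\mathsf O''$ consists of $(s_1,\dots,s_m,t_1,\dots,t_n)$ and all the other cycles of $\mathsf O'$ and $\mathsf O''$. A *cyclic hybrid* (without units) is a hybrid collection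 $H$ with operations $${}_u\!\circ_v:H(\mathsf O',C';G')\times H(\mathsf O'',C'';G'')\to H(\mathsf O'\,{}_u\!\circ_v\mathsf O'',C'\sqcup C'';G'+G'')\quad(u\in O',\ v\in O''),$$ $${}_c\circ_d:H(\mathsf O',C';G')\times H(\mathsf O'',C'';G'')\to H(\mathsf O'\mathsf O'',(C'\setminus\{c\})\sqcup (C''\setminus\{d\});G'+G'')\quad(c\in C',\ d\in C''),$$ which are equivariant, commutative ($x\,{}_a\!\circ_b\,y=y\,{}_b\circ_a\,x$) and associative ($(x\,{}_a\!\circ_b\,y)\,{}_{b'}\!\circ_c\,z=x\,{}_a\!\circ_b\,(y\,{}_{b'}\!\circ_c\,z)$ for distinct inputs $b,b'$ of $y$, of any colours). The free cyclic hybrid $F(E)$ on a hybrid collection $E$ is the value of the left adjoint of the forgetful functor. An *ideal* of a cyclic hybrid is a congruence, i.e. a family of equivalence relations on its components compatible with the isomorphisms and with all the operations. **The hybrid $\underline{\mathcal{OC}}_{KP}$.** For $\mathsf O=\mathsf o_1\cdots\mathsf o_b$ let $\underline{\mathcal{OC}}_{KP}(\mathsf O,C;G)$ be the set of symbols $[\mathsf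 O,C]_0$ (surfaces of geometric genus $g=0$ with $b$ open boundaries carrying the open inputs, and closed inputs $C$), present if and only if all of the following hold: $G=b-1+|C|/2$; the stability $2(G-1)+|O|+|C|>0$; and the symbol is of none of the types (i) $C=\emptyset$, $b\ge3$, all $\mathsf o_i$ empty; (ii) $C=\emptyset$, $b\ge2$, exactly one $\mathsf o_i$ nonempty; (iii) $|C|=1$, $b\ge2$, all $\mathsf o_i$ empty. So each component has at most one element. The operations and isomorphisms act in the only possible way, and this is a cyclic hybrid. **Theorem.** The cyclic hybrid $\underline{\mathcal{OC}}_{KP}$ has the following presentation. The generators are * an open pair of pants $\mu^{(pqr)}$ in the component $\mathsf O=(p,q,r)$, $C=\emptyset$, $G=0$, with trivial action of the automorphisms of $(p,q,r)$; * a closed pair of pants $\omega_{\{d,e,f\}}$ in the component $\mathsf O=\varnothing$ (no cycles, $b=0$), $C=\{d,e,f\}$, $G=\frac12$, with trivial action of the permutations of $\{d,e,f\}$; * a morphism $\phi^{(p)}_{\{d\}}$ in the component $\mathsf O=(p)$, $C=\{d\}$, $G=\frac12$; and the relations are, for all labels, * (open associativity) $\mu^{(pqr)}\,{}_r\!\circ_s\,\mu^{(stu)}=\mu^{(pru)}\,{}_r\!\circ_s\,\mu^{(qts)}$;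 * (closed associativity) $\omega_{\{d,e,f\}}\,{}_f\!\circ_g\,\omega_{\{g,h,i\}}=\omega_{\{d,f,i\}}\,{}_f\!\circ_g\,\omega_{\{e,h,g\}}$; * (morphism property) $\phi^{(p)}_{\{g\}}\,{}_g\!\circ_f\,\omega_{\{d,e,f\}}=\bigl(\mu^{(pqr)}\,{}_q\!\circ_s\,\phi^{(s)}_{\{d\}}\bigr)\,{}_r\!\circ_t\,\phi^{(t)}_{\{e\}}$; * (centrality) $\mu^{(pqr)}\,{}_q\!\circ_s\,\phi^{(s)}_{\{d\}}=\mu^{(prq)}\,{}_q\!\circ_s\,\phi^{(s)}_{\{d\}}$. That is, if $E$ is the hybrid collection of the generators and $\mathcal J$ the ideal of $F(E)$ generated by the relations, then $F(E)/\mathcal J\cong\underline{\mathcal{OC}}_{KP}$ as cyclic hybrids. -/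

import Mathlib

namespace OpenClosed

/-! ## Multicycles and biarities -/

/-- A multicycle on the set `O`: an unordered family of pairwise disjoint, possibly empty cycles
which exhaust `O`.  A cycle is a finite sequence without repetitions, up to rotation.  Empty cycles
may occur repeatedly; only their number is recorded. (`O` is automatically finite.) -/
structure Multicycle (O : Type) where
  /-- the cycles `o₁ ⋯ o_b` -/
  cycles : Multiset (Cycle O)
  /-- no label occurs twice -/
  nodup : (cycles.bind Cycle.toMultiset).Nodup
  /-- every label occurs -/
  cover : ∀ x : O, ∃ c ∈ cycles, x ∈ c

/-- An object of `MultCyc × Fin × ½ℕ`: a multicycle, a finite set and an operadic genus. -/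
structure Biarity : Type 1 where
  /-- labels of the open inputs -/
  Open : Type
  /-- labels of the closed inputs -/
  Closed : Type
  closed_finite : Finite Closed
  /-- the multicycle on the open labels -/
  multicycle : Multicycle Open
  /-- the operadic genus -/
  genus : ℚ
  genus_half : ∃ n : ℕ, genus = n / 2

/-- All inputs, open or closed. -/
abbrev Biarity.Leg (a : Biarity) : Type := a.Open ⊕ a.Closed

/-- The multiset of cycles (boundaries) of a biarity. -/
abbrev Biarity.cycles (a : Biarity) : Multiset (Cycle a.Open) := a.multicycle.cycles

/-- The number `b` of boundaries. -/
def Biarity.numBoundaries (a : Biarity) : ℕ := Multiset.card a.cycles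

/-- Morphisms of `MultCyc × Fin × ½ℕ`: a bijection of the open labels which carries the cycles of
`a` to the cycles of `b`, and a bijection of the closed labels; `½ℕ` is discrete. -/
structure Biarity.Iso (a b : Biarity) where
  openEquiv : a.Open ≃ b.Open
  closedEquiv : a.Closed ≃ b.Closed
  map_cycles : a.cycles.map (Cycle.map openEquiv) = b.cycles
  genus_eq : a.genus = b.genus

theorem cycle_map_map {A B C : Type} (f : A → B) (g : B → C) (c : Cycle A) :
    Cycle.map g (Cycle.map f c) = Cycle.map (g ∘ f) c := by
  induction c using Quotient.inductionOn with
  | h l => simp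

theorem cycle_map_id {A : Type} (c : Cycle A) : Cycle.map id c = c := by
  induction c using Quotient.inductionOn with
  | h l => simp

/-- The identity isomorphism. -/
def Biarity.Iso.refl (a : Biarity) : Biarity.Iso a a where
  openEquiv := Equiv.refl _
  closedEquiv := Equiv.refl _
  map_cycles := by
    exact (Multiset.map_congr rfl (fun c _ => cycle_map_id c)).trans (Multiset.map_id' _)
  genus_eq := rfl

/-- Composition of isomorphisms. -/
def Biarity.Iso.trans {a b c : Biarity} (f : Biarity.Iso a b) (g : Biarity.Iso b c) :
    Biarity.Iso a c where
  openEquiv := f.openEquiv.trans g.openEquiv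
  closedEquiv := f.closedEquiv.trans g.closedEquiv
  map_cycles := by
    rw [← g.map_cycles, ← f.map_cycles, Multiset.map_map]
    refine Multiset.map_congr rfl (fun c _ => ?_)
    rw [Function.comp_apply, cycle_map_map]
    rfl
  genus_eq := f.genus_eq.trans g.genus_eq

/-- The bijection of all inputs underlying an isomorphism. -/
def Biarity.Iso.leg {a b : Biarity} (f : Biarity.Iso a b) : a.Leg → b.Leg :=
  Sum.map f.openEquiv f.closedEquiv

/-! ## Gluings of biarities -/

/-- `K` is the pancake merging of `M` and `N` at `u` and `v`: if `u` lies in the cycle `(u, s)`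
of `M` and `v` in the cycle `(v, t)` of `N`, then these two cycles are replaced by the single cycle
`(s, t)` and all other cycles are kept.  The labels of `K` are identified through `ι` with labels
of `M` and of `N`. -/
def IsMerging {A B R : Type} (M : Multicycle A) (u : A) (N : Multicycle B) (v : B)
    (K : Multicycle R) (ι : R → A ⊕ B) : Prop :=
  ∃ (s : List A) (t : List B) (M₀ : Multiset (Cycle A)) (N₀ : Multiset (Cycle B)),
    M.cycles = (↑(u :: s) : Cycle A) ::ₘ M₀ ∧
    N.cycles = (↑(v :: t) : Cycle B) ::ₘ N₀ ∧
    K.cycles.map (Cycle.map ι) =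
      ((s.map Sum.inl ++ t.map Sum.inr : List (A ⊕ B)) : Cycle (A ⊕ B)) ::ₘ
        (M₀.map (Cycle.map Sum.inl) + N₀.map (Cycle.map Sum.inr))

/-- `K` is the disjoint union of the multicycles `M` and `N`, with labels identified by `ι`. -/
def IsUnion {A B R : Type} (M : Multicycle A) (N : Multicycle B)
    (K : Multicycle R) (ι : R → A ⊕ B) : Prop :=
  K.cycles.map (Cycle.map ι) =
    M.cycles.map (Cycle.map Sum.inl) + N.cycles.map (Cycle.map Sum.inr)

/-- Combine identifications of open and of closed labels into one of all inputs. -/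
def legMap {a b r : Biarity} (f : r.Open → a.Open ⊕ b.Open) (g : r.Closed → a.Closed ⊕ b.Closed) :
    r.Leg → a.Leg ⊕ b.Leg :=
  Sum.elim (fun x => Sum.map Sum.inl Sum.inl (f x)) (fun x => Sum.map Sum.inr Sum.inr (g x))

/-- The datum exhibiting `r` as the result of gluing the input `left` of `a` to the input `right`
of `b`, two inputs of the same colour.  The inputs of `r` are identified with the remaining inputs
of `a` and `b`.  If the glued inputs are open, the multicycle of `r` is the pancake merging; if they
are closed, it is the disjoint union.  The operadic genera add up. -/
structure Gluing (a b r : Biarity) where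
  left : a.Leg
  right : b.Leg
  openMap : r.Open → a.Open ⊕ b.Open
  closedMap : r.Closed → a.Closed ⊕ b.Closed
  injective : Function.Injective (legMap openMap closedMap)
  range_eq : Set.range (legMap openMap closedMap) = {Sum.inl left, Sum.inr right}ᶜ
  cycles_eq :
    (∃ u v, left = Sum.inl u ∧ right = Sum.inl v ∧
      IsMerging a.multicycle u b.multicycle v r.multicycle openMap) ∨
    (∃ c d, left = Sum.inr c ∧ right = Sum.inr d ∧
      IsUnion a.multicycle b.multicycle r.multicycle openMap)
  genus_eq : r.genus = a.genus + b.genus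

/-- A multicycle on a type is determined by, and can be built from, its image in a larger type. -/
theorem exists_multicycle {X R : Type} (ι : R → X) (hι : Function.Injective ι)
    (K : Multiset (Cycle X)) (hnd : (K.bind Cycle.toMultiset).Nodup)
    (hK : ∀ x, (∃ c ∈ K, x ∈ c) ↔ x ∈ Set.range ι) :
    ∃ M : Multicycle R, M.cycles.map (Cycle.map ι) = K := by
  have step : ∀ c : Cycle X, (∀ x ∈ c, x ∈ Set.range ι) → ∃ c' : Cycle R, Cycle.map ι c' = c := by
    intro c
    induction c using Quotient.inductionOn with
    | h l =>
      intro h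
      obtain ⟨l', hl'⟩ : ∃ l' : List R, l'.map ι = l := by
        have : l ∈ Set.range (List.map ι) := by
          rw [Set.range_list_map]
          exact h
        exact this
      exact ⟨(l' : Cycle R), by rw [Cycle.map_coe, hl']; rfl⟩
  have lift : ∀ K : Multiset (Cycle X), (∀ c ∈ K, ∀ x ∈ c, x ∈ Set.range ι) →
      ∃ M : Multiset (Cycle R), M.map (Cycle.map ι) = K := by
    intro K
    induction K using Multiset.induction_on with
    | empty => exact fun _ => ⟨0, rfl⟩
    | cons c K ih =>
      intro h
      obtain ⟨M, rfl⟩ := ih (fun c' hc' => h c' (Multiset.mem_cons_of_mem hc'))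
      obtain ⟨c', rfl⟩ := step c (h c (Multiset.mem_cons_self _ _))
      exact ⟨c' ::ₘ M, Multiset.map_cons _ _ _⟩
  obtain ⟨M, rfl⟩ := lift K (fun c hc x hx => (hK x).1 ⟨c, hc, hx⟩)
  have htm : ∀ c : Cycle R, (Cycle.map ι c).toMultiset = c.toMultiset.map ι := by
    intro c
    induction c using Quotient.inductionOn with
    | h l => simp
  refine ⟨⟨M, ?_, ?_⟩, rfl⟩
  · rw [Multiset.bind_map] at hnd
    simp only [htm] at hnd
    rw [← Multiset.map_bind] at hnd
    exact Multiset.Nodup.of_map _ hnd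
  · intro x
    obtain ⟨c, hc, hx⟩ := (hK (ι x)).2 ⟨x, rfl⟩
    obtain ⟨c', hc', rfl⟩ := Multiset.mem_map.1 hc
    obtain ⟨y, hy, hyx⟩ := Cycle.mem_map.1 hx
    exact ⟨c', hc', hι hyx ▸ hy⟩

theorem mem_cycle_toMultiset {A : Type} (c : Cycle A) (x : A) : x ∈ c.toMultiset ↔ x ∈ c := by
  induction c using Quotient.inductionOn with
  | h l => simp

theorem cycle_toMultiset_map {A B : Type} (f : A → B) (c : Cycle A) :
    (Cycle.map f c).toMultiset = c.toMultiset.map f := by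
  induction c using Quotient.inductionOn with
  | h l => simp

theorem bind_toMultiset_map {A B : Type} (f : A → B) (M : Multiset (Cycle A)) :
    (M.map (Cycle.map f)).bind Cycle.toMultiset = (M.bind Cycle.toMultiset).map f := by
  rw [Multiset.bind_map, Multiset.map_bind]
  simp only [cycle_toMultiset_map]

/-- Any two open inputs can be glued. -/
theorem exists_gluing_open (a b : Biarity) (u : a.Open) (v : b.Open) :
    ∃ (r : Biarity) (w : Gluing a b r), w.left = Sum.inl u ∧ w.right = Sum.inl v := by
  have cyc : ∀ {A : Type} (M : Multicycle A) (u : A), ∃ (s : List A) (M₀ : Multiset (Cycle A)),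
      M.cycles = (↑(u :: s) : Cycle A) ::ₘ M₀ := by
    intro A M u
    obtain ⟨c, hc, hu⟩ := M.cover u
    obtain ⟨M₀, h⟩ := Multiset.exists_cons_of_mem hc
    induction c using Quotient.inductionOn with
    | h l =>
      obtain ⟨l₁, l₂, rfl⟩ := List.append_of_mem (show u ∈ l from hu)
      refine ⟨l₂ ++ l₁, M₀, h.trans (congrArg (· ::ₘ M₀) ?_)⟩
      refine Cycle.coe_eq_coe.2 ⟨l₁.length, ?_⟩
      simp [List.rotate_append_length_eq]
  obtain ⟨s, M₀, hM⟩ := cyc a.multicycle u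
  obtain ⟨t, N₀, hN⟩ := cyc b.multicycle v
  let R : Type := {x : a.Open ⊕ b.Open // x ≠ Sum.inl u ∧ x ≠ Sum.inr v}
  have hMn := a.multicycle.nodup
  have hNn := b.multicycle.nodup
  have hMc : ∀ x, x ∈ a.multicycle.cycles.bind Cycle.toMultiset := fun x => by
    obtain ⟨c, hc, hx⟩ := a.multicycle.cover x
    exact Multiset.mem_bind.2 ⟨c, hc, (mem_cycle_toMultiset c x).2 hx⟩
  have hNc : ∀ x, x ∈ b.multicycle.cycles.bind Cycle.toMultiset := fun x => by
    obtain ⟨c, hc, hx⟩ := b.multicycle.cover x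
    exact Multiset.mem_bind.2 ⟨c, hc, (mem_cycle_toMultiset c x).2 hx⟩
  rw [hM, Multiset.cons_bind, Cycle.coe_toMultiset, ← Multiset.cons_coe, Multiset.cons_add,
    Multiset.nodup_cons] at hMn
  rw [hN, Multiset.cons_bind, Cycle.coe_toMultiset, ← Multiset.cons_coe, Multiset.cons_add,
    Multiset.nodup_cons] at hNn
  simp only [hM, Multiset.cons_bind, Cycle.coe_toMultiset, ← Multiset.cons_coe, Multiset.cons_add,
    Multiset.mem_cons] at hMc
  simp only [hN, Multiset.cons_bind, Cycle.coe_toMultiset, ← Multiset.cons_coe, Multiset.cons_add,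
    Multiset.mem_cons] at hNc
  set K : Multiset (Cycle (a.Open ⊕ b.Open)) :=
    ((s.map Sum.inl ++ t.map Sum.inr : List (a.Open ⊕ b.Open)) : Cycle (a.Open ⊕ b.Open)) ::ₘ
      (M₀.map (Cycle.map Sum.inl) + N₀.map (Cycle.map Sum.inr)) with hKdef
  have hbind : K.bind Cycle.toMultiset =
      ((s : Multiset a.Open) + M₀.bind Cycle.toMultiset).map Sum.inl +
      ((t : Multiset b.Open) + N₀.bind Cycle.toMultiset).map Sum.inr := by
    rw [hKdef, Multiset.cons_bind, Multiset.add_bind, bind_toMultiset_map, bind_toMultiset_map,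
      Cycle.coe_toMultiset, ← Multiset.coe_add, Multiset.map_add, Multiset.map_add,
      Multiset.map_coe, Multiset.map_coe]
    abel
  have hmem : ∀ x, (∃ c ∈ K, x ∈ c) ↔ x ∈ Set.range (Subtype.val : R → a.Open ⊕ b.Open) := by
    intro x
    have : (∃ c ∈ K, x ∈ c) ↔ x ∈ K.bind Cycle.toMultiset := by
      simp [Multiset.mem_bind, mem_cycle_toMultiset]
    rw [this, hbind, show Set.range (Subtype.val : R → a.Open ⊕ b.Open) =
      {x | x ≠ Sum.inl u ∧ x ≠ Sum.inr v} from Subtype.range_coe]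
    change _ ↔ x ≠ Sum.inl u ∧ x ≠ Sum.inr v
    rw [Multiset.mem_add, Multiset.mem_map, Multiset.mem_map]
    rcases x with x | x
    · have h1 := hMc x
      constructor
      · rintro (⟨y, hy, h⟩ | ⟨y, hy, h⟩)
        · cases h
          exact ⟨fun h => hMn.1 (Sum.inl_injective h ▸ hy), by simp⟩
        · cases h
      · rintro ⟨h, -⟩
        exact Or.inl ⟨x, h1.resolve_left (fun e => h (e ▸ rfl)), rfl⟩
    · have h1 := hNc x
      constructor
      · rintro (⟨y, hy, h⟩ | ⟨y, hy, h⟩)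
        · cases h
        · cases h
          exact ⟨by simp, fun h => hNn.1 (Sum.inr_injective h ▸ hy)⟩
      · rintro ⟨-, h⟩
        exact Or.inr ⟨x, h1.resolve_left (fun e => h (e ▸ rfl)), rfl⟩
  have hnd : (K.bind Cycle.toMultiset).Nodup := by
    rw [hbind, Multiset.nodup_add]
    refine ⟨hMn.2.map Sum.inl_injective, hNn.2.map Sum.inr_injective, ?_⟩
    rw [Multiset.disjoint_left]
    intro x hx hy
    obtain ⟨_, _, rfl⟩ := Multiset.mem_map.1 hx
    obtain ⟨_, _, h⟩ := Multiset.mem_map.1 hy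
    cases h
  obtain ⟨L, hL⟩ := exists_multicycle (Subtype.val : R → _) Subtype.val_injective K hnd hmem
  have := a.closed_finite
  have := b.closed_finite
  refine ⟨⟨R, a.Closed ⊕ b.Closed, inferInstance, L, a.genus + b.genus, ?_⟩,
    ⟨Sum.inl u, Sum.inl v, Subtype.val, id, ?_, ?_,
      Or.inl ⟨u, v, rfl, rfl, s, t, M₀, N₀, hM, hN, hL⟩, rfl⟩, rfl, rfl⟩
  · obtain ⟨m, hm⟩ := a.genus_half
    obtain ⟨n, hn⟩ := b.genus_half
    exact ⟨m + n, by rw [hm, hn]; push_cast; ring⟩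
  · rintro (⟨x | x, hx⟩ | x | x) (⟨y | y, hy⟩ | y | y) h <;> simp_all [legMap]
  · ext x
    constructor
    · rintro ⟨⟨y | y, hy⟩ | y | y, rfl⟩
      · have := hy.1
        simpa [legMap] using this
      · have := hy.2
        simpa [legMap] using this
      · simp [legMap]
      · simp [legMap]
    · intro hx
      rcases x with (x | x) | (x | x)
      · exact ⟨Sum.inl ⟨Sum.inl x, by simpa using hx⟩, rfl⟩
      · exact ⟨Sum.inr (Sum.inl x), rfl⟩
      · exact ⟨Sum.inl ⟨Sum.inr x, by simpa using hx⟩, rfl⟩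
      · exact ⟨Sum.inr (Sum.inr x), rfl⟩

/-- Any two closed inputs can be glued. -/
theorem exists_gluing_closed (a b : Biarity) (c : a.Closed) (d : b.Closed) :
    ∃ (r : Biarity) (w : Gluing a b r), w.left = Sum.inr c ∧ w.right = Sum.inr d := by
  have mem : ∀ {A : Type} (M : Multiset (Cycle A)) (x : A),
      (∃ c ∈ M, x ∈ c) ↔ x ∈ M.bind Cycle.toMultiset := by
    intro A M x
    simp [Multiset.mem_bind, mem_cycle_toMultiset]
  have hbind : (a.cycles.map (Cycle.map Sum.inl) + b.cycles.map (Cycle.map Sum.inr) :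
      Multiset (Cycle (a.Open ⊕ b.Open))).bind Cycle.toMultiset =
      (a.cycles.bind Cycle.toMultiset).map Sum.inl +
      (b.cycles.bind Cycle.toMultiset).map Sum.inr := by
    rw [Multiset.add_bind, bind_toMultiset_map, bind_toMultiset_map]
  obtain ⟨L, hL⟩ := exists_multicycle (id : a.Open ⊕ b.Open → a.Open ⊕ b.Open)
    Function.injective_id
    (a.cycles.map (Cycle.map Sum.inl) + b.cycles.map (Cycle.map Sum.inr))
    (by
      rw [hbind, Multiset.nodup_add]
      refine ⟨a.multicycle.nodup.map Sum.inl_injective, b.multicycle.nodup.map Sum.inr_injective, ?_⟩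
      rw [Multiset.disjoint_left]
      intro x hx hy
      obtain ⟨_, _, rfl⟩ := Multiset.mem_map.1 hx
      obtain ⟨_, _, h⟩ := Multiset.mem_map.1 hy
      cases h)
    (by
      intro x
      rw [mem, hbind, Multiset.mem_add, Multiset.mem_map, Multiset.mem_map]
      refine ⟨fun _ => ⟨x, rfl⟩, fun _ => ?_⟩
      rcases x with x | x
      · exact Or.inl ⟨x, (mem _ x).1 (a.multicycle.cover x), rfl⟩
      · exact Or.inr ⟨x, (mem _ x).1 (b.multicycle.cover x), rfl⟩)
  have := a.closed_finite
  have := b.closed_finite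
  refine ⟨⟨a.Open ⊕ b.Open, {x : a.Closed ⊕ b.Closed // x ≠ Sum.inl c ∧ x ≠ Sum.inr d},
      inferInstance, L, a.genus + b.genus, ?_⟩,
    ⟨Sum.inr c, Sum.inr d, id, Subtype.val, ?_, ?_, Or.inr ⟨c, d, rfl, rfl, hL⟩, rfl⟩, rfl, rfl⟩
  · obtain ⟨m, hm⟩ := a.genus_half
    obtain ⟨n, hn⟩ := b.genus_half
    exact ⟨m + n, by rw [hm, hn]; push_cast; ring⟩
  · rintro ((x | x) | ⟨x | x, hx⟩) ((y | y) | ⟨y | y, hy⟩) h <;> simp_all [legMap]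
  · ext x
    constructor
    · rintro ⟨(y | y) | ⟨y | y, hy⟩, rfl⟩
      · simp [legMap]
      · simp [legMap]
      · have := hy.1
        simpa [legMap] using this
      · have := hy.2
        simpa [legMap] using this
    · intro hx
      rcases x with (x | x) | (x | x)
      · exact ⟨Sum.inl (Sum.inl x), rfl⟩
      · exact ⟨Sum.inr ⟨Sum.inl x, by simpa using hx⟩, rfl⟩
      · exact ⟨Sum.inl (Sum.inr x), rfl⟩
      · exact ⟨Sum.inr ⟨Sum.inr x, by simpa using hx⟩, rfl⟩

/-- The identification of the inputs of the result with the unglued inputs of the two pieces. -/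
def Gluing.leg {a b r : Biarity} (w : Gluing a b r) : r.Leg → a.Leg ⊕ b.Leg :=
  legMap w.openMap w.closedMap

/-- The gluing `w'` is obtained from `w` by relabelling along isomorphisms. -/
def Gluing.Relabelled {a b r a' b' r' : Biarity} (f : Biarity.Iso a a') (g : Biarity.Iso b b')
    (h : Biarity.Iso r r') (w : Gluing a b r) (w' : Gluing a' b' r') : Prop :=
  w'.left = f.leg w.left ∧ w'.right = g.leg w.right ∧
    ∀ x : r.Leg, w'.leg (h.leg x) = Sum.map f.leg g.leg (w.leg x)

/-- The gluing `w'` is `w` with the roles of the two pieces exchanged. -/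
def Gluing.Swapped {a b r : Biarity} (w : Gluing a b r) (w' : Gluing b a r) : Prop :=
  w'.left = w.right ∧ w'.right = w.left ∧ ∀ x : r.Leg, w'.leg x = (w.leg x).swap

/-- The two ways of gluing `a` to `b` and `b` to `c` (along two different inputs of `b`):
first `a` to `b` by `w₁` and then `c` by `w₂`, or first `b` to `c` by `w₃` and then `a` by `w₄`. -/
def Gluing.Associated {a b c r s t : Biarity} (w₁ : Gluing a b r) (w₂ : Gluing r c t)
    (w₃ : Gluing b c s) (w₄ : Gluing a s t) : Prop :=
  w₄.left = w₁.left ∧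
  w₃.leg w₄.right = Sum.inl w₁.right ∧
  w₁.leg w₂.left = Sum.inr w₃.left ∧
  w₂.right = w₃.right ∧
  ∀ x : t.Leg, Equiv.sumAssoc _ _ _ (Sum.map w₁.leg id (w₂.leg x)) = Sum.map id w₃.leg (w₄.leg x)

/-! ## Hybrid collections and cyclic hybrids -/

universe u v

/-- A hybrid collection: a functor from `MultCyc × Fin × ½ℕ` to sets. -/
structure Collection where
  obj : Biarity → Type u
  map : ∀ {a b : Biarity}, Biarity.Iso a b → obj a → obj b
  map_refl : ∀ {a : Biarity} (x : obj a), map (Biarity.Iso.refl a) x = x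
  map_trans : ∀ {a b c : Biarity} (f : Biarity.Iso a b) (g : Biarity.Iso b c) (x : obj a),
    map (f.trans g) x = map g (map f x)

/-- A cyclic hybrid: a hybrid collection with compositions along open and closed inputs,
which are equivariant, commutative and associative. -/
structure CyclicHybrid extends Collection.{u} where
  comp : ∀ {a b r : Biarity}, Gluing a b r → obj a → obj b → obj r
  equivariant : ∀ {a b r a' b' r' : Biarity} (f : Biarity.Iso a a') (g : Biarity.Iso b b')
    (h : Biarity.Iso r r') (w : Gluing a b r) (w' : Gluing a' b' r'),
    Gluing.Relabelled f g h w w' →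
    ∀ (x : obj a) (y : obj b), map h (comp w x y) = comp w' (map f x) (map g y)
  commutative : ∀ {a b r : Biarity} (w : Gluing a b r) (w' : Gluing b a r), w.Swapped w' →
    ∀ (x : obj a) (y : obj b), comp w x y = comp w' y x
  associative : ∀ {a b c r s t : Biarity} (w₁ : Gluing a b r) (w₂ : Gluing r c t)
    (w₃ : Gluing b c s) (w₄ : Gluing a s t), Gluing.Associated w₁ w₂ w₃ w₄ →
    ∀ (x : obj a) (y : obj b) (z : obj c),
      comp w₂ (comp w₁ x y) z = comp w₄ x (comp w₃ y z)

/-- Morphisms of hybrid collections. -/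
structure Collection.Hom (E : Collection.{u}) (F : Collection.{v}) where
  app : ∀ a : Biarity, E.obj a → F.obj a
  map_app : ∀ {a b : Biarity} (f : Biarity.Iso a b) (x : E.obj a),
    app b (E.map f x) = F.map f (app a x)

/-- Morphisms of cyclic hybrids. -/
structure CyclicHybrid.Hom (H : CyclicHybrid.{u}) (K : CyclicHybrid.{v}) extends
    Collection.Hom H.toCollection K.toCollection where
  map_comp : ∀ {a b r : Biarity} (w : Gluing a b r) (x : H.obj a) (y : H.obj b),
    app r (H.comp w x y) = K.comp w (app a x) (app b y)

/-- Isomorphisms of cyclic hybrids. -/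
structure CyclicHybrid.Iso (H : CyclicHybrid.{u}) (K : CyclicHybrid.{v}) extends
    toMorphism : CyclicHybrid.Hom H K where
  bijective : ∀ a : Biarity, Function.Bijective (app a)

/-! ## The free cyclic hybrid -/

/-- Formal expressions in the elements of `E`, the actions and the compositions. -/
inductive Term (E : Collection.{u}) : Biarity → Type (max 1 u)
  | gen {a : Biarity} (e : E.obj a) : Term E a
  | map {a b : Biarity} (f : Biarity.Iso a b) (x : Term E a) : Term E b
  | comp {a b r : Biarity} (w : Gluing a b r) (x : Term E a) (y : Term E b) : Term E r

/-- Equality of formal expressions by virtue of the axioms of cyclic hybrids and of the functor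
structure of `E`. -/
inductive Term.Equal {E : Collection.{u}} : ∀ {a : Biarity}, Term E a → Term E a → Prop
  | refl {a : Biarity} (x : Term E a) : Term.Equal x x
  | symm {a : Biarity} {x y : Term E a} : Term.Equal x y → Term.Equal y x
  | trans {a : Biarity} {x y z : Term E a} : Term.Equal x y → Term.Equal y z → Term.Equal x z
  | map_congr {a b : Biarity} (f : Biarity.Iso a b) {x y : Term E a} :
      Term.Equal x y → Term.Equal (Term.map f x) (Term.map f y)
  | comp_congr {a b r : Biarity} (w : Gluing a b r) {x x' : Term E a} {y y' : Term E b} :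
      Term.Equal x x' → Term.Equal y y' → Term.Equal (Term.comp w x y) (Term.comp w x' y')
  | map_gen {a b : Biarity} (f : Biarity.Iso a b) (e : E.obj a) :
      Term.Equal (Term.map f (Term.gen e)) (Term.gen (E.map f e))
  | map_refl {a : Biarity} (x : Term E a) : Term.Equal (Term.map (Biarity.Iso.refl a) x) x
  | map_trans {a b c : Biarity} (f : Biarity.Iso a b) (g : Biarity.Iso b c) (x : Term E a) :
      Term.Equal (Term.map (f.trans g) x) (Term.map g (Term.map f x))
  | equivariant {a b r a' b' r' : Biarity} (f : Biarity.Iso a a') (g : Biarity.Iso b b')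
      (h : Biarity.Iso r r') (w : Gluing a b r) (w' : Gluing a' b' r')
      (hw : Gluing.Relabelled f g h w w') (x : Term E a) (y : Term E b) :
      Term.Equal (Term.map h (Term.comp w x y)) (Term.comp w' (Term.map f x) (Term.map g y))
  | commutative {a b r : Biarity} (w : Gluing a b r) (w' : Gluing b a r) (hw : w.Swapped w')
      (x : Term E a) (y : Term E b) : Term.Equal (Term.comp w x y) (Term.comp w' y x)
  | associative {a b c r s t : Biarity} (w₁ : Gluing a b r) (w₂ : Gluing r c t)
      (w₃ : Gluing b c s) (w₄ : Gluing a s t) (hw : Gluing.Associated w₁ w₂ w₃ w₄)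
      (x : Term E a) (y : Term E b) (z : Term E c) :
      Term.Equal (Term.comp w₂ (Term.comp w₁ x y) z) (Term.comp w₄ x (Term.comp w₃ y z))

/-- The setoid of provably equal formal expressions. -/
def Term.setoid (E : Collection.{u}) (a : Biarity) : Setoid (Term E a) where
  r := Term.Equal
  iseqv := ⟨Term.Equal.refl, Term.Equal.symm, Term.Equal.trans⟩

/-- The free cyclic hybrid generated by a hybrid collection. -/
def freeHybrid (E : Collection.{u}) : CyclicHybrid.{max 1 u} where
  obj a := Quotient (Term.setoid E a)
  map f := Quotient.map (Term.map f) (fun _ _ h => Term.Equal.map_congr f h)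
  map_refl x := by
    induction x using Quotient.inductionOn with
    | h x => exact Quotient.sound (Term.Equal.map_refl x)
  map_trans f g x := by
    induction x using Quotient.inductionOn with
    | h x => exact Quotient.sound (Term.Equal.map_trans f g x)
  comp w := Quotient.map₂ (Term.comp w) (fun _ _ h _ _ h' => Term.Equal.comp_congr w h h')
  equivariant f g h w w' hw x y := by
    induction x, y using Quotient.inductionOn₂ with
    | h x y => exact Quotient.sound (Term.Equal.equivariant f g h w w' hw x y)
  commutative w w' hw x y := by
    induction x, y using Quotient.inductionOn₂ with
    | h x y => exact Quotient.sound (Term.Equal.commutative w w' hw x y)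
  associative w₁ w₂ w₃ w₄ hw x y z := by
    induction x, y, z using Quotient.inductionOn₃ with
    | h x y z => exact Quotient.sound (Term.Equal.associative w₁ w₂ w₃ w₄ hw x y z)

/-- The inclusion of the generating collection. -/
def freeGen (E : Collection.{u}) : Collection.Hom E (freeHybrid E).toCollection where
  app a e := Quotient.mk (Term.setoid E a) (Term.gen e)
  map_app f e := Quotient.sound (Term.Equal.symm (Term.Equal.map_gen f e))

/-- The value of a formal expression in a cyclic hybrid. -/
def Term.eval {E : Collection.{u}} {K : CyclicHybrid.{v}}
    (g : Collection.Hom E K.toCollection) : ∀ {a : Biarity}, Term E a → K.obj a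
  | _, Term.gen e => g.app _ e
  | _, Term.map f x => K.map f (Term.eval g x)
  | _, Term.comp w x y => K.comp w (Term.eval g x) (Term.eval g y)

theorem Term.eval_eq {E : Collection.{u}} {K : CyclicHybrid.{v}}
    (g : Collection.Hom E K.toCollection) {a : Biarity} {x y : Term E a} (h : Term.Equal x y) :
    Term.eval g x = Term.eval g y := by
  induction h with
  | refl x => rfl
  | symm _ ih => exact ih.symm
  | trans _ _ ih ih' => exact ih.trans ih'
  | map_congr f _ ih => simp only [Term.eval, ih]
  | comp_congr w _ _ ih ih' => simp only [Term.eval, ih, ih']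
  | map_gen f e => exact (g.map_app f e).symm
  | map_refl x => exact K.map_refl _
  | map_trans f g' x => exact K.map_trans _ _ _
  | equivariant f g' h w w' hw x y => exact K.equivariant f g' h w w' hw _ _
  | commutative w w' hw x y => exact K.commutative w w' hw _ _
  | associative w₁ w₂ w₃ w₄ hw x y z => exact K.associative w₁ w₂ w₃ w₄ hw _ _ _

/-- Universal property: `freeHybrid` is left adjoint to the forgetful functor from cyclic hybrids to
hybrid collections. -/
theorem freeHybrid_universal (E : Collection.{u}) (K : CyclicHybrid.{v})
    (g : Collection.Hom E K.toCollection) :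
    ∃! F : CyclicHybrid.Hom (freeHybrid E) K,
      ∀ (a : Biarity) (e : E.obj a), F.app a ((freeGen E).app a e) = g.app a e := by
  refine ⟨⟨⟨fun a => Quotient.lift (Term.eval g) (fun _ _ h => Term.eval_eq g h), ?_⟩, ?_⟩,
    fun a e => rfl, ?_⟩
  · intro a b f x
    induction x using Quotient.inductionOn with
    | h x => rfl
  · intro a b r w x y
    induction x, y using Quotient.inductionOn₂ with
    | h x y => rfl
  · rintro ⟨⟨app, map_app⟩, map_comp⟩ hF
    congr 2
    funext a x
    induction x using Quotient.inductionOn with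
    | h x =>
      induction x with
      | gen e => exact hF _ e
      | map f x ih =>
        refine (map_app f (Quotient.mk (Term.setoid E _) x)).trans ?_
        exact congrArg (K.map f) ih
      | comp w x y ih ih' =>
        refine (map_comp w (Quotient.mk (Term.setoid E _) x)
          (Quotient.mk (Term.setoid E _) y)).trans ?_
        exact congrArg₂ (K.comp w) ih ih'

/-! ## Ideals and quotients

As hybrids live in the category of sets, an ideal is a congruence. -/

/-- An ideal (congruence) of a cyclic hybrid. -/
structure Ideal (H : CyclicHybrid.{u}) where
  setoid : ∀ a : Biarity, Setoid (H.obj a)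
  map_congr : ∀ {a b : Biarity} (f : Biarity.Iso a b) {x y : H.obj a},
    (setoid a).r x y → (setoid b).r (H.map f x) (H.map f y)
  comp_congr : ∀ {a b r : Biarity} (w : Gluing a b r) {x x' : H.obj a} {y y' : H.obj b},
    (setoid a).r x x' → (setoid b).r y y' → (setoid r).r (H.comp w x y) (H.comp w x' y')

/-- The quotient of a cyclic hybrid by an ideal. -/
def CyclicHybrid.quotient (H : CyclicHybrid.{u}) (J : Ideal H) : CyclicHybrid.{u} where
  obj a := Quotient (J.setoid a)
  map f := Quotient.map (H.map f) (fun _ _ h => J.map_congr f h)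
  map_refl x := by
    induction x using Quotient.inductionOn with
    | h x => exact congrArg _ (H.map_refl x)
  map_trans f g x := by
    induction x using Quotient.inductionOn with
    | h x => exact congrArg _ (H.map_trans f g x)
  comp w := Quotient.map₂ (H.comp w) (fun _ _ h _ _ h' => J.comp_congr w h h')
  equivariant f g h w w' hw x y := by
    induction x, y using Quotient.inductionOn₂ with
    | h x y => exact congrArg _ (H.equivariant f g h w w' hw x y)
  commutative w w' hw x y := by
    induction x, y using Quotient.inductionOn₂ with
    | h x y => exact congrArg _ (H.commutative w w' hw x y)
  associative w₁ w₂ w₃ w₄ hw x y z := by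
    induction x, y, z using Quotient.inductionOn₃ with
    | h x y z => exact congrArg _ (H.associative w₁ w₂ w₃ w₄ hw x y z)

/-- The equalities implied by the relations `R`. -/
inductive Generated (H : CyclicHybrid.{u}) (R : ∀ a : Biarity, H.obj a → H.obj a → Prop) :
    ∀ {a : Biarity}, H.obj a → H.obj a → Prop
  | rel {a : Biarity} {x y : H.obj a} : R a x y → Generated H R x y
  | refl {a : Biarity} (x : H.obj a) : Generated H R x x
  | symm {a : Biarity} {x y : H.obj a} : Generated H R x y → Generated H R y x
  | trans {a : Biarity} {x y z : H.obj a} :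
      Generated H R x y → Generated H R y z → Generated H R x z
  | map {a b : Biarity} (f : Biarity.Iso a b) {x y : H.obj a} :
      Generated H R x y → Generated H R (H.map f x) (H.map f y)
  | comp {a b r : Biarity} (w : Gluing a b r) {x x' : H.obj a} {y y' : H.obj b} :
      Generated H R x x' → Generated H R y y' → Generated H R (H.comp w x y) (H.comp w x' y')

/-- The ideal generated by the relations `R`. -/
def generatedIdeal (H : CyclicHybrid.{u}) (R : ∀ a : Biarity, H.obj a → H.obj a → Prop) :
    Ideal H where
  setoid _ := ⟨Generated H R, ⟨Generated.refl, Generated.symm, Generated.trans⟩⟩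
  map_congr f _ _ h := Generated.map f h
  comp_congr w _ _ _ _ h h' := Generated.comp w h h'

/-! ## Generators and relations -/

/-- `a` is the biarity of `μ`, with multicycle consisting of the single cycle `(p q r)`, without
closed inputs, of operadic genus `0`. -/
def IsOpenPants (a : Biarity) (p q r : a.Open) : Prop :=
  a.cycles = {(↑[p, q, r] : Cycle a.Open)} ∧ IsEmpty a.Closed ∧ a.genus = 0

/-- `a` is the biarity of `ω`, with empty multicycle, set of closed inputs consisting of the three
elements `d, e, f`, of operadic genus `1/2`. -/
def IsClosedPants (a : Biarity) (d e f : a.Closed) : Prop :=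
  a.cycles = 0 ∧ [d, e, f].Nodup ∧ (∀ x, x ∈ [d, e, f]) ∧ a.genus = 1 / 2

/-- `a` is the biarity of `φ`, with multicycle consisting of the single cycle `(p)`, with the single
closed input `d`, of operadic genus `1/2`. -/
def IsMorphism (a : Biarity) (p : a.Open) (d : a.Closed) : Prop :=
  a.cycles = {(↑[p] : Cycle a.Open)} ∧ (∀ x, x = d) ∧ a.genus = 1 / 2

/-- The names of the three generators. -/
inductive Generator
  | mu
  | omega
  | phi

/-- The biarities of the generators. -/
def Generator.HasBiarity (a : Biarity) : Generator → Prop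
  | mu => ∃ p q r, IsOpenPants a p q r
  | omega => ∃ d e f, IsClosedPants a d e f
  | phi => ∃ p d, IsMorphism a p d

theorem Generator.HasBiarity.map {a b : Biarity} (f : Biarity.Iso a b) {g : Generator}
    (h : g.HasBiarity a) : g.HasBiarity b := by
  cases g with
  | mu =>
    obtain ⟨p, q, r, h1, h2, h3⟩ := h
    refine ⟨f.openEquiv p, f.openEquiv q, f.openEquiv r, ?_, ?_, f.genus_eq ▸ h3⟩
    · rw [← f.map_cycles, h1]; simp
    · exact f.closedEquiv.symm.isEmpty
  | omega =>
    obtain ⟨d, e, k, h1, h2, h3, h4⟩ := h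
    refine ⟨f.closedEquiv d, f.closedEquiv e, f.closedEquiv k, ?_, ?_, ?_, f.genus_eq ▸ h4⟩
    · rw [← f.map_cycles, h1]; simp
    · exact h2.map f.closedEquiv.injective
    · intro x
      have := List.mem_map_of_mem (f := f.closedEquiv) (h3 (f.closedEquiv.symm x))
      simpa using this
  | phi =>
    obtain ⟨p, d, h1, h2, h3⟩ := h
    refine ⟨f.openEquiv p, f.closedEquiv d, ?_, ?_, f.genus_eq ▸ h3⟩
    · rw [← f.map_cycles, h1]; simp
    · intro x
      rw [← h2 (f.closedEquiv.symm x), Equiv.apply_symm_apply]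

/-- The generating collection `E`: in each biarity of the form of `μ`, `ω` or `φ` there is exactly
one generator, with the trivial action of automorphisms. -/
def generators : Collection.{0} where
  obj a := {g : Generator // g.HasBiarity a}
  map f g := ⟨g.1, g.2.map f⟩
  map_refl _ := rfl
  map_trans _ _ _ := rfl

/-- The element `μ^{(pqr)}` of the free cyclic hybrid. -/
def mu {a : Biarity} (p q r : a.Open) (h : IsOpenPants a p q r) : (freeHybrid generators).obj a :=
  (freeGen generators).app a ⟨Generator.mu, p, q, r, h⟩

/-- The element `ω_{def}` of the free cyclic hybrid. -/
def omega {a : Biarity} (d e f : a.Closed) (h : IsClosedPants a d e f) :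
    (freeHybrid generators).obj a :=
  (freeGen generators).app a ⟨Generator.omega, d, e, f, h⟩

/-- The element `φ^{(p)}_{d}` of the free cyclic hybrid. -/
def phi {a : Biarity} (p : a.Open) (d : a.Closed) (h : IsMorphism a p d) :
    (freeHybrid generators).obj a :=
  (freeGen generators).app a ⟨Generator.phi, p, d, h⟩

/-- The gluing `w` glues the open inputs `u` and `v`. -/
def Gluing.GluesOpen {a b r : Biarity} (w : Gluing a b r) (u : a.Open) (v : b.Open) : Prop :=
  w.left = Sum.inl u ∧ w.right = Sum.inl v

/-- The gluing `w` glues the closed inputs `c` and `d`. -/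
def Gluing.GluesClosed {a b r : Biarity} (w : Gluing a b r) (c : a.Closed) (d : b.Closed) : Prop :=
  w.left = Sum.inr c ∧ w.right = Sum.inr d

/-- The four defining relations, in the free cyclic hybrid.  The same input of the left and of
the right side of a relation carries a letter with different indices in the different pieces, and
the letter without index in the result of the gluing. -/
inductive Relation :
    ∀ t : Biarity, (freeHybrid generators).obj t → (freeHybrid generators).obj t → Prop
  /-- `μ(p q r) _r∘_s μ(s t u) = μ(p r u) _r∘_s μ(q t s)` -/
  | open_assoc {a b a' b' z : Biarity} (w : Gluing a b z) (w' : Gluing a' b' z)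
      {p q t u : z.Open}
      {p₁ q₁ r₁ : a.Open} (ha : IsOpenPants a p₁ q₁ r₁)
      {s₁ t₁ u₁ : b.Open} (hb : IsOpenPants b s₁ t₁ u₁)
      {p₂ r₂ u₂ : a'.Open} (ha' : IsOpenPants a' p₂ r₂ u₂)
      {q₂ t₂ s₂ : b'.Open} (hb' : IsOpenPants b' q₂ t₂ s₂)
      (hw : w.GluesOpen r₁ s₁)
      (hp : w.openMap p = Sum.inl p₁) (hq : w.openMap q = Sum.inl q₁)
      (ht : w.openMap t = Sum.inr t₁) (hu : w.openMap u = Sum.inr u₁)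
      (hw' : w'.GluesOpen r₂ s₂)
      (hp' : w'.openMap p = Sum.inl p₂) (hq' : w'.openMap q = Sum.inr q₂)
      (ht' : w'.openMap t = Sum.inr t₂) (hu' : w'.openMap u = Sum.inl u₂) :
      Relation z
        ((freeHybrid generators).comp w (mu p₁ q₁ r₁ ha) (mu s₁ t₁ u₁ hb))
        ((freeHybrid generators).comp w' (mu p₂ r₂ u₂ ha') (mu q₂ t₂ s₂ hb'))
  /-- `ω{d e f} _f∘_g ω{g h i} = ω{d f i} _f∘_g ω{e h g}` -/
  | closed_assoc {a b a' b' z : Biarity} (w : Gluing a b z) (w' : Gluing a' b' z)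
      {d e h i : z.Closed}
      {d₁ e₁ f₁ : a.Closed} (ha : IsClosedPants a d₁ e₁ f₁)
      {g₁ h₁ i₁ : b.Closed} (hb : IsClosedPants b g₁ h₁ i₁)
      {d₂ f₂ i₂ : a'.Closed} (ha' : IsClosedPants a' d₂ f₂ i₂)
      {e₂ h₂ g₂ : b'.Closed} (hb' : IsClosedPants b' e₂ h₂ g₂)
      (hw : w.GluesClosed f₁ g₁)
      (hd : w.closedMap d = Sum.inl d₁) (he : w.closedMap e = Sum.inl e₁)
      (hh : w.closedMap h = Sum.inr h₁) (hi : w.closedMap i = Sum.inr i₁)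
      (hw' : w'.GluesClosed f₂ g₂)
      (hd' : w'.closedMap d = Sum.inl d₂) (he' : w'.closedMap e = Sum.inr e₂)
      (hh' : w'.closedMap h = Sum.inr h₂) (hi' : w'.closedMap i = Sum.inl i₂) :
      Relation z
        ((freeHybrid generators).comp w (omega d₁ e₁ f₁ ha) (omega g₁ h₁ i₁ hb))
        ((freeHybrid generators).comp w' (omega d₂ f₂ i₂ ha') (omega e₂ h₂ g₂ hb'))
  /-- `φ(p){g} _g∘_f ω{d e f} = (μ(p q r) _q∘_s φ(s){d}) _r∘_t φ(t){e}` -/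
  | morphism {a b a' b' y c' z : Biarity} (w : Gluing a b z)
      (w' : Gluing a' b' y) (w'' : Gluing y c' z)
      {p : z.Open} {d e : z.Closed}
      {p₁ : a.Open} {g₁ : a.Closed} (ha : IsMorphism a p₁ g₁)
      {d₁ e₁ f₁ : b.Closed} (hb : IsClosedPants b d₁ e₁ f₁)
      {p₂ q₂ r₂ : a'.Open} (ha' : IsOpenPants a' p₂ q₂ r₂)
      {s₂ : b'.Open} {d₂ : b'.Closed} (hb' : IsMorphism b' s₂ d₂)
      {p₃ r₃ : y.Open} {d₃ : y.Closed}
      {t₂ : c'.Open} {e₂ : c'.Closed} (hc' : IsMorphism c' t₂ e₂)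
      (hw : w.GluesClosed g₁ f₁)
      (hp : w.openMap p = Sum.inl p₁)
      (hd : w.closedMap d = Sum.inr d₁) (he : w.closedMap e = Sum.inr e₁)
      (hw' : w'.GluesOpen q₂ s₂)
      (hp' : w'.openMap p₃ = Sum.inl p₂) (hr' : w'.openMap r₃ = Sum.inl r₂)
      (hd' : w'.closedMap d₃ = Sum.inr d₂)
      (hw'' : w''.GluesOpen r₃ t₂)
      (hp'' : w''.openMap p = Sum.inl p₃)
      (hd'' : w''.closedMap d = Sum.inl d₃) (he'' : w''.closedMap e = Sum.inr e₂) :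
      Relation z
        ((freeHybrid generators).comp w (phi p₁ g₁ ha) (omega d₁ e₁ f₁ hb))
        ((freeHybrid generators).comp w''
          ((freeHybrid generators).comp w' (mu p₂ q₂ r₂ ha') (phi s₂ d₂ hb'))
          (phi t₂ e₂ hc'))
  /-- `μ(p q r) _q∘_s φ(s){d} = μ(p r q) _q∘_s φ(s){d}` -/
  | centrality {a b a' b' z : Biarity} (w : Gluing a b z) (w' : Gluing a' b' z)
      {p r : z.Open} {d : z.Closed}
      {p₁ q₁ r₁ : a.Open} (ha : IsOpenPants a p₁ q₁ r₁)
      {s₁ : b.Open} {d₁ : b.Closed} (hb : IsMorphism b s₁ d₁)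
      {p₂ r₂ q₂ : a'.Open} (ha' : IsOpenPants a' p₂ r₂ q₂)
      {s₂ : b'.Open} {d₂ : b'.Closed} (hb' : IsMorphism b' s₂ d₂)
      (hw : w.GluesOpen q₁ s₁)
      (hp : w.openMap p = Sum.inl p₁) (hr : w.openMap r = Sum.inl r₁)
      (hd : w.closedMap d = Sum.inr d₁)
      (hw' : w'.GluesOpen q₂ s₂)
      (hp' : w'.openMap p = Sum.inl p₂) (hr' : w'.openMap r = Sum.inl r₂)
      (hd' : w'.closedMap d = Sum.inr d₂) :
      Relation z
        ((freeHybrid generators).comp w (mu p₁ q₁ r₁ ha) (phi s₁ d₁ hb))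
        ((freeHybrid generators).comp w' (mu p₂ r₂ q₂ ha') (phi s₂ d₂ hb'))

/-- The ideal `𝒥` generated by the four relations. -/
def relationIdeal : Ideal (freeHybrid generators) :=
  generatedIdeal (freeHybrid generators) Relation

/-- The cyclic hybrid presented by the three generators and the four relations. -/
def presentedHybrid : CyclicHybrid :=
  (freeHybrid generators).quotient relationIdeal

/-! ## The Kaufmann-Penner cyclic hybrid -/

/-- The component of the quantum open-closed modular hybrid: the geometric genera `g` of the
surfaces with the given open boundaries, closed inputs and operadic genus `G = 2g + b - 1 + |C|/2`. -/
def quantumOC (a : Biarity) : Set ℕ :=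
  {g | a.genus = 2 * g + a.numBoundaries - 1 + (Nat.card a.Closed : ℚ) / 2}

/-- The stability condition `2(G - 1) + |O| + |C| > 0`. -/
def Biarity.IsStable (a : Biarity) : Prop :=
  0 < 2 * (a.genus - 1) + Nat.card a.Open + Nat.card a.Closed

/-- At least three boundaries, all empty, and no closed inputs. -/
def Biarity.IsTypeOne (a : Biarity) : Prop :=
  Nat.card a.Closed = 0 ∧ ∃ n ≥ 3, a.cycles = Multiset.replicate n Cycle.nil

/-- At least two boundaries, all but one of them empty, and no closed inputs. -/
def Biarity.IsTypeTwo (a : Biarity) : Prop :=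
  Nat.card a.Closed = 0 ∧
    ∃ n ≥ 1, ∃ o : Cycle a.Open, o ≠ Cycle.nil ∧ a.cycles = o ::ₘ Multiset.replicate n Cycle.nil

/-- At least two boundaries, all empty, and exactly one closed input. -/
def Biarity.IsTypeThree (a : Biarity) : Prop :=
  Nat.card a.Closed = 1 ∧ ∃ n ≥ 2, a.cycles = Multiset.replicate n Cycle.nil

/-- The component of the Kaufmann-Penner cyclic hybrid: the symbols of the quantum open-closed hybrid
of geometric genus `0` (those of the open-closed hybrid) which are stable, without those of the
three exceptional types. -/
def kaufmannPennerSet (a : Biarity) : Set ℕ :=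
  {g | g ∈ quantumOC a ∧ g = 0 ∧ a.IsStable ∧ ¬ a.IsTypeOne ∧ ¬ a.IsTypeTwo ∧ ¬ a.IsTypeThree}

section Counting

open Classical in
/-- The number of nonempty cycles. -/
noncomputable def numNonempty {O : Type} (M : Multiset (Cycle O)) : ℕ := M.countP (fun c => c ≠ Cycle.nil)

/-- The number of labels occurring in the cycles. -/
def numLabels {O : Type} (M : Multiset (Cycle O)) : ℕ := (M.map Cycle.length).sum

theorem numLabels_eq {O : Type} (M : Multicycle O) : numLabels M.cycles = Nat.card O := by
  classical
  have h1 : ∀ x, x ∈ M.cycles.bind Cycle.toMultiset := by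
    intro x
    obtain ⟨c, hc, hx⟩ := M.cover x
    refine Multiset.mem_bind.2 ⟨c, hc, ?_⟩
    induction c using Quotient.inductionOn with
    | h l => simpa using hx
  let s : Finset O := ⟨_, M.nodup⟩
  let _ : Fintype O := ⟨s, h1⟩
  rw [Nat.card_eq_fintype_card]
  change _ = Multiset.card (M.cycles.bind Cycle.toMultiset)
  rw [Multiset.card_bind]
  unfold numLabels
  congr 1
  exact Multiset.map_congr rfl (fun c _ => (Cycle.card_toMultiset c).symm)

theorem cycle_length_map {A B : Type} (f : A → B) (c : Cycle A) :
    (Cycle.map f c).length = c.length := by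
  induction c using Quotient.inductionOn with
  | h l => simp

theorem numLabels_map {A B : Type} (f : A → B) (M : Multiset (Cycle A)) :
    numLabels (M.map (Cycle.map f)) = numLabels M := by
  unfold numLabels
  rw [Multiset.map_map]
  congr 1
  exact Multiset.map_congr rfl (fun c _ => cycle_length_map f c)

theorem numNonempty_map {A B : Type} (f : A → B) (M : Multiset (Cycle A)) :
    numNonempty (M.map (Cycle.map f)) = numNonempty M := by
  classical
  unfold numNonempty
  rw [Multiset.countP_map, Multiset.countP_eq_card_filter]
  simp

theorem numNonempty_add {A : Type} (M N : Multiset (Cycle A)) :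
    numNonempty (M + N) = numNonempty M + numNonempty N := by
  simp [numNonempty]

theorem numLabels_add {A : Type} (M N : Multiset (Cycle A)) :
    numLabels (M + N) = numLabels M + numLabels N := by
  simp [numLabels]

theorem numLabels_cons {A : Type} (l : List A) (M : Multiset (Cycle A)) :
    numLabels ((l : Cycle A) ::ₘ M) = l.length + numLabels M := by
  simp [numLabels]

theorem numNonempty_cons {A : Type} (l : List A) (M : Multiset (Cycle A)) :
    numNonempty ((l : Cycle A) ::ₘ M) = (if l.length = 0 then 0 else 1) + numNonempty M := by
  by_cases h : l = []
  · simp [numNonempty, h]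
  · simp [numNonempty, h, add_comm]

theorem eq_replicate_of_numNonempty {A : Type} {M : Multiset (Cycle A)} (h : numNonempty M = 0) :
    M = Multiset.replicate (Multiset.card M) Cycle.nil := by
  classical
  rw [numNonempty, Multiset.countP_eq_zero] at h
  exact Multiset.eq_replicate.2 ⟨rfl, fun c hc => not_not.1 (h c hc)⟩

theorem numNonempty_replicate {A : Type} (n : ℕ) :
    numNonempty (Multiset.replicate n (Cycle.nil : Cycle A)) = 0 := by
  classical
  rw [numNonempty, Multiset.countP_eq_zero]
  intro c hc
  simpa using Multiset.eq_of_mem_replicate hc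

theorem exists_cons_of_numNonempty {A : Type} {M : Multiset (Cycle A)} (h : 0 < numNonempty M) :
    ∃ (o : Cycle A) (N : Multiset (Cycle A)), o ≠ Cycle.nil ∧ M = o ::ₘ N ∧
      numNonempty M = numNonempty N + 1 := by
  classical
  rw [numNonempty, Multiset.countP_pos] at h
  obtain ⟨o, ho, hne⟩ := h
  obtain ⟨N, rfl⟩ := Multiset.exists_cons_of_mem ho
  refine ⟨o, N, hne, rfl, ?_⟩
  simp [numNonempty, hne]

theorem numLabels_le_of_numNonempty {A : Type} {M : Multiset (Cycle A)} :
    numNonempty M ≤ numLabels M := by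
  induction M using Multiset.induction_on with
  | empty => simp [numNonempty]
  | cons c M ih =>
    induction c using Quotient.inductionOn with
    | h l =>
      have h1 := numNonempty_cons l M
      have h2 := numLabels_cons l M
      simp only [Cycle.mk''_eq_coe] at *
      change numNonempty ((l : Cycle A) ::ₘ M) ≤ numLabels ((l : Cycle A) ::ₘ M)
      rw [h1, h2]
      split_ifs <;> omega

/-- The explicit list of the biarities of the elements of the Kaufmann-Penner hybrid. -/
theorem mem_kaufmannPennerSet (a : Biarity) (g : ℕ) :
    g ∈ kaufmannPennerSet a ↔ g = 0 ∧
      a.genus = a.numBoundaries - 1 + (Nat.card a.Closed : ℚ) / 2 ∧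
      (2 ≤ a.numBoundaries → 2 ≤ Nat.card a.Closed + numNonempty a.cycles) ∧
      (a.numBoundaries = 1 → 2 < Nat.card a.Open + 2 * Nat.card a.Closed) ∧
      (a.numBoundaries = 0 → 3 ≤ Nat.card a.Closed) := by
  have hO := numLabels_eq a.multicycle
  change numLabels a.cycles = Nat.card a.Open at hO
  have hk := numLabels_le_of_numNonempty (M := a.cycles)
  simp only [kaufmannPennerSet, quantumOC, Set.mem_ofPred_eq]
  have key : g = 0 → a.genus = a.numBoundaries - 1 + (Nat.card a.Closed : ℚ) / 2 →
      (a.IsStable ↔ 4 < 2 * a.numBoundaries + 2 * Nat.card a.Closed + Nat.card a.Open) := by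
    intro _ h
    rw [Biarity.IsStable, h]
    constructor
    · intro h
      have : (4 : ℚ) < 2 * a.numBoundaries + 2 * Nat.card a.Closed + Nat.card a.Open := by linarith
      exact_mod_cast this
    · intro h
      have : (4 : ℚ) < 2 * a.numBoundaries + 2 * Nat.card a.Closed + Nat.card a.Open := by
        exact_mod_cast h
      linarith
  constructor
  · rintro ⟨hg, rfl, hs, h1, h2, h3⟩
    have hg' : a.genus = a.numBoundaries - 1 + (Nat.card a.Closed : ℚ) / 2 := by
      rw [hg]; simp
    rw [key rfl hg'] at hs
    refine ⟨rfl, hg', ?_, ?_, ?_⟩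
    · intro hb
      by_contra hlt
      by_cases h0 : numNonempty a.cycles = 0
      · have hrep := eq_replicate_of_numNonempty h0
        have hO0 : Nat.card a.Open = 0 := by
          rw [← hO, hrep]; simp [numLabels]
        change a.cycles = Multiset.replicate a.numBoundaries _ at hrep
        by_cases hc : Nat.card a.Closed = 0
        · exact h1 ⟨hc, _, by omega, hrep⟩
        · exact h3 ⟨by omega, _, hb, hrep⟩
      · obtain ⟨o, N, ho, hN, hc⟩ := exists_cons_of_numNonempty (Nat.pos_of_ne_zero h0)
        have hN0 := eq_replicate_of_numNonempty (M := N) (by omega)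
        refine h2 ⟨by omega, _, ?_, o, ho, hN0 ▸ hN⟩
        have : a.numBoundaries = Multiset.card N + 1 := by
          rw [Biarity.numBoundaries, hN, Multiset.card_cons]
        omega
    · intro hb; omega
    · intro hb
      have : a.cycles = 0 := Multiset.card_eq_zero.1 hb
      have hO0 : Nat.card a.Open = 0 := by rw [← hO, this]; simp [numLabels]
      omega
  · rintro ⟨rfl, hg, h2, h1, h0⟩
    refine ⟨by rw [hg]; simp, rfl, ?_, ?_, ?_, ?_⟩
    · rw [key rfl hg]
      rcases Nat.lt_or_ge a.numBoundaries 2 with h | h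
      · interval_cases hb : a.numBoundaries
        · have := h0 rfl; omega
        · have := h1 rfl; omega
      · have := h2 h; omega
    · rintro ⟨hc, n, hn, hrep⟩
      have hb : a.numBoundaries = n := by rw [Biarity.numBoundaries, hrep]; simp
      have := h2 (by omega)
      rw [hrep, numNonempty_replicate] at this
      omega
    · rintro ⟨hc, n, hn, o, ho, hrep⟩
      have hb : a.numBoundaries = n + 1 := by rw [Biarity.numBoundaries, hrep]; simp
      have := h2 (by omega)
      have h' : numNonempty a.cycles = 1 := by
        classical
        have h'' := numNonempty_replicate (A := a.Open) n
        unfold numNonempty at h'' ⊢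
        rw [hrep, Multiset.countP_cons_of_pos (p := fun c => c ≠ Cycle.nil) _ ho, h'']
      omega
    · rintro ⟨hc, n, hn, hrep⟩
      have hb : a.numBoundaries = n := by rw [Biarity.numBoundaries, hrep]; simp
      have := h2 (by omega)
      rw [hrep, numNonempty_replicate] at this
      omega

theorem kaufmannPennerSet_map {a b : Biarity} (f : Biarity.Iso a b) {g : ℕ}
    (h : g ∈ kaufmannPennerSet a) : g ∈ kaufmannPennerSet b := by
  rw [mem_kaufmannPennerSet] at h ⊢
  have h1 : a.numBoundaries = b.numBoundaries := by
    rw [Biarity.numBoundaries, Biarity.numBoundaries, ← f.map_cycles, Multiset.card_map]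
  have h2 : numNonempty a.cycles = numNonempty b.cycles := by
    rw [← f.map_cycles, numNonempty_map]
  rwa [← h1, ← h2, ← f.genus_eq, ← Nat.card_congr f.openEquiv, ← Nat.card_congr f.closedEquiv]

theorem Gluing.mem_range_closedMap {a b r : Biarity} (w : Gluing a b r) (y : a.Closed ⊕ b.Closed) :
    y ∈ Set.range w.closedMap ↔
      Sum.map Sum.inr Sum.inr y ∈ ({Sum.inl w.left, Sum.inr w.right}ᶜ : Set (a.Leg ⊕ b.Leg)) := by
  rw [← w.range_eq]
  constructor
  · rintro ⟨x, rfl⟩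
    exact ⟨Sum.inr x, rfl⟩
  · rintro ⟨x | x, hx⟩
    · exfalso
      simp only [legMap, Sum.elim_inl] at hx
      rcases hy : w.openMap x with z | z <;> rcases y with y | y <;> simp [hy] at hx
    · refine ⟨x, ?_⟩
      simp only [legMap, Sum.elim_inr] at hx
      exact (Sum.map_injective.2 ⟨Sum.inr_injective, Sum.inr_injective⟩) hx

theorem Gluing.closedMap_injective {a b r : Biarity} (w : Gluing a b r) :
    Function.Injective w.closedMap := by
  intro x y h
  have := @w.injective (Sum.inr x) (Sum.inr y) (by simp [legMap, h])
  exact Sum.inr_injective this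

theorem kaufmannPennerSet_comp {a b r : Biarity} (w : Gluing a b r) {g g' : ℕ}
    (h : g ∈ kaufmannPennerSet a) (h' : g' ∈ kaufmannPennerSet b) :
    g + g' ∈ kaufmannPennerSet r := by
  have := a.closed_finite
  have := b.closed_finite
  rw [mem_kaufmannPennerSet] at h h' ⊢
  obtain ⟨rfl, hG, h2, h1, h0⟩ := h
  obtain ⟨rfl, hG', h2', h1', h0'⟩ := h'
  have hO := numLabels_eq a.multicycle
  have hO' := numLabels_eq b.multicycle
  have hO'' := numLabels_eq r.multicycle
  have hk := numLabels_le_of_numNonempty (M := a.cycles)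
  have hk' := numLabels_le_of_numNonempty (M := b.cycles)
  have hz : a.numBoundaries = 1 → numNonempty a.cycles = 0 → numLabels a.cycles = 0 := by
    intro _ h
    rw [eq_replicate_of_numNonempty h]; simp [numLabels]
  have hz' : b.numBoundaries = 1 → numNonempty b.cycles = 0 → numLabels b.cycles = 0 := by
    intro _ h
    rw [eq_replicate_of_numNonempty h]; simp [numLabels]
  have hmb : Multiset.card (r.cycles.map (Cycle.map w.openMap)) = r.numBoundaries :=
    Multiset.card_map _ _
  have hmk := numNonempty_map w.openMap r.cycles
  have hml := numLabels_map w.openMap r.cycles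
  refine ⟨rfl, ?_⟩
  rcases w.cycles_eq with ⟨u, v, hl, hr, s, t, M, N, hM, hN, hK⟩ | ⟨c, d, hl, hr, hK⟩
  · have hC : Nat.card r.Closed = Nat.card a.Closed + Nat.card b.Closed := by
      rw [← Nat.card_sum]
      refine Nat.card_eq_of_bijective w.closedMap ⟨w.closedMap_injective, fun y => ?_⟩
      change y ∈ Set.range w.closedMap
      rw [w.mem_range_closedMap, hl, hr]
      rcases y with y | y <;> simp
    change a.cycles = _ at hM
    change b.cycles = _ at hN
    change r.cycles.map _ = _ at hK
    change numLabels a.cycles = _ at hO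
    change numLabels b.cycles = _ at hO'
    change numLabels r.cycles = _ at hO''
    have e1 : a.numBoundaries = Multiset.card M + 1 := by
      rw [Biarity.numBoundaries, hM, Multiset.card_cons]
    have e2 : b.numBoundaries = Multiset.card N + 1 := by
      rw [Biarity.numBoundaries, hN, Multiset.card_cons]
    rw [hK] at hmb hmk hml
    simp only [Multiset.card_cons, Multiset.card_add, Multiset.card_map] at hmb
    rw [numLabels_cons, numLabels_add, numLabels_map, numLabels_map] at hml
    rw [numNonempty_cons, numNonempty_add, numNonempty_map, numNonempty_map] at hmk
    rw [hM, numLabels_cons] at hO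
    rw [hN, numLabels_cons] at hO'
    have k1 : numNonempty a.cycles = 1 + numNonempty M := by
      rw [hM, numNonempty_cons]; simp
    have k2 : numNonempty b.cycles = 1 + numNonempty N := by
      rw [hN, numNonempty_cons]; simp
    have z1 : Multiset.card M = 0 → numLabels M = 0 := by
      intro h; rw [Multiset.card_eq_zero.1 h]; simp [numLabels]
    have z2 : Multiset.card N = 0 → numLabels N = 0 := by
      intro h; rw [Multiset.card_eq_zero.1 h]; simp [numLabels]
    simp only [List.length_append, List.length_map, List.length_cons] at *
    refine ⟨?_, ?_, ?_, ?_⟩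
    · rw [w.genus_eq, hG, hG', hC, ← hmb, e1, e2]; push_cast; ring
    · intro hb; split_ifs at hmk <;> omega
    · intro hb; omega
    · intro hb; omega
  · have hC : Nat.card r.Closed + 2 = Nat.card a.Closed + Nat.card b.Closed := by
      rw [← Nat.card_sum]
      have hrange : Set.range w.closedMap = {Sum.inl c, Sum.inr d}ᶜ := by
        ext y
        rw [w.mem_range_closedMap, hl, hr]
        rcases y with y | y <;> simp
      have e := Set.ncard_add_ncard_compl ({Sum.inl c, Sum.inr d} : Set (a.Closed ⊕ b.Closed))
      rw [← hrange, Set.ncard_pair (by simp), ← Nat.card_coe_set_eq,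
        Nat.card_range_of_injective w.closedMap_injective] at e
      omega
    have p1 : 0 < Nat.card a.Closed := Nat.card_pos_iff.2 ⟨⟨c⟩, inferInstance⟩
    have p2 : 0 < Nat.card b.Closed := Nat.card_pos_iff.2 ⟨⟨d⟩, inferInstance⟩
    change r.cycles.map _ = _ at hK
    rw [hK] at hmb hmk hml
    rw [numLabels_add, numLabels_map, numLabels_map] at hml
    rw [numNonempty_add, numNonempty_map, numNonempty_map] at hmk
    simp only [Multiset.card_add, Multiset.card_map] at hmb
    change a.numBoundaries + b.numBoundaries = _ at hmb
    change numLabels a.cycles = _ at hO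
    change numLabels b.cycles = _ at hO'
    change numLabels r.cycles = _ at hO''
    refine ⟨?_, ?_, ?_, ?_⟩
    · have hC' : (Nat.card r.Closed : ℚ) + 2 = Nat.card a.Closed + Nat.card b.Closed := by
        exact_mod_cast hC
      rw [w.genus_eq, hG, hG', ← hmb]; push_cast; linarith
    · intro hb
      change numNonempty a.cycles + numNonempty b.cycles = numNonempty r.cycles at hmk
      omega
    · intro hb; omega
    · intro hb; omega

end Counting

theorem kaufmannPenner_ext {a : Biarity} (x y : kaufmannPennerSet a) : x = y :=
  Subtype.ext (x.2.2.1.trans y.2.2.1.symm)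

/-- The Kaufmann-Penner open-closed cyclic hybrid.  Isomorphisms relabel the inputs, and the
geometric genera add up under the compositions. -/
def kaufmannPenner : CyclicHybrid.{0} where
  obj a := kaufmannPennerSet a
  map f x := ⟨x.1, kaufmannPennerSet_map f x.2⟩
  map_refl _ := rfl
  map_trans _ _ _ := rfl
  comp w x y := ⟨x.1 + y.1, kaufmannPennerSet_comp w x.2 y.2⟩
  equivariant _ _ _ _ _ _ _ _ := rfl
  commutative _ _ _ _ _ := kaufmannPenner_ext _ _
  associative _ _ _ _ _ _ _ _ := kaufmannPenner_ext _ _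

end OpenClosed

/-! Every component of `kaufmannPenner` has at most one element. The theorem therefore says that the
presented hybrid has exactly one element in each stable, non-exceptional component of geometric
genus zero, and none elsewhere. The second half is formal: the generators live in such components,
and these are closed under gluing (`presentedHybrid_bounded`). This also yields the morphism to
`kaufmannPenner`, whose compatibilities are automatic.

The first half is an induction on surfaces. The number 2b + 2|C| + |O| exceeds the stability
quantity 2(G - 1) + |O| + |C| by 4, and the latter is positive and additive under gluing. Hence both
pieces of a composite are strictly smaller than the whole (`Glues.size`,
`Shape.Valid.five_le_size`). For each valid shape other than those of the generators a standard cut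
into two valid pieces is fixed. Existence follows by gluing the pieces. For uniqueness it is enough
that every element admits the standard cut, because its two pieces are unique by induction
(`Cut.same`).

An element that is not a generator is a composite, hence has some cut, which has to be moved to the
standard one. The engine is `Cut.move`: the left piece is smaller, hence the only element of its
shape, and may be cut again in any admissible way; associativity trades the old cut for the new one.
The relations enter only in minimal configurations that such moves cannot resolve: closed
associativity for spheres, open associativity for discs without closed inputs, centrality for discs
with one closed input, the morphism property for nonempty discs with at least two. Discs with empty
boundary and surfaces with several boundaries need no further relation.

Isomorphisms are controlled by labelling all inputs injectively by natural numbers. A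
label-preserving isomorphism is unique, identities between gluings can be tested on labels, and the
combinatorics reduces to cycles and multisets of numbers (`Shape`, `Glues`). -/

namespace OpenClosed

/-! ## Shapes of labelled biarities -/

/-- The isomorphism class of a biarity with inputs labelled by natural numbers, up to the genus. -/
@[ext] structure Shape where
  cycles : Multiset (Cycle ℕ)
  closed : Multiset ℕ

/-- All labels of a shape. -/
def Shape.labels (T : Shape) : Multiset ℕ := T.cycles.bind Cycle.toMultiset + T.closed

/-- A number which is, up to the shift by `4`, additive under gluing. -/
def Shape.size (T : Shape) : ℕ :=
  2 * Multiset.card T.cycles + 2 * Multiset.card T.closed + numLabels T.cycles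

/-- The conditions characterizing the shapes of the elements of the Kaufmann-Penner hybrid. -/
def Shape.Valid (T : Shape) : Prop :=
  (2 ≤ Multiset.card T.cycles → 2 ≤ Multiset.card T.closed + numNonempty T.cycles) ∧
  (Multiset.card T.cycles = 1 → 2 < numLabels T.cycles + 2 * Multiset.card T.closed) ∧
  (Multiset.card T.cycles = 0 → 3 ≤ Multiset.card T.closed)

theorem numLabels_zero {A : Type} : numLabels (0 : Multiset (Cycle A)) = 0 := by
  simp [numLabels]

/-- With G = b - 1 + |C|/2 the size is 4 more than 2(G - 1) + |O| + |C|, so that the bound 5 is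
stability. Together with `Glues.size` it makes both pieces of a gluing strictly smaller than the
result. -/
theorem Shape.Valid.five_le_size {T : Shape} (h : T.Valid) : 5 ≤ T.size := by
  obtain ⟨h2, h1, h0⟩ := h
  have := numLabels_le_of_numNonempty (M := T.cycles)
  unfold Shape.size
  rcases Nat.lt_or_ge (Multiset.card T.cycles) 2 with h | h
  · interval_cases Multiset.card T.cycles
    · have := h0 rfl; omega
    · have := h1 rfl; omega
  · have := h2 h; omega

/-- Gluing of the label `u` of the first to the label `v` of the second shape. -/
inductive Glues (u v : ℕ) : Shape → Shape → Shape → Prop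
  | ofOpen (s t : List ℕ) (M N : Multiset (Cycle ℕ)) (C D : Multiset ℕ) :
      Glues u v ⟨((u :: s : List ℕ) : Cycle ℕ) ::ₘ M, C⟩ ⟨((v :: t : List ℕ) : Cycle ℕ) ::ₘ N, D⟩
        ⟨((s ++ t : List ℕ) : Cycle ℕ) ::ₘ (M + N), C + D⟩
  | ofClosed (M N : Multiset (Cycle ℕ)) (C D : Multiset ℕ) :
      Glues u v ⟨M, u ::ₘ C⟩ ⟨N, v ::ₘ D⟩ ⟨M + N, C + D⟩

/-- Gluing consumes only the two glued labels. Freshness of `u` and `v` for the result is thus the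
same as absence of repetitions among the labels of the two pieces together. -/
theorem Glues.labels {u v : ℕ} {A B T : Shape} (h : Glues u v A B T) :
    A.labels + B.labels = u ::ₘ v ::ₘ T.labels := by
  cases h with
  | ofOpen s t M N C D =>
    simp only [Shape.labels, Multiset.cons_bind, Multiset.add_bind, Cycle.coe_toMultiset]
    simp only [← Multiset.coe_add, ← Multiset.cons_coe, ← Multiset.singleton_add]
    abel
  | ofClosed M N C D =>
    simp only [Shape.labels, Multiset.add_bind, ← Multiset.singleton_add]
    abel

/-- An open gluing loses one cycle of weight 2 and two labels of weight 1, a closed gluing two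
closed inputs of weight 2: the shift is 4 in both cases. -/
theorem Glues.size {u v : ℕ} {A B T : Shape} (h : Glues u v A B T) :
    A.size + B.size = T.size + 4 := by
  cases h with
  | ofOpen s t M N C D =>
    simp only [Shape.size, numLabels_cons, numLabels_add, Multiset.card_cons, Multiset.card_add,
      List.length_append, List.length_cons]
    ring
  | ofClosed M N C D =>
    simp only [Shape.size, numLabels_add, Multiset.card_cons, Multiset.card_add]
    ring

theorem coe_append_comm (s t : List ℕ) : ((s ++ t : List ℕ) : Cycle ℕ) = ((t ++ s : List ℕ) : Cycle ℕ) :=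
  Cycle.coe_eq_coe.2 List.isRotated_append

theorem Glues.symm {u v : ℕ} {A B T : Shape} (h : Glues u v A B T) : Glues v u B A T := by
  cases h with
  | ofOpen s t M N C D =>
    rw [coe_append_comm, add_comm M, add_comm C]
    exact .ofOpen t s N M D C
  | ofClosed M N C D =>
    rw [add_comm M, add_comm C]
    exact .ofClosed N M D C

/-- A rotation that fixes the first entry of a list without repetitions is trivial. -/
theorem eq_of_coe_cons_eq {u : ℕ} {s t : List ℕ} (hn : (u :: s).Nodup)
    (h : ((u :: s : List ℕ) : Cycle ℕ) = ((u :: t : List ℕ) : Cycle ℕ)) : s = t := by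
  obtain ⟨n, hlt, hn'⟩ := List.isRotated_iff_mod.1 (Cycle.coe_eq_coe.1 h)
  have hlen : n < (u :: s).length ∨ n = (u :: s).length := lt_or_eq_of_le hlt
  rcases hlen with hlt | rfl
  · have h0 : (u :: s)[n]'hlt = u := by
      have := List.getElem_rotate (u :: s) n 0 (by simp)
      simp only [hn', List.getElem_cons_zero, Nat.zero_add, Nat.mod_eq_of_lt hlt] at this
      exact this.symm
    have : n = 0 := (hn.getElem_inj_iff (hi := hlt) (hj := by simp)).1 h0
    subst this
    simpa using hn'
  · simpa using hn'

/-- A label lies in one cycle only, and the rest of the cycle is determined. -/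
theorem cons_cycle_unique {u : ℕ} {s t : List ℕ} {M N : Multiset (Cycle ℕ)}
    (hn : ((((u :: s : List ℕ) : Cycle ℕ) ::ₘ M).bind Cycle.toMultiset).Nodup)
    (h : ((u :: s : List ℕ) : Cycle ℕ) ::ₘ M = ((u :: t : List ℕ) : Cycle ℕ) ::ₘ N) :
    s = t ∧ M = N := by
  rw [Multiset.cons_bind, Cycle.coe_toMultiset, Multiset.nodup_add] at hn
  obtain ⟨h1, -, h3⟩ := hn
  have hu : ∀ c ∈ M, u ∉ c := fun c hc hu => Multiset.disjoint_left.1 h3 (by simp)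
    (Multiset.mem_bind.2 ⟨c, hc, (mem_cycle_toMultiset c u).2 hu⟩)
  have hc : ((u :: s : List ℕ) : Cycle ℕ) = ((u :: t : List ℕ) : Cycle ℕ) := by
    by_contra hne
    have : ((u :: t : List ℕ) : Cycle ℕ) ∈ ((u :: s : List ℕ) : Cycle ℕ) ::ₘ M := by simp [h]
    rcases Multiset.mem_cons.1 this with e | e
    · exact hne e.symm
    · exact hu _ e (by simp)
  refine ⟨eq_of_coe_cons_eq (by simpa using h1) hc, ?_⟩
  rw [hc] at h
  exact (Multiset.cons_inj_right _).1 h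

/-- Since no label is repeated, `u` and `v` determine the colour of the gluing and the cycles that
are merged. Results of gluings can therefore be computed on shapes. -/
theorem Glues.unique {u v : ℕ} {A B T T' : Shape} (hA : A.labels.Nodup) (hB : B.labels.Nodup)
    (h : Glues u v A B T) (h' : Glues u v A B T') : T = T' := by
  -- A label cannot be open and closed at once, which excludes the mixed cases.
  have key : ∀ {w : ℕ} {s : List ℕ} {M N : Multiset (Cycle ℕ)} {C D : Multiset ℕ} {S : Shape},
      S.labels.Nodup → S = ⟨((w :: s : List ℕ) : Cycle ℕ) ::ₘ M, C⟩ → S = ⟨N, w ::ₘ D⟩ → False := by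
    intro w s M N C D S hS h1 h2
    have e1 : S.cycles = _ := congrArg Shape.cycles h1
    have e2 : S.closed = _ := congrArg Shape.closed h2
    rw [Shape.labels, e1, e2, Multiset.nodup_add] at hS
    have hw : w ∈ (((w :: s : List ℕ) : Cycle ℕ) ::ₘ M).bind Cycle.toMultiset := by simp
    exact Multiset.disjoint_left.1 hS.2.2 hw (Multiset.mem_cons_self _ _)
  generalize hA' : A = A' at h'
  generalize hB' : B = B' at h'
  cases h with
  | ofOpen s t M N C D =>
    cases h' with
    | ofOpen s' t' M' N' C' D' =>
      simp only [Shape.mk.injEq] at hA' hB'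
      obtain ⟨hA1, rfl⟩ := hA'
      obtain ⟨hB1, rfl⟩ := hB'
      obtain ⟨rfl, rfl⟩ := cons_cycle_unique (Multiset.nodup_add.1 hA).1 hA1
      obtain ⟨rfl, rfl⟩ := cons_cycle_unique (Multiset.nodup_add.1 hB).1 hB1
      rfl
    | ofClosed M' N' C' D' => exact (key hA rfl hA').elim
  | ofClosed M N C D =>
    cases h' with
    | ofOpen s' t' M' N' C' D' => exact (key (hA' ▸ hA) rfl hA'.symm).elim
    | ofClosed M' N' C' D' =>
      simp only [Shape.mk.injEq, Multiset.cons_inj_right] at hA' hB'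
      obtain ⟨rfl, rfl⟩ := hA'
      obtain ⟨rfl, rfl⟩ := hB'
      rfl

/-! ## Labelled biarities -/

noncomputable instance (a : Biarity) : Fintype a.Closed :=
  have := a.closed_finite
  Fintype.ofFinite _

theorem Biarity.finite_open (a : Biarity) : Finite a.Open := by
  refine Set.finite_univ_iff.1 ((a.cycles.bind Cycle.toMultiset).finite_toSet.subset ?_)
  intro x _
  obtain ⟨c, hc, hx⟩ := a.multicycle.cover x
  exact Multiset.mem_bind.2 ⟨c, hc, (mem_cycle_toMultiset c x).2 hx⟩

theorem Biarity.exists_labelling (a : Biarity) : ∃ ℓ : a.Leg → ℕ, Function.Injective ℓ := by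
  have := a.closed_finite
  have := a.finite_open
  obtain ⟨n, ⟨e⟩⟩ := Finite.exists_equiv_fin a.Leg
  exact ⟨fun l => e l, fun x y h => e.injective (Fin.ext h)⟩

/-- The shape of a biarity with labelled inputs. -/
noncomputable def Biarity.shape (a : Biarity) (ℓ : a.Leg → ℕ) : Shape where
  cycles := a.cycles.map (Cycle.map (fun x => ℓ (Sum.inl x)))
  closed := (Finset.univ : Finset a.Closed).val.map (fun x => ℓ (Sum.inr x))

theorem Biarity.bind_toMultiset_mem (a : Biarity) (x : a.Open) :
    x ∈ a.cycles.bind Cycle.toMultiset := by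
  obtain ⟨c, hc, hx⟩ := a.multicycle.cover x
  exact Multiset.mem_bind.2 ⟨c, hc, (mem_cycle_toMultiset c x).2 hx⟩

theorem Biarity.mem_openLabels (a : Biarity) (ℓ : a.Leg → ℕ) (n : ℕ) :
    n ∈ (a.shape ℓ).cycles.bind Cycle.toMultiset ↔ ∃ x, ℓ (Sum.inl x) = n := by
  simp only [Biarity.shape, bind_toMultiset_map, Multiset.mem_map, a.bind_toMultiset_mem, true_and]

theorem Biarity.mem_closedLabels (a : Biarity) (ℓ : a.Leg → ℕ) (n : ℕ) :
    n ∈ (a.shape ℓ).closed ↔ ∃ x, ℓ (Sum.inr x) = n := by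
  simp [Biarity.shape]

theorem Biarity.mem_labels (a : Biarity) (ℓ : a.Leg → ℕ) (n : ℕ) :
    n ∈ (a.shape ℓ).labels ↔ ∃ x, ℓ x = n := by
  rw [Shape.labels, Multiset.mem_add, a.mem_openLabels, a.mem_closedLabels, Sum.exists]

theorem Biarity.nodup_labels (a : Biarity) {ℓ : a.Leg → ℕ} (h : Function.Injective ℓ) :
    (a.shape ℓ).labels.Nodup := by
  rw [Shape.labels, Multiset.nodup_add]
  refine ⟨?_, Finset.univ.nodup.map (h.comp Sum.inr_injective), ?_⟩
  · rw [Biarity.shape, bind_toMultiset_map]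
    exact a.multicycle.nodup.map (h.comp Sum.inl_injective)
  · rw [Multiset.disjoint_left]
    intro n h1 h2
    obtain ⟨x, rfl⟩ := (a.mem_openLabels ℓ n).1 h1
    obtain ⟨y, hy⟩ := (a.mem_closedLabels ℓ _).1 h2
    simpa using h hy

theorem Biarity.card_closed_shape (a : Biarity) (ℓ : a.Leg → ℕ) :
    Multiset.card (a.shape ℓ).closed = Nat.card a.Closed := by
  rw [Nat.card_eq_fintype_card]
  simp [Biarity.shape]

theorem Biarity.card_cycles_shape (a : Biarity) (ℓ : a.Leg → ℕ) :
    Multiset.card (a.shape ℓ).cycles = a.numBoundaries :=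
  Multiset.card_map _ _

/-- Inside the Kaufmann-Penner range the shape determines the genus, which is why shapes need not
record it. -/
theorem Biarity.mem_kaufmannPennerSet_iff (a : Biarity) (ℓ : a.Leg → ℕ) :
    0 ∈ kaufmannPennerSet a ↔ (a.shape ℓ).Valid ∧
      a.genus = Multiset.card (a.shape ℓ).cycles - 1 + (Multiset.card (a.shape ℓ).closed : ℚ) / 2 := by
  have h : numLabels (a.shape ℓ).cycles = Nat.card a.Open :=
    (numLabels_map _ _).trans (numLabels_eq a.multicycle)
  have h' : numNonempty (a.shape ℓ).cycles = numNonempty a.cycles := numNonempty_map _ _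
  rw [mem_kaufmannPennerSet, Shape.Valid, a.card_closed_shape, a.card_cycles_shape, h, h']
  tauto

theorem cycle_map_injective {A B : Type} {f : A → B} (hf : Function.Injective f) :
    Function.Injective (Cycle.map f) := by
  intro c d
  induction c, d using Quotient.inductionOn₂ with
  | h l l' =>
    intro h
    obtain ⟨n, hn⟩ := Cycle.coe_eq_coe.1 h
    rw [← List.map_rotate] at hn
    exact Cycle.coe_eq_coe.2 ⟨n, List.map_injective_iff.2 hf hn⟩

/-- Labelled biarities of the same shape and genus are isomorphic. -/
theorem Biarity.exists_iso {a b : Biarity} {ℓ : a.Leg → ℕ} {m : b.Leg → ℕ}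
    (hℓ : Function.Injective ℓ) (hm : Function.Injective m) (h : a.shape ℓ = b.shape m)
    (hg : a.genus = b.genus) : ∃ f : Biarity.Iso a b, ∀ x, m (f.leg x) = ℓ x := by
  have i1 : Function.Injective fun x => ℓ (Sum.inl x) := hℓ.comp Sum.inl_injective
  have i2 : Function.Injective fun x => ℓ (Sum.inr x) := hℓ.comp Sum.inr_injective
  have j1 : Function.Injective fun x => m (Sum.inl x) := hm.comp Sum.inl_injective
  have j2 : Function.Injective fun x => m (Sum.inr x) := hm.comp Sum.inr_injective
  have r1 : Set.range (fun x => ℓ (Sum.inl x)) = Set.range (fun x => m (Sum.inl x)) := by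
    ext n
    have := a.mem_openLabels ℓ n
    rw [h, b.mem_openLabels] at this
    exact this.symm
  have r2 : Set.range (fun x => ℓ (Sum.inr x)) = Set.range (fun x => m (Sum.inr x)) := by
    ext n
    have := a.mem_closedLabels ℓ n
    rw [h, b.mem_closedLabels] at this
    exact this.symm
  let f₁ := (Equiv.ofInjective _ i1).trans
    ((Equiv.setCongr r1).trans (Equiv.ofInjective _ j1).symm)
  let f₂ := (Equiv.ofInjective _ i2).trans
    ((Equiv.setCongr r2).trans (Equiv.ofInjective _ j2).symm)
  have h1 : ∀ x, m (Sum.inl (f₁ x)) = ℓ (Sum.inl x) := fun x =>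
    Equiv.apply_ofInjective_symm j1 _
  have h2 : ∀ x, m (Sum.inr (f₂ x)) = ℓ (Sum.inr x) := fun x =>
    Equiv.apply_ofInjective_symm j2 _
  refine ⟨⟨f₁, f₂, ?_, hg⟩, ?_⟩
  -- Equality of cycles may be tested after the injective relabelling by `m`.
  · apply Multiset.map_injective (cycle_map_injective j1)
    have : (a.shape ℓ).cycles = (b.shape m).cycles := by rw [h]
    refine Eq.trans ?_ this
    rw [Multiset.map_map]
    refine Multiset.map_congr rfl (fun c _ => ?_)
    rw [Function.comp_apply, cycle_map_map]
    congr 1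
    funext x
    exact h1 x
  · rintro (x | x)
    · exact h1 x
    · exact h2 x

/-- Every shape is the shape of a labelled biarity. -/
theorem Shape.exists_biarity (T : Shape) (hT : T.labels.Nodup) (n : ℕ) :
    ∃ (a : Biarity) (ℓ : a.Leg → ℕ), Function.Injective ℓ ∧ a.shape ℓ = T ∧ a.genus = n / 2 := by
  have hn := Multiset.nodup_add.1 hT
  obtain ⟨M, hM⟩ := exists_multicycle
    (Subtype.val : {x // x ∈ T.cycles.bind Cycle.toMultiset} → ℕ) Subtype.val_injective T.cycles
    hn.1 (fun x => by simp [Multiset.mem_bind, mem_cycle_toMultiset])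
  let a : Biarity := ⟨_, {x // x ∈ T.closed}, T.closed.finite_toSet, M, n / 2, n, rfl⟩
  let ℓ : a.Leg → ℕ := Sum.elim Subtype.val Subtype.val
  have hℓ : Function.Injective ℓ := by
    rintro (⟨x, hx⟩ | ⟨x, hx⟩) (⟨y, hy⟩ | ⟨y, hy⟩) h
    · cases h; rfl
    · cases h; exact (Multiset.disjoint_left.1 hn.2.2 hx hy).elim
    · cases h; exact (Multiset.disjoint_left.1 hn.2.2 hy hx).elim
    · cases h; rfl
  refine ⟨a, ℓ, hℓ, Shape.ext hM ?_, rfl⟩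
  refine (Multiset.Nodup.ext (Multiset.nodup_add.1 (a.nodup_labels hℓ)).2.1 hn.2.1).2 fun x => ?_
  rw [a.mem_closedLabels]
  exact ⟨fun ⟨⟨y, hy⟩, h⟩ => h ▸ hy, fun h => ⟨⟨x, h⟩, rfl⟩⟩

/-! ## Labelled gluings -/

/-- The gluing respects the given labellings of the inputs. -/
def Gluing.IsLabelled {a b r : Biarity} (w : Gluing a b r) (ℓ : a.Leg → ℕ) (m : b.Leg → ℕ)
    (k : r.Leg → ℕ) : Prop :=
  ∀ x, Sum.elim ℓ m (w.leg x) = k x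

theorem Gluing.leg_inl {a b r : Biarity} (w : Gluing a b r) (x : r.Open) :
    w.leg (Sum.inl x) = Sum.map Sum.inl Sum.inl (w.openMap x) := rfl

theorem Gluing.leg_inr {a b r : Biarity} (w : Gluing a b r) (x : r.Closed) :
    w.leg (Sum.inr x) = Sum.map Sum.inr Sum.inr (w.closedMap x) := rfl

theorem Gluing.mem_range_leg {a b r : Biarity} (w : Gluing a b r) (y : a.Leg ⊕ b.Leg) :
    (∃ x, w.leg x = y) ↔ y ≠ Sum.inl w.left ∧ y ≠ Sum.inr w.right := by
  have : y ∈ Set.range w.leg ↔ y ∈ ({Sum.inl w.left, Sum.inr w.right}ᶜ : Set (a.Leg ⊕ b.Leg)) := by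
    rw [← w.range_eq]; rfl
  simpa using this

/-- Computes the closed inputs of a gluing: `P` and `Q` are all closed inputs of the pieces for an
open gluing, and all but the glued ones for a closed gluing. -/
theorem univ_val_map_sum {A B R X : Type} [Fintype A] [Fintype B] [Fintype R] (g : R → A ⊕ B)
    (hg : Function.Injective g) (P : Finset A) (Q : Finset B)
    (h : ∀ y, (∃ x, g x = y) ↔ Sum.elim (· ∈ P) (· ∈ Q) y) (f : A ⊕ B → X) :
    (Finset.univ : Finset R).val.map (fun x => f (g x)) =
      P.val.map (fun x => f (Sum.inl x)) + Q.val.map (fun x => f (Sum.inr x)) := by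
  have : (Finset.univ : Finset R).val.map g = P.val.map Sum.inl + Q.val.map Sum.inr := by
    refine (Multiset.Nodup.ext (Finset.univ.nodup.map hg) ?_).2 ?_
    · rw [Multiset.nodup_add]
      refine ⟨P.nodup.map Sum.inl_injective, Q.nodup.map Sum.inr_injective, ?_⟩
      rw [Multiset.disjoint_left]
      intro x hx hy
      obtain ⟨_, _, rfl⟩ := Multiset.mem_map.1 hx
      obtain ⟨_, _, h⟩ := Multiset.mem_map.1 hy
      cases h
    · intro y
      have := h y
      rcases y with y | y <;> simpa using this
  have h2 := congrArg (Multiset.map f) this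
  rw [Multiset.map_add, Multiset.map_map, Multiset.map_map, Multiset.map_map] at h2
  exact h2

/-- The bridge from gluings of biarities to the relation `Glues`: pushing the equation of the merged
or united multicycle forward along the labels leaves an equation between cycles of numbers. -/
theorem Gluing.IsLabelled.glues {a b r : Biarity} {w : Gluing a b r} {ℓ : a.Leg → ℕ}
    {m : b.Leg → ℕ} {k : r.Leg → ℕ} (h : w.IsLabelled ℓ m k) :
    Glues (ℓ w.left) (m w.right) (a.shape ℓ) (b.shape m) (r.shape k) := by
  classical
  have hO : ∀ x, Sum.elim (fun y => ℓ (Sum.inl y)) (fun y => m (Sum.inl y)) (w.openMap x) =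
      k (Sum.inl x) := by
    intro x
    rw [← h, w.leg_inl]
    cases w.openMap x <;> rfl
  have hC : ∀ x, Sum.elim (fun y => ℓ (Sum.inr y)) (fun y => m (Sum.inr y)) (w.closedMap x) =
      k (Sum.inr x) := by
    intro x
    rw [← h, w.leg_inr]
    cases w.closedMap x <;> rfl
  have eO : (r.shape k).cycles = (r.cycles.map (Cycle.map w.openMap)).map
      (Cycle.map (Sum.elim (fun y => ℓ (Sum.inl y)) (fun y => m (Sum.inl y)))) := by
    rw [Multiset.map_map]
    refine Multiset.map_congr rfl (fun c _ => ?_)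
    rw [Function.comp_apply, cycle_map_map]
    congr 1
    funext x
    exact (hO x).symm
  have eC : (r.shape k).closed = (Finset.univ : Finset r.Closed).val.map (fun x =>
      Sum.elim (fun y => ℓ (Sum.inr y)) (fun y => m (Sum.inr y)) (w.closedMap x)) :=
    Multiset.map_congr rfl (fun x _ => (hC x).symm)
  rcases w.cycles_eq with ⟨u, v, hl, hr, s, t, M, N, hM, hN, hK⟩ | ⟨c, d, hl, hr, hK⟩
  · change a.cycles = _ at hM
    change b.cycles = _ at hN
    change r.cycles.map _ = _ at hK
    have e1 : a.shape ℓ = ⟨((ℓ w.left :: s.map (fun y => ℓ (Sum.inl y)) : List ℕ) : Cycle ℕ) ::ₘ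
        M.map (Cycle.map fun y => ℓ (Sum.inl y)), (a.shape ℓ).closed⟩ := by
      refine Shape.ext ?_ rfl
      simp only [Biarity.shape, hM, hl]
      exact Multiset.map_cons _ _ _
    have e2 : b.shape m = ⟨((m w.right :: t.map (fun y => m (Sum.inl y)) : List ℕ) : Cycle ℕ) ::ₘ
        N.map (Cycle.map fun y => m (Sum.inl y)), (b.shape m).closed⟩ := by
      refine Shape.ext ?_ rfl
      simp only [Biarity.shape, hN, hr]
      exact Multiset.map_cons _ _ _
    have e3 : r.shape k = ⟨((s.map (fun y => ℓ (Sum.inl y)) ++ t.map (fun y => m (Sum.inl y)) :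
        List ℕ) : Cycle ℕ) ::ₘ (M.map (Cycle.map fun y => ℓ (Sum.inl y)) +
        N.map (Cycle.map fun y => m (Sum.inl y))), (a.shape ℓ).closed + (b.shape m).closed⟩ := by
      refine Shape.ext ?_ ?_
      · rw [eO, hK]
        simp only [Multiset.map_cons, Multiset.map_add, Multiset.map_map, Function.comp_def,
          cycle_map_map, Cycle.map_coe, List.map_append, List.map_map, Sum.elim_inl, Sum.elim_inr]
      · rw [eC]
        refine univ_val_map_sum w.closedMap w.closedMap_injective Finset.univ Finset.univ ?_ _
        intro y
        have := w.mem_range_closedMap y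
        rw [Set.mem_range, hl, hr] at this
        rw [this]
        rcases y with y | y <;> simp
    rw [e1, e2, e3]
    exact .ofOpen _ _ _ _ _ _
  · change r.cycles.map _ = _ at hK
    have e1 : a.shape ℓ = ⟨(a.shape ℓ).cycles,
        ℓ w.left ::ₘ (Finset.univ.erase c).val.map (fun y => ℓ (Sum.inr y))⟩ := by
      refine Shape.ext rfl ?_
      rw [hl, ← Multiset.map_cons (fun y => ℓ (Sum.inr y)), Finset.erase_val,
        Multiset.cons_erase (by simp)]
      rfl
    have e2 : b.shape m = ⟨(b.shape m).cycles,
        m w.right ::ₘ (Finset.univ.erase d).val.map (fun y => m (Sum.inr y))⟩ := by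
      refine Shape.ext rfl ?_
      rw [hr, ← Multiset.map_cons (fun y => m (Sum.inr y)), Finset.erase_val,
        Multiset.cons_erase (by simp)]
      rfl
    have e3 : r.shape k = ⟨(a.shape ℓ).cycles + (b.shape m).cycles,
        (Finset.univ.erase c).val.map (fun y => ℓ (Sum.inr y)) +
        (Finset.univ.erase d).val.map (fun y => m (Sum.inr y))⟩ := by
      refine Shape.ext ?_ ?_
      · rw [eO, hK]
        simp only [Multiset.map_add, Multiset.map_map, Function.comp_def, cycle_map_map,
          Sum.elim_inl, Sum.elim_inr]
        rfl
      · rw [eC]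
        refine univ_val_map_sum w.closedMap w.closedMap_injective _ _ ?_ _
        intro y
        have := w.mem_range_closedMap y
        rw [Set.mem_range, hl, hr] at this
        rw [this]
        rcases y with y | y <;> simp
    rw [e1, e2, e3]
    exact .ofClosed _ _ _ _

/-- Relabelling the result of a gluing. -/
theorem Gluing.exists_mapResult {a b r r' : Biarity} (w : Gluing a b r) (f : Biarity.Iso r r') :
    ∃ w' : Gluing a b r', w'.left = w.left ∧ w'.right = w.right ∧
      ∀ x, w'.leg (f.leg x) = w.leg x := by
  have hleg : ∀ x, legMap (a := a) (b := b) (r := r') (fun x => w.openMap (f.openEquiv.symm x))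
      (fun x => w.closedMap (f.closedEquiv.symm x)) (f.leg x) = w.leg x := by
    rintro (x | x) <;> simp [Biarity.Iso.leg, legMap, Gluing.leg]
  have hsurj : Function.Bijective f.leg :=
    ⟨Sum.map_injective.2 ⟨f.openEquiv.injective, f.closedEquiv.injective⟩,
      Sum.map_surjective.2 ⟨f.openEquiv.surjective, f.closedEquiv.surjective⟩⟩
  have hcyc : ∀ g : r.Open → a.Open ⊕ b.Open,
      r'.multicycle.cycles.map (Cycle.map fun x => g (f.openEquiv.symm x)) =
        r.multicycle.cycles.map (Cycle.map g) := by
    intro g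
    have h := f.map_cycles
    change _ = r'.multicycle.cycles at h
    rw [← h, Multiset.map_map]
    refine Multiset.map_congr rfl (fun c _ => ?_)
    rw [Function.comp_apply, cycle_map_map]
    congr 1
    funext x
    simp
  refine ⟨⟨w.left, w.right, fun x => w.openMap (f.openEquiv.symm x),
    fun x => w.closedMap (f.closedEquiv.symm x), ?_, ?_, ?_, f.genus_eq ▸ w.genus_eq⟩, rfl, rfl,
    hleg⟩
  · intro x y h
    obtain ⟨x, rfl⟩ := hsurj.2 x
    obtain ⟨y, rfl⟩ := hsurj.2 y
    rw [hleg, hleg] at h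
    rw [w.injective h]
  · rw [← w.range_eq]
    ext y
    constructor
    · rintro ⟨x, rfl⟩
      obtain ⟨x, rfl⟩ := hsurj.2 x
      exact ⟨x, (hleg x).symm⟩
    · rintro ⟨x, rfl⟩
      exact ⟨f.leg x, hleg x⟩
  · refine w.cycles_eq.imp ?_ ?_
    · rintro ⟨u, v, hu, hv, s, t, M, N, hM, hN, hK⟩
      exact ⟨u, v, hu, hv, s, t, M, N, hM, hN, (hcyc _).trans hK⟩
    · rintro ⟨c, d, hc, hd, hK⟩
      exact ⟨c, d, hc, hd, (hcyc _).trans hK⟩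

/-- Two labellings without common labels. -/
def DisjointLabels {A B : Type} (ℓ : A → ℕ) (m : B → ℕ) : Prop :=
  Function.Injective (Sum.elim ℓ m)

theorem disjointLabels_of_nodup {a b : Biarity} {ℓ : a.Leg → ℕ} {m : b.Leg → ℕ}
    (hℓ : Function.Injective ℓ) (hm : Function.Injective m)
    (h : ((a.shape ℓ).labels + (b.shape m).labels).Nodup) : DisjointLabels ℓ m := by
  have hd := (Multiset.nodup_add.1 h).2.2
  refine Function.Injective.sumElim hℓ hm fun x y e => ?_
  exact Multiset.disjoint_left.1 hd ((a.mem_labels ℓ _).2 ⟨x, rfl⟩) ((b.mem_labels m _).2 ⟨y, e.symm⟩)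

/-- Gluing of labelled biarities. -/
theorem exists_labelled_result {a b : Biarity} {ℓ : a.Leg → ℕ} {m : b.Leg → ℕ}
    (hℓ : Function.Injective ℓ) (hm : Function.Injective m) (hd : DisjointLabels ℓ m)
    {u v : ℕ} {T : Shape} (h : Glues u v (a.shape ℓ) (b.shape m) T) :
    ∃ (r : Biarity) (k : r.Leg → ℕ) (w : Gluing a b r), Function.Injective k ∧ r.shape k = T ∧
      ℓ w.left = u ∧ m w.right = v ∧ w.IsLabelled ℓ m k := by
  have key : ∃ (r : Biarity) (w : Gluing a b r), ℓ w.left = u ∧ m w.right = v := by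
    generalize hA : a.shape ℓ = A at h
    generalize hB : b.shape m = B at h
    cases h with
    | ofOpen s t M N C D =>
      obtain ⟨x, hx⟩ := (a.mem_openLabels ℓ u).1 (by rw [hA]; simp)
      obtain ⟨y, hy⟩ := (b.mem_openLabels m v).1 (by rw [hB]; simp)
      obtain ⟨r, w, h1, h2⟩ := exists_gluing_open a b x y
      exact ⟨r, w, h1 ▸ hx, h2 ▸ hy⟩
    | ofClosed M N C D =>
      obtain ⟨x, hx⟩ := (a.mem_closedLabels ℓ u).1 (by rw [hA]; simp)
      obtain ⟨y, hy⟩ := (b.mem_closedLabels m v).1 (by rw [hB]; simp)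
      obtain ⟨r, w, h1, h2⟩ := exists_gluing_closed a b x y
      exact ⟨r, w, h1 ▸ hx, h2 ▸ hy⟩
  obtain ⟨r, w, rfl, rfl⟩ := key
  -- The labelling of the result is inherited from the pieces; its shape is then forced by
  -- `Glues.unique`.
  have hk : w.IsLabelled ℓ m (fun x => Sum.elim ℓ m (w.leg x)) := fun x => rfl
  exact ⟨r, _, w, hd.comp w.injective,
    hk.glues.unique (a.nodup_labels hℓ) (b.nodup_labels hm) h, rfl, rfl, hk⟩

/-- Gluing of labelled biarities with prescribed result. -/
theorem exists_labelled_gluing {a b r : Biarity} {ℓ : a.Leg → ℕ} {m : b.Leg → ℕ} {k : r.Leg → ℕ}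
    (hℓ : Function.Injective ℓ) (hm : Function.Injective m) (hk : Function.Injective k)
    (hd : DisjointLabels ℓ m) (ha : 0 ∈ kaufmannPennerSet a) (hb : 0 ∈ kaufmannPennerSet b)
    (hr : 0 ∈ kaufmannPennerSet r) {u v : ℕ}
    (h : Glues u v (a.shape ℓ) (b.shape m) (r.shape k)) :
    ∃ w : Gluing a b r, ℓ w.left = u ∧ m w.right = v ∧ w.IsLabelled ℓ m k := by
  obtain ⟨r', k', w, hk', hT, h1, h2, h3⟩ := exists_labelled_result hℓ hm hd h
  have hr' := kaufmannPennerSet_comp w ha hb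
  -- Both genera are given by the common shape, since the Kaufmann-Penner components are closed
  -- under gluing.
  have hg : r'.genus = r.genus := by
    rw [((r.mem_kaufmannPennerSet_iff k).1 hr).2, ((r'.mem_kaufmannPennerSet_iff k').1 hr').2, hT]
  obtain ⟨f, hf⟩ := Biarity.exists_iso hk' hk hT hg
  obtain ⟨w', e1, e2, e3⟩ := w.exists_mapResult f
  refine ⟨w', by rw [e1, h1], by rw [e2, h2], fun x => ?_⟩
  obtain ⟨y, rfl⟩ := (Sum.map_surjective.2 ⟨f.openEquiv.surjective, f.closedEquiv.surjective⟩ :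
    Function.Surjective f.leg) x
  change Sum.elim ℓ m (w'.leg (f.leg y)) = k (f.leg y)
  rw [e3, hf]
  exact h3 y

/-- Disjoint labels form an injective function on the inputs of both pieces together, so the
equations between inputs that define `Gluing.Relabelled` can be checked on labels. The next two
lemmas apply the same principle to commutativity and associativity. -/
theorem Gluing.IsLabelled.relabelled {a b r a' b' r' : Biarity} {f : Biarity.Iso a a'}
    {g : Biarity.Iso b b'} {h : Biarity.Iso r r'} {w : Gluing a b r} {w' : Gluing a' b' r'}
    {ℓ : a.Leg → ℕ} {m : b.Leg → ℕ} {k : r.Leg → ℕ}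
    {ℓ' : a'.Leg → ℕ} {m' : b'.Leg → ℕ} {k' : r'.Leg → ℕ} (hd : DisjointLabels ℓ' m')
    (hw : w.IsLabelled ℓ m k) (hw' : w'.IsLabelled ℓ' m' k')
    (hf : ∀ x, ℓ' (f.leg x) = ℓ x) (hg : ∀ x, m' (g.leg x) = m x) (hh : ∀ x, k' (h.leg x) = k x)
    (hl : ℓ' w'.left = ℓ w.left) (hr : m' w'.right = m w.right) :
    Gluing.Relabelled f g h w w' := by
  refine ⟨?_, ?_, fun x => ?_⟩
  · exact Sum.inl_injective (hd (show Sum.elim ℓ' m' (Sum.inl _) = Sum.elim ℓ' m' (Sum.inl _) from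
      hl.trans (hf _).symm))
  · exact Sum.inr_injective (hd (show Sum.elim ℓ' m' (Sum.inr _) = Sum.elim ℓ' m' (Sum.inr _) from
      hr.trans (hg _).symm))
  · apply hd
    rw [hw', hh, ← hw]
    rcases w.leg x with y | y
    · exact (hf y).symm
    · exact (hg y).symm

theorem Gluing.IsLabelled.swapped {a b r : Biarity} {w : Gluing a b r} {w' : Gluing b a r}
    {ℓ : a.Leg → ℕ} {m : b.Leg → ℕ} {k : r.Leg → ℕ} (hd : DisjointLabels ℓ m)
    (hw : w.IsLabelled ℓ m k) (hw' : w'.IsLabelled m ℓ k)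
    (hl : m w'.left = m w.right) (hr : ℓ w'.right = ℓ w.left) : w.Swapped w' := by
  refine ⟨?_, ?_, fun x => ?_⟩
  · exact Sum.inr_injective (hd (show Sum.elim ℓ m (Sum.inr _) = Sum.elim ℓ m (Sum.inr _) from hl))
  · exact Sum.inl_injective (hd (show Sum.elim ℓ m (Sum.inl _) = Sum.elim ℓ m (Sum.inl _) from hr))
  · have : w.leg x = (w'.leg x).swap := by
      apply hd
      rw [hw x, ← hw' x]
      cases w'.leg x <;> rfl
    rw [this, Sum.swap_swap]

theorem Gluing.IsLabelled.associated {a b c r s t : Biarity} {w₁ : Gluing a b r}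
    {w₂ : Gluing r c t} {w₃ : Gluing b c s} {w₄ : Gluing a s t}
    {ℓa : a.Leg → ℕ} {ℓb : b.Leg → ℕ} {ℓc : c.Leg → ℕ} {ℓr : r.Leg → ℕ} {ℓs : s.Leg → ℕ}
    {ℓt : t.Leg → ℕ} (hd : DisjointLabels ℓa (Sum.elim ℓb ℓc))
    (h₁ : w₁.IsLabelled ℓa ℓb ℓr) (h₂ : w₂.IsLabelled ℓr ℓc ℓt) (h₃ : w₃.IsLabelled ℓb ℓc ℓs)
    (h₄ : w₄.IsLabelled ℓa ℓs ℓt) (e₁ : ℓa w₄.left = ℓa w₁.left) (e₂ : ℓs w₄.right = ℓb w₁.right)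
    (e₃ : ℓr w₂.left = ℓb w₃.left) (e₄ : ℓc w₂.right = ℓc w₃.right) :
    Gluing.Associated w₁ w₂ w₃ w₄ := by
  have inj : ∀ x y, Sum.elim ℓa (Sum.elim ℓb ℓc) x = Sum.elim ℓa (Sum.elim ℓb ℓc) y → x = y :=
    fun x y h => hd h
  refine ⟨?_, ?_, ?_, ?_, fun x => ?_⟩
  · exact Sum.inl_injective (inj (Sum.inl _) (Sum.inl _) e₁)
  · have := inj (Sum.inr (w₃.leg w₄.right)) (Sum.inr (Sum.inl w₁.right))
      (by rw [Sum.elim_inr, h₃, e₂]; rfl)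
    exact Sum.inr_injective this
  · have := inj (Equiv.sumAssoc _ _ _ (Sum.inl (w₁.leg w₂.left))) (Sum.inr (Sum.inl w₃.left)) (by
      rw [Sum.elim_inr, Sum.elim_inl, ← e₃, ← h₁]
      rcases w₁.leg w₂.left with y | y <;> rfl)
    rcases hy : w₁.leg w₂.left with y | y
    · rw [hy] at this; simp at this
    · rw [hy] at this; simpa using this
  · exact Sum.inr_injective (Sum.inr_injective (inj (Sum.inr (Sum.inr _)) (Sum.inr (Sum.inr _)) e₄))
  · apply inj
    have h : ℓt x = ℓt x := rfl
    conv_lhs at h => rw [← h₂]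
    conv_rhs at h => rw [← h₄]
    refine Eq.trans ?_ (h.trans ?_)
    · rcases w₂.leg x with y | y
      · simp only [Sum.map_inl, Sum.elim_inl, ← h₁ y]
        rcases w₁.leg y with z | z <;> rfl
      · rfl
    · rcases w₄.leg x with y | y
      · rfl
      · simp only [Sum.map_inr, Sum.elim_inr, ← h₃ y]

universe u

/-! ## Labelled elements -/

/-- The hybrid has elements only where the Kaufmann-Penner hybrid has. -/
def CyclicHybrid.Bounded (H : CyclicHybrid.{u}) : Prop :=
  ∀ (a : Biarity), H.obj a → 0 ∈ kaufmannPennerSet a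

/-- An element of a cyclic hybrid together with a labelling of its inputs by natural numbers. -/
structure LabelledElement (H : CyclicHybrid.{u}) where
  bi : Biarity
  lab : bi.Leg → ℕ
  inj : Function.Injective lab
  el : H.obj bi

namespace LabelledElement

variable {H : CyclicHybrid.{u}}

/-- The shape of a labelled element. -/
noncomputable def shape (z : LabelledElement H) : Shape := z.bi.shape z.lab

theorem nodup (z : LabelledElement H) : z.shape.labels.Nodup := z.bi.nodup_labels z.inj

theorem valid (hH : H.Bounded) (z : LabelledElement H) : z.shape.Valid :=
  ((z.bi.mem_kaufmannPennerSet_iff z.lab).1 (hH _ z.el)).1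

/-- Equality of labelled elements up to isomorphisms respecting the labels. -/
def Same (z z' : LabelledElement H) : Prop :=
  ∃ f : Biarity.Iso z.bi z'.bi, (∀ x, z'.lab (f.leg x) = z.lab x) ∧ H.map f z.el = z'.el

/-- `z` is the composite of `x` and `y` along the inputs labelled `u` and `v`. -/
def Comp (u v : ℕ) (x y z : LabelledElement H) : Prop :=
  ∃ w : Gluing x.bi y.bi z.bi, x.lab w.left = u ∧ y.lab w.right = v ∧
    w.IsLabelled x.lab y.lab z.lab ∧ z.el = H.comp w x.el y.el

theorem Comp.glues {u v : ℕ} {x y z : LabelledElement H} (h : Comp u v x y z) :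
    Glues u v x.shape y.shape z.shape := by
  obtain ⟨w, rfl, rfl, h, -⟩ := h
  exact h.glues

/-- Boundedness is needed for the genera, which are then determined by the shapes. -/
theorem exists_iso (hH : H.Bounded) {z z' : LabelledElement H} (h : z.shape = z'.shape) :
    ∃ f : Biarity.Iso z.bi z'.bi, ∀ x, z'.lab (f.leg x) = z.lab x := by
  refine Biarity.exists_iso z.inj z'.inj h ?_
  rw [((z.bi.mem_kaufmannPennerSet_iff z.lab).1 (hH _ z.el)).2,
    ((z'.bi.mem_kaufmannPennerSet_iff z'.lab).1 (hH _ z'.el)).2]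
  change (Multiset.card z.shape.cycles : ℚ) - 1 + (Multiset.card z.shape.closed : ℚ) / 2 = _
  rw [h]
  rfl

theorem disjointLabels {x y : LabelledElement H} (h : (x.shape.labels + y.shape.labels).Nodup) :
    DisjointLabels x.lab y.lab :=
  disjointLabels_of_nodup x.inj y.inj h

theorem exists_comp {x y : LabelledElement H} {u v : ℕ} {T : Shape}
    (hd : (x.shape.labels + y.shape.labels).Nodup) (h : Glues u v x.shape y.shape T) :
    ∃ z, z.shape = T ∧ Comp u v x y z := by
  obtain ⟨r, k, w, hk, hT, h1, h2, h3⟩ := exists_labelled_result x.inj y.inj (disjointLabels hd) h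
  exact ⟨⟨r, k, hk, H.comp w x.el y.el⟩, hT, w, h1, h2, h3, rfl⟩

/-- This is equivariance freed of explicit isomorphisms: a composite depends on its pieces only up
to `Same`. -/
theorem Comp.same (hH : H.Bounded) {u v : ℕ} {x y z x' y' z' : LabelledElement H}
    (hd : (x'.shape.labels + y'.shape.labels).Nodup)
    (hx : Same x x') (hy : Same y y') (h : Comp u v x y z) (h' : Comp u v x' y' z')
    (hz : z.shape = z'.shape) : Same z z' := by
  obtain ⟨f, hf, ef⟩ := hx
  obtain ⟨g, hg, eg⟩ := hy
  obtain ⟨w, hl, hr, hw, e⟩ := h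
  obtain ⟨w', hl', hr', hw', e'⟩ := h'
  obtain ⟨k, hk⟩ := exists_iso hH hz
  refine ⟨k, hk, ?_⟩
  rw [e, e', ← ef, ← eg]
  exact H.equivariant f g k w w' (hw.relabelled (disjointLabels hd) hw' hf hg hk
    (hl'.trans hl.symm) (hr'.trans hr.symm)) _ _

/-- A composite with a prescribed result is realized by a gluing. -/
theorem exists_gluing (hH : H.Bounded) {x y z : LabelledElement H} {u v : ℕ}
    (hd : (x.shape.labels + y.shape.labels).Nodup) (h : Glues u v x.shape y.shape z.shape) :
    ∃ w : Gluing x.bi y.bi z.bi, x.lab w.left = u ∧ y.lab w.right = v ∧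
      w.IsLabelled x.lab y.lab z.lab :=
  exists_labelled_gluing x.inj y.inj z.inj (disjointLabels hd) (hH _ x.el) (hH _ y.el) (hH _ z.el) h

theorem Comp.symm (hH : H.Bounded) {u v : ℕ} {x y z : LabelledElement H}
    (hd : (x.shape.labels + y.shape.labels).Nodup) (h : Comp u v x y z) : Comp v u y x z := by
  obtain ⟨w', hl', hr', hw'⟩ := exists_gluing hH (add_comm x.shape.labels _ ▸ hd) h.glues.symm
  obtain ⟨w, hl, hr, hw, e⟩ := h
  refine ⟨w', hl', hr', hw', e.trans (H.commutative w w' ?_ _ _)⟩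
  exact hw.swapped (disjointLabels hd) hw' (hl'.trans hr.symm) (hr'.trans hl.symm)

/-- The associativity axiom needs the inner composite to be `x` itself. Here it is only the `Same`
as `x`, which is what uniqueness of smaller elements provides. -/
theorem Comp.assoc (hH : H.Bounded) {u v e f : ℕ} {x₁ x₂ x x' y z r : LabelledElement H}
    (hd : (x₁.shape.labels + (x₂.shape.labels + y.shape.labels)).Nodup)
    (h₁ : Comp e f x₁ x₂ x') (hx : Same x' x) (h₂ : Comp u v x y z) (h₃ : Comp u v x₂ y r)
    (h₄ : Glues e f x₁.shape r.shape z.shape) : Comp e f x₁ r z := by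
  have hd12 : (x₁.shape.labels + x₂.shape.labels).Nodup :=
    Multiset.nodup_of_le (by rw [← add_assoc]; exact Multiset.le_add_right _ _) hd
  have hd1r : (x₁.shape.labels + r.shape.labels).Nodup := by
    refine Multiset.nodup_of_le (add_le_add_right ?_ _) hd
    rw [h₃.glues.labels]
    exact (Multiset.le_cons_self _ _).trans (Multiset.le_cons_self _ _)
  have hdis : DisjointLabels x₁.lab (Sum.elim x₂.lab y.lab) := by
    have hd2 := Multiset.nodup_add.1 hd
    refine Function.Injective.sumElim x₁.inj (disjointLabels hd2.2.1) fun i j hij => ?_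
    refine Multiset.disjoint_left.1 hd2.2.2 ((x₁.bi.mem_labels x₁.lab _).2 ⟨i, rfl⟩) ?_
    rw [hij, Multiset.mem_add]
    rcases j with j | j
    · exact Or.inl ((x₂.bi.mem_labels x₂.lab _).2 ⟨j, rfl⟩)
    · exact Or.inr ((y.bi.mem_labels y.lab _).2 ⟨j, rfl⟩)
  obtain ⟨k, hk, ek⟩ := hx
  have hshape : x'.shape = x.shape := by
    have h := (k.map_cycles)
    refine Shape.ext ?_ ?_
    · change _ = Multiset.map _ _
      rw [← h, Multiset.map_map]
      refine Multiset.map_congr rfl fun c _ => ?_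
      rw [Function.comp_apply, cycle_map_map]
      congr 1
      funext i
      exact (hk (Sum.inl i)).symm
    · change _ = Multiset.map _ _
      rw [← Finset.map_univ_equiv k.closedEquiv, Finset.map_val, Multiset.map_map]
      exact Multiset.map_congr rfl fun i _ => (hk (Sum.inr i)).symm
  obtain ⟨w₁, l₁, r₁, lab₁⟩ := exists_gluing hH (z := x) hd12 (hshape ▸ h₁.glues)
  obtain ⟨w₄, l₄, r₄, lab₄⟩ := exists_gluing hH hd1r h₄
  obtain ⟨w₁', l₁', r₁', lab₁', e₁'⟩ := h₁
  obtain ⟨w₂, l₂, r₂, lab₂, e₂⟩ := h₂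
  obtain ⟨w₃, l₃, r₃, lab₃, e₃⟩ := h₃
  refine ⟨w₄, l₄, r₄, lab₄, ?_⟩
  -- `w₁` glues directly into the biarity of `x`; equivariance along `k` transports the composite
  -- `x'` there.
  have ex : x.el = H.comp w₁ x₁.el x₂.el := by
    rw [← ek, e₁', H.equivariant (Biarity.Iso.refl _) (Biarity.Iso.refl _) k w₁' w₁, H.map_refl,
      H.map_refl]
    refine lab₁'.relabelled (disjointLabels hd12) lab₁ ?_ ?_ hk (l₁.trans l₁'.symm)
      (r₁.trans r₁'.symm)
    · rintro (i | i) <;> rfl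
    · rintro (i | i) <;> rfl
  rw [e₂, e₃, ex]
  exact H.associative w₁ w₂ w₃ w₄ (Gluing.IsLabelled.associated hdis lab₁ lab₂ lab₃ lab₄
    (l₄.trans l₁.symm) (r₄.trans r₁.symm) (l₂.trans l₃.symm) (r₂.trans r₃.symm)) _ _ _

end LabelledElement

/-- There is an element of the given shape. -/
def CyclicHybrid.Inhabits (H : CyclicHybrid.{u}) (T : Shape) : Prop :=
  ∃ z : LabelledElement H, z.shape = T

/-- There is at most one element of the given shape. -/
def CyclicHybrid.Subsingle (H : CyclicHybrid.{u}) (T : Shape) : Prop :=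
  ∀ z z' : LabelledElement H, z.shape = T → z'.shape = T → z.Same z'

theorem exists_fresh (S : Multiset ℕ) (hS : S.Nodup) : ∃ u v, (u ::ₘ v ::ₘ S).Nodup := by
  obtain ⟨v, hv⟩ := Infinite.exists_notMem_finset S.toFinset
  obtain ⟨u, hu⟩ := Infinite.exists_notMem_finset (v ::ₘ S).toFinset
  rw [Multiset.mem_toFinset] at hu hv
  exact ⟨u, v, Multiset.nodup_cons.2 ⟨hu, Multiset.nodup_cons.2 ⟨hv, hS⟩⟩⟩

/-! ### Cuts of labelled elements, with free choice of the glued labels -/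

open LabelledElement

variable {H : CyclicHybrid.{u}}

/-- `z` decomposes into two elements of the given shapes, which depend on the label of the glued
input, whatever this label is. -/
def Cut (z : LabelledElement H) (A B : ℕ → Shape) : Prop :=
  ∀ u v, (u ::ₘ v ::ₘ z.shape.labels).Nodup →
    ∃ x y, x.shape = A u ∧ y.shape = B v ∧ Comp u v x y z

theorem Cut.symm (hH : H.Bounded) {z : LabelledElement H} {A B : ℕ → Shape} (h : Cut z A B) :
    Cut z B A := by
  intro u v huv
  obtain ⟨x, y, hx, hy, hc⟩ := h v u (Multiset.cons_swap u v _ ▸ huv)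
  exact ⟨y, x, hy, hx, hc.symm hH (hc.glues.labels ▸ Multiset.cons_swap u v _ ▸ huv)⟩

/-- Elements with equal decompositions into unique pieces are equal. -/
theorem Cut.same (hH : H.Bounded) {z z' : LabelledElement H} {A B : ℕ → Shape}
    (hz : z.shape = z'.shape) (h : Cut z A B) (h' : Cut z' A B)
    (hu : ∀ T, T.size < z.shape.size → H.Subsingle T) : z.Same z' := by
  obtain ⟨u, v, huv⟩ := exists_fresh _ z.nodup
  obtain ⟨x, y, hx, hy, hc⟩ := h u v huv
  obtain ⟨x', y', hx', hy', hc'⟩ := h' u v (hz ▸ huv)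
  -- Each piece has size at least 5 and the two sizes add up to that of `z` plus 4, so both pieces
  -- are strictly smaller than `z`.
  have hs := hc.glues.size
  have h1 := (x.valid hH).five_le_size
  have h2 := (y.valid hH).five_le_size
  refine Comp.same hH ?_ (hu _ ?_ x x' rfl (hx'.trans hx.symm))
    (hu _ ?_ y y' rfl (hy'.trans hy.symm)) hc hc' hz
  · rw [hc'.glues.labels, ← hz]
    exact huv
  · omega
  · omega

/-- Existence of an element by composing smaller ones. -/
theorem inhabits_of_glues {T : Shape} (hT : T.labels.Nodup) {A B : ℕ → Shape}
    (hg : ∀ u v, Glues u v (A u) (B v) T) (hA : ∀ u, (A u).Valid) (hB : ∀ u, (B u).Valid)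
    (ih : ∀ S : Shape, S.size < T.size → S.labels.Nodup → S.Valid → H.Inhabits S) :
    H.Inhabits T := by
  obtain ⟨u, v, huv⟩ := exists_fresh _ hT
  have hs := (hg u v).size
  have h1 := (hA u).five_le_size
  have h2 := (hB v).five_le_size
  rw [← (hg u v).labels] at huv
  have hn := Multiset.nodup_add.1 huv
  obtain ⟨x, hx⟩ := ih (A u) (by omega) hn.1 (hA u)
  obtain ⟨y, hy⟩ := ih (B v) (by omega) hn.2.1 (hB v)
  obtain ⟨z, hz, -⟩ := exists_comp (x := x) (y := y) (by rwa [hx, hy]) (hx ▸ hy ▸ hg u v)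
  exact ⟨z, hz⟩

/-- Changing a decomposition by cutting the left piece. -/
theorem Cut.move (hH : H.Bounded) {z : LabelledElement H} {A B A' B' : ℕ → Shape}
    {X : ℕ → ℕ → Shape} (h : Cut z A B)
    (hX : ∀ e f u, Glues e f (A' e) (X f u) (A u))
    (hB' : ∀ f u v, Glues u v (X f u) (B v) (B' f))
    (hz : ∀ e f, Glues e f (A' e) (B' f) z.shape)
    (vA : ∀ e, (A' e).Valid) (vX : ∀ f u, (X f u).Valid)
    (ih : ∀ S : Shape, S.size < z.shape.size → S.labels.Nodup → S.Valid →
      H.Inhabits S ∧ H.Subsingle S) : Cut z A' B' := by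
  intro e f hef
  -- The auxiliary labels avoid `e` and `f` as well, so that both cuts can be made at once.
  obtain ⟨u, v, huv⟩ := exists_fresh _ hef
  obtain ⟨x, y, hx, hy, hc⟩ := h u v (Multiset.nodup_of_le (Multiset.cons_le_cons _
    (Multiset.cons_le_cons _ ((Multiset.le_cons_self _ _).trans (Multiset.le_cons_self _ _)))) huv)
  have hs := hc.glues.size
  have hs' := (hX e f u).size
  have v1 := (vA e).five_le_size
  have v2 := (vX f u).five_le_size
  have v4 := (y.valid hH).five_le_size
  have hsx : x.shape.size = (A u).size := by rw [hx]
  have hl : (A' e).labels + ((X f u).labels + y.shape.labels) = u ::ₘ v ::ₘ e ::ₘ f ::ₘ z.shape.labels := by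
    have h1 := hc.glues.labels
    have h2 := (hX e f u).labels
    rw [hx] at h1
    rw [← add_assoc, h2, Multiset.cons_add, Multiset.cons_add, h1]
    simp only [← Multiset.singleton_add]
    abel
  rw [← hl] at huv
  have hn := Multiset.nodup_add.1 huv
  have hn' := Multiset.nodup_add.1 hn.2.1
  -- Three pieces in a row are used: `A' e`, `X f u` and the old right piece `y`. The first two glue
  -- to an element `x'` of the shape of `x`, the last two to an element `r` of shape `B' f`.
  obtain ⟨x₁, hx₁⟩ := (ih (A' e) (by omega) hn.1 (vA e)).1
  obtain ⟨x₂, hx₂⟩ := (ih (X f u) (by omega) hn'.1 (vX f u)).1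
  rw [← hx₁, ← hx₂] at huv
  obtain ⟨x', hx', hc₁⟩ := exists_comp (x := x₁) (y := x₂) (u := e) (v := f) (T := x.shape)
    (Multiset.nodup_of_le (by rw [← add_assoc]; exact Multiset.le_add_right _ _) huv)
    (by rw [hx₁, hx₂, hx]; exact hX e f u)
  obtain ⟨r, hr, hc₂⟩ := exists_comp (x := x₂) (y := y) (u := u) (v := v) (T := B' f)
    (Multiset.nodup_add.1 huv).2.1 (by rw [hx₂, hy]; exact hB' f u v)
  refine ⟨x₁, r, hx₁, hr, Comp.assoc hH huv hc₁ ?_ hc hc₂ (by rw [hx₁, hr]; exact hz e f)⟩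
  -- `x` is smaller than `z`, hence the only element of its shape, and so agrees with the rebuilt
  -- `x'`.
  exact (ih x.shape (by omega) x.nodup (x.valid hH)).2 _ _ hx' rfl

/-! ## Decompositions -/

/-- The shape of a piece with glued open input, in a cycle followed by the list `s`. -/
def openEnd (s : List ℕ) (M : Multiset (Cycle ℕ)) (C : Multiset ℕ) (u : ℕ) : Shape :=
  ⟨((u :: s : List ℕ) : Cycle ℕ) ::ₘ M, C⟩

/-- The shape of a piece with glued closed input. -/
def closedEnd (M : Multiset (Cycle ℕ)) (C : Multiset ℕ) (u : ℕ) : Shape := ⟨M, u ::ₘ C⟩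

/-- The glued cycle is never empty, as it contains `u`. This meets one half of the condition for
several boundaries, and the other half falls on `M` and `C`. -/
theorem valid_openEnd {s : List ℕ} {M : Multiset (Cycle ℕ)} {C : Multiset ℕ} {u : ℕ} :
    (openEnd s M C u).Valid ↔
      (1 ≤ Multiset.card M → 1 ≤ Multiset.card C + numNonempty M) ∧
      (Multiset.card M = 0 → 1 < s.length + 2 * Multiset.card C) := by
  have h : Multiset.card M = 0 → numLabels M = 0 := fun h => by
    rw [Multiset.card_eq_zero.1 h, numLabels_zero]
  have h' : numNonempty (((u :: s : List ℕ) : Cycle ℕ) ::ₘ M) = 1 + numNonempty M := by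
    rw [numNonempty_cons]
    simp
  simp only [Shape.Valid, openEnd, h', numLabels_cons, Multiset.card_cons, List.length_cons]
  omega

theorem numLabels_eq_zero {A : Type} {M : Multiset (Cycle A)} (h : numNonempty M = 0) :
    numLabels M = 0 := by
  rw [eq_replicate_of_numNonempty h]
  simp [numLabels]

/-- The glued input already counts as one closed input. A single boundary then falls under the same
condition as several, because a cycle has labels exactly if it is nonempty. -/
theorem valid_closedEnd {M : Multiset (Cycle ℕ)} {C : Multiset ℕ} {u : ℕ} :
    (closedEnd M C u).Valid ↔
      (1 ≤ Multiset.card M → 1 ≤ Multiset.card C + numNonempty M) ∧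
      (Multiset.card M = 0 → 2 ≤ Multiset.card C) := by
  have h := numLabels_le_of_numNonempty (M := M)
  have h' := numLabels_eq_zero (M := M)
  simp only [Shape.Valid, closedEnd, Multiset.card_cons]
  omega

theorem glues_openEnd {u v : ℕ} {s t : List ℕ} {M N K : Multiset (Cycle ℕ)} {C D E : Multiset ℕ}
    {o : Cycle ℕ} (ho : ((s ++ t : List ℕ) : Cycle ℕ) = o) (hK : M + N = K) (hE : C + D = E) :
    Glues u v (openEnd s M C u) (openEnd t N D v) ⟨o ::ₘ K, E⟩ := by
  subst ho hK hE
  exact .ofOpen s t M N C D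

theorem glues_closedEnd {u v : ℕ} {M N K : Multiset (Cycle ℕ)} {C D E : Multiset ℕ}
    (hK : M + N = K) (hE : C + D = E) :
    Glues u v (closedEnd M C u) (closedEnd N D v) ⟨K, E⟩ := by
  subst hK hE
  exact .ofClosed M N C D

/-- A middle piece carries two glued inputs `u` and `f` and may be read from either: a rotation
makes the other one the head of its cycle. -/
theorem openEnd_eq {s s' : List ℕ} {f u : ℕ} {M : Multiset (Cycle ℕ)} {C : Multiset ℕ}
    (h : ((u :: s : List ℕ) : Cycle ℕ) = ((f :: s' : List ℕ) : Cycle ℕ)) :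
    openEnd s M C u = openEnd s' M C f := by
  rw [openEnd, h, openEnd]

theorem Cut.shape_eq {z : LabelledElement H} {A B : ℕ → Shape} {T : Shape} (h : Cut z A B)
    (hT : ∀ u v, Glues u v (A u) (B v) T) : z.shape = T := by
  obtain ⟨u, v, huv⟩ := exists_fresh _ z.nodup
  obtain ⟨x, y, hx, hy, hc⟩ := h u v huv
  exact hc.glues.unique x.nodup y.nodup (hx ▸ hy ▸ hT u v)

theorem Cut.valid_left (hH : H.Bounded) {z : LabelledElement H} {A B : ℕ → Shape} (h : Cut z A B) :
    ∃ u, (A u).Valid := by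
  obtain ⟨u, v, huv⟩ := exists_fresh _ z.nodup
  obtain ⟨x, y, hx, hy, hc⟩ := h u v huv
  exact ⟨u, hx ▸ x.valid hH⟩

theorem Cut.valid_right (hH : H.Bounded) {z : LabelledElement H} {A B : ℕ → Shape}
    (h : Cut z A B) : ∃ u, (B u).Valid :=
  (h.symm hH).valid_left hH

/-- All smaller shapes carry exactly one element. -/
def CyclicHybrid.UniqueBelow (H : CyclicHybrid.{u}) (n : ℕ) : Prop :=
  ∀ S : Shape, S.size < n → S.labels.Nodup → S.Valid → H.Inhabits S ∧ H.Subsingle S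

/-- `Cut.move` for discs. The left disc (u, s₁, s₂, s₃) is cut by an arc that separates the block
`s₂` together with the closed inputs `C`; the middle disc (f, s₃, u, s₁) with `C₀` is absorbed by
the right piece. The bounds `v₁` and `v₂` are the stability of the new left piece and of the middle
piece. -/
theorem Cut.open_open (hH : H.Bounded) {z : LabelledElement H} (ih : H.UniqueBelow z.shape.size)
    {s t s' : List ℕ} {C' D D' : Multiset ℕ} (h : Cut z (openEnd s 0 C') (openEnd t 0 D))
    (s₁ s₂ s₃ : List ℕ) (C₀ C : Multiset ℕ) (hs : s = s₁ ++ s₂ ++ s₃) (hC : C' = C₀ + C)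
    (hs' : s₃ ++ t ++ s₁ = s') (hD : C₀ + D = D')
    (v₁ : 1 < s₂.length + 2 * Multiset.card C)
    (v₂ : 0 < s₁.length + s₃.length + 2 * Multiset.card C₀) :
    Cut z (openEnd s₂ 0 C) (openEnd s' 0 D') := by
  subst hs hC hs' hD
  have hz := h.shape_eq (fun u v => glues_openEnd rfl rfl rfl)
  refine h.move hH (X := fun f u => openEnd (s₃ ++ u :: s₁) 0 C₀ f) (fun e f u => ?_)
    (fun f u v => ?_) (fun e f => ?_) (fun e => ?_) (fun f u => ?_) ih
  · refine glues_openEnd ?_ rfl (add_comm _ _)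
    simpa using coe_append_comm (s₂ ++ s₃) (u :: s₁)
  · rw [← openEnd_eq (s := s₁ ++ f :: s₃) (u := u) (by
      simpa using coe_append_comm (u :: s₁) (f :: s₃))]
    refine glues_openEnd ?_ rfl rfl
    simpa using coe_append_comm s₁ (f :: s₃ ++ t)
  · rw [hz]
    refine glues_openEnd ?_ rfl (by abel)
    simpa using coe_append_comm (s₂ ++ s₃ ++ t) s₁
  · rw [valid_openEnd]
    simpa using v₁
  · rw [valid_openEnd]
    simp only [Multiset.card_zero, List.length_append, List.length_cons]
    omega

/-- `Cut.move` along closed curves: boundaries and closed inputs carry no order and may be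
redistributed freely. The middle piece has the two closed inputs `u` and `f`, so that `v₂` suffices
for its validity. -/
theorem Cut.closed_closed (hH : H.Bounded) {z : LabelledElement H}
    (ih : H.UniqueBelow z.shape.size)
    {M N N' : Multiset (Cycle ℕ)} {C D D' : Multiset ℕ}
    (h : Cut z (closedEnd M C) (closedEnd N D)) (M₁ M₂ : Multiset (Cycle ℕ)) (C₁ C₂ : Multiset ℕ)
    (hM : M = M₁ + M₂) (hC : C = C₁ + C₂) (hN : M₂ + N = N') (hD : C₂ + D = D')
    (v₁ : ∀ u, (closedEnd M₁ C₁ u).Valid) (v₂ : Multiset.card M₂ = 0 → 1 ≤ Multiset.card C₂) :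
    Cut z (closedEnd M₁ C₁) (closedEnd N' D') := by
  subst hM hC hN hD
  have hz := h.shape_eq (fun u v => glues_closedEnd rfl rfl)
  refine h.move hH (X := fun f u => closedEnd M₂ (u ::ₘ C₂) f) (fun e f u => ?_)
    (fun f u v => ?_) (fun e f => ?_) v₁ (fun f u => ?_) ih
  · exact glues_closedEnd rfl (Multiset.add_cons _ _ _)
  · have : closedEnd M₂ (u ::ₘ C₂) f = closedEnd M₂ (f ::ₘ C₂) u := by
      rw [closedEnd, Multiset.cons_swap, closedEnd]
    rw [this]
    exact glues_closedEnd rfl (Multiset.cons_add _ _ _)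
  · rw [hz]
    exact glues_closedEnd (by abel) (by abel)
  · rw [valid_closedEnd, Multiset.card_cons]
    omega

/-- A closed curve parallel to the boundary with the glued input separates everything else, `M` and
`C`, from it. The middle piece is a disc with cycle (u, s) and a single closed input, which is
always stable. -/
theorem Cut.open_closed (hH : H.Bounded) {z : LabelledElement H}
    (ih : H.UniqueBelow z.shape.size)
    {s t : List ℕ} {M N : Multiset (Cycle ℕ)} {C D : Multiset ℕ}
    (h : Cut z (openEnd s M C) (openEnd t N D)) (v₁ : ∀ u, (closedEnd M C u).Valid) :
    Cut z (closedEnd M C) (closedEnd (((s ++ t : List ℕ) : Cycle ℕ) ::ₘ N) D) := by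
  have hz := h.shape_eq (fun u v => glues_openEnd rfl rfl rfl)
  refine h.move hH (X := fun f u => openEnd s 0 {f} u) (fun e f u => ?_)
    (fun f u v => ?_) (fun e f => ?_) v₁ (fun f u => ?_) ih
  · exact glues_closedEnd (D := 0) (by rw [add_comm, Multiset.cons_add, zero_add]) (add_zero _)
  · exact glues_openEnd rfl (zero_add _) (Multiset.singleton_add _ _)
  · rw [hz]
    exact glues_closedEnd (Multiset.add_cons _ _ _) rfl
  · rw [valid_openEnd]
    simp

/-- The reverse exchange for an empty boundary, whose disc with a single closed input is unstable
and so cannot be split off by a closed curve. The middle disc has the one-element cycle (f) and the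
closed inputs `u` and `S`. -/
theorem Cut.closed_open (hH : H.Bounded) {z : LabelledElement H}
    (ih : H.UniqueBelow z.shape.size) {x : ℕ} {S D : Multiset ℕ}
    (h : Cut z (closedEnd {Cycle.nil} (x ::ₘ S)) (closedEnd 0 D)) :
    Cut z (openEnd [] 0 {x}) (openEnd [] 0 (S + D)) := by
  have hz := h.shape_eq (fun u v => glues_closedEnd (add_zero _) rfl)
  refine h.move hH (X := fun f u => openEnd [] 0 (u ::ₘ S) f) (fun e f u => ?_)
    (fun f u v => ?_) (fun e f => ?_) (fun e => ?_) (fun f u => ?_) ih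
  · refine glues_openEnd (K := 0) (o := Cycle.nil) rfl rfl ?_
    rw [Multiset.singleton_add, Multiset.cons_swap]
  · exact glues_closedEnd (M := {((f :: [] : List ℕ) : Cycle ℕ)}) (add_zero _) rfl
  · rw [hz]
    exact glues_openEnd (K := 0) (o := Cycle.nil) rfl rfl (by
      rw [Multiset.singleton_add, Multiset.cons_add])
  · simp [valid_openEnd]
  · rw [valid_openEnd, Multiset.card_cons]
    simp only [Multiset.card_zero, List.length_nil]
    omega

/-- Replacing the label `u` by `u'`. -/
theorem Biarity.shape_update {a : Biarity} {ℓ ℓ' : a.Leg → ℕ} (hℓ : Function.Injective ℓ)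
    (i : a.Leg) (h : ∀ j, j ≠ i → ℓ' j = ℓ j) :
    a.shape ℓ' = ⟨(a.shape ℓ).cycles.map (Cycle.map (Function.update id (ℓ i) (ℓ' i))),
      (a.shape ℓ).closed.map (Function.update id (ℓ i) (ℓ' i))⟩ := by
  have key : ∀ j, Function.update id (ℓ i) (ℓ' i) (ℓ j) = ℓ' j := by
    intro j
    by_cases hj : j = i
    · subst hj; simp
    · rw [Function.update_of_ne (hℓ.ne hj), h j hj]; rfl
  refine Shape.ext ?_ ?_
  · simp only [Biarity.shape, Multiset.map_map, Function.comp_def, cycle_map_map, key]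
  · simp only [Biarity.shape, Multiset.map_map, Function.comp_def, key]

theorem map_update_cycles {M : Multiset (Cycle ℕ)} {u u' : ℕ}
    (h : u ∉ M.bind Cycle.toMultiset) : M.map (Cycle.map (Function.update id u u')) = M := by
  refine (Multiset.map_congr rfl fun c hc => ?_).trans (Multiset.map_id' M)
  have hu : u ∉ c := fun hu => h (Multiset.mem_bind.2 ⟨c, hc, (mem_cycle_toMultiset c u).2 hu⟩)
  induction c using Quotient.inductionOn with
  | h l =>
    change ((l.map _ : List ℕ) : Cycle ℕ) = (l : Cycle ℕ)
    congr 1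
    refine (List.map_congr_left fun x hx => ?_).trans (List.map_id l)
    exact Function.update_of_ne (fun e => hu (by rwa [e] at hx)) _ _

theorem map_update_closed {C : Multiset ℕ} {u u' : ℕ} (h : u ∉ C) :
    C.map (Function.update id u u') = C :=
  (Multiset.map_congr rfl fun x hx => Function.update_of_ne (show x ≠ u from fun e => h (e ▸ hx)) _ _).trans
    (Multiset.map_id C)

/-- As labels do not repeat, the label of `i` occurs only at the head of the distinguished cycle,
and changing it leaves `s`, `M` and `C` alone. The shape of a piece thus depends on the glued label
through this entry only. -/
theorem Biarity.shape_openEnd {a : Biarity} {ℓ ℓ' : a.Leg → ℕ} (hℓ : Function.Injective ℓ)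
    (i : a.Leg) (h : ∀ j, j ≠ i → ℓ' j = ℓ j) {s : List ℕ} {M : Multiset (Cycle ℕ)}
    {C : Multiset ℕ} (hs : a.shape ℓ = openEnd s M C (ℓ i)) :
    a.shape ℓ' = openEnd s M C (ℓ' i) := by
  have hn := a.nodup_labels hℓ
  have hn' := Multiset.nodup_add.1 hn
  rw [hs] at hn hn'
  simp only [openEnd, Multiset.cons_bind, Cycle.coe_toMultiset] at hn'
  have h1 := hn'.1
  rw [← Multiset.cons_coe, Multiset.cons_add, Multiset.nodup_cons, Multiset.mem_add] at h1
  have h2 : ℓ i ∉ C := fun hc => Multiset.disjoint_left.1 hn'.2.2 (by simp) hc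
  have h3 := map_update_closed (u' := ℓ' i) (C := s) (fun hc => h1.1 (Or.inl hc))
  rw [a.shape_update hℓ i h, hs]
  refine Shape.ext ?_ (map_update_closed h2)
  simp only [openEnd, Multiset.map_cons, Cycle.map_coe, List.map_cons, Function.update_self]
  rw [map_update_cycles (fun hc => h1.1 (Or.inr hc))]
  congr 3
  refine (List.map_congr_left fun x hx => ?_).trans (List.map_id s)
  exact Function.update_of_ne (fun e => h1.1 (Or.inl (by rwa [e] at hx))) _ _

theorem Biarity.shape_closedEnd {a : Biarity} {ℓ ℓ' : a.Leg → ℕ} (hℓ : Function.Injective ℓ)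
    (i : a.Leg) (h : ∀ j, j ≠ i → ℓ' j = ℓ j) {M : Multiset (Cycle ℕ)}
    {C : Multiset ℕ} (hs : a.shape ℓ = closedEnd M C (ℓ i)) :
    a.shape ℓ' = closedEnd M C (ℓ' i) := by
  have hn := a.nodup_labels hℓ
  rw [hs, Shape.labels, closedEnd, Multiset.nodup_add] at hn
  have h2 : ℓ i ∉ C := (Multiset.nodup_cons.1 hn.2.1).1
  have h1 : ℓ i ∉ M.bind Cycle.toMultiset := fun hc =>
    Multiset.disjoint_left.1 hn.2.2 hc (Multiset.mem_cons_self _ _)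
  rw [a.shape_update hℓ i h, hs]
  refine Shape.ext (map_update_cycles h1) ?_
  simp only [closedEnd, Multiset.map_cons, Function.update_self, map_update_closed h2]

/-- Labellings of the pieces of a gluing, with prescribed labels of the glued inputs. -/
theorem Gluing.exists_labellings {a b r : Biarity} (w : Gluing a b r) {k : r.Leg → ℕ}
    (hk : Function.Injective k) :
    ∃ (ℓ : ℕ → a.Leg → ℕ) (m : ℕ → b.Leg → ℕ),
      (∀ u, ℓ u w.left = u) ∧ (∀ v, m v w.right = v) ∧
      (∀ u u' j, j ≠ w.left → ℓ u j = ℓ u' j) ∧ (∀ v v' j, j ≠ w.right → m v j = m v' j) ∧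
      (∀ u, (∀ x, k x ≠ u) → Function.Injective (ℓ u)) ∧
      (∀ v, (∀ x, k x ≠ v) → Function.Injective (m v)) ∧
      ∀ u v, w.IsLabelled (ℓ u) (m v) k := by
  classical
  have hl : ∀ j, j ≠ w.left ↔ ∃ x, w.leg x = Sum.inl j := fun j => by
    rw [w.mem_range_leg]; simp
  have hr : ∀ j, j ≠ w.right ↔ ∃ x, w.leg x = Sum.inr j := fun j => by
    rw [w.mem_range_leg]; simp
  -- An unglued input of a piece comes from exactly one input of `r` and inherits its label. The
  -- default value is taken only at the glued input.
  let f : ℕ → a.Leg → ℕ := fun u j =>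
    if h : ∃ x, w.leg x = Sum.inl j then k h.choose else u
  let g : ℕ → b.Leg → ℕ := fun v j =>
    if h : ∃ x, w.leg x = Sum.inr j then k h.choose else v
  have fl : ∀ u, f u w.left = u := fun u => dif_neg fun h => (hl _).2 h rfl
  have gr : ∀ v, g v w.right = v := fun v => dif_neg fun h => (hr _).2 h rfl
  have fx : ∀ u x j, w.leg x = Sum.inl j → f u j = k x := fun u x j h => by
    have h' : ∃ x, w.leg x = Sum.inl j := ⟨x, h⟩
    rw [show f u j = k h'.choose from dif_pos h', w.injective (h'.choose_spec.trans h.symm)]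
  have gx : ∀ v x j, w.leg x = Sum.inr j → g v j = k x := fun v x j h => by
    have h' : ∃ x, w.leg x = Sum.inr j := ⟨x, h⟩
    rw [show g v j = k h'.choose from dif_pos h', w.injective (h'.choose_spec.trans h.symm)]
  refine ⟨f, g, fl, gr, fun u u' j hj => ?_, fun v v' j hj => ?_, fun u hu i j hij => ?_,
    fun v hv i j hij => ?_, fun u v x => ?_⟩
  · obtain ⟨x, hx⟩ := (hl j).1 hj
    rw [fx u x j hx, fx u' x j hx]
  · obtain ⟨x, hx⟩ := (hr j).1 hj
    rw [gx v x j hx, gx v' x j hx]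
  · rcases eq_or_ne i w.left with rfl | hi <;> rcases eq_or_ne j w.left with rfl | hj
    · rfl
    · obtain ⟨x, hx⟩ := (hl j).1 hj
      rw [fl, fx u x j hx] at hij
      exact (hu x hij.symm).elim
    · obtain ⟨x, hx⟩ := (hl i).1 hi
      rw [fl, fx u x i hx] at hij
      exact (hu x hij).elim
    · obtain ⟨x, hx⟩ := (hl i).1 hi
      obtain ⟨y, hy⟩ := (hl j).1 hj
      rw [fx u x i hx, fx u y j hy] at hij
      exact Sum.inl_injective (hx.symm.trans ((congrArg w.leg (hk hij)).trans hy))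
  · rcases eq_or_ne i w.right with rfl | hi <;> rcases eq_or_ne j w.right with rfl | hj
    · rfl
    · obtain ⟨x, hx⟩ := (hr j).1 hj
      rw [gr, gx v x j hx] at hij
      exact (hv x hij.symm).elim
    · obtain ⟨x, hx⟩ := (hr i).1 hi
      rw [gr, gx v x i hx] at hij
      exact (hv x hij).elim
    · obtain ⟨x, hx⟩ := (hr i).1 hi
      obtain ⟨y, hy⟩ := (hr j).1 hj
      rw [gx v x i hx, gx v y j hy] at hij
      exact Sum.inr_injective (hx.symm.trans ((congrArg w.leg (hk hij)).trans hy))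
  · rcases hx : w.leg x with j | j
    · exact fx u x j hx
    · exact gx v x j hx

/-- A composite element decomposes into labelled pieces. -/
theorem exists_cut (z : LabelledElement H) {a b : Biarity} (w : Gluing a b z.bi)
    {x : H.obj a} {y : H.obj b} (h : z.el = H.comp w x y) :
    (∃ s M C t N D, Cut z (openEnd s M C) (openEnd t N D)) ∨
    ∃ M C N D, Cut z (closedEnd M C) (closedEnd N D) := by
  obtain ⟨ℓ, m, hl, hm, el, em, il, im, hw⟩ := w.exists_labellings z.inj
  have fresh : ∀ u v, (u ::ₘ v ::ₘ z.shape.labels).Nodup →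
      (∀ i, z.lab i ≠ u) ∧ (∀ i, z.lab i ≠ v) := by
    intro u v huv
    rw [Multiset.nodup_cons, Multiset.nodup_cons, Multiset.mem_cons] at huv
    exact ⟨fun i hi => huv.1 (Or.inr ((z.bi.mem_labels z.lab u).2 ⟨i, hi⟩)),
      fun i hi => huv.2.1 ((z.bi.mem_labels z.lab v).2 ⟨i, hi⟩)⟩
  have mk : ∀ A B : ℕ → Shape, (∀ u, a.shape (ℓ u) = A u) → (∀ v, b.shape (m v) = B v) →
      Cut z A B := fun A B hA hB u v huv =>
    ⟨⟨a, ℓ u, il u (fresh u v huv).1, x⟩, ⟨b, m v, im v (fresh u v huv).2, y⟩, hA u, hB v, w, hl u,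
      hm v, hw u v, h⟩
  -- A single fresh pair decides the colour of the gluing and the data of both ends; any other pair
  -- merely replaces the glued labels.
  obtain ⟨u, v, huv⟩ := exists_fresh _ z.nodup
  have iu := il u (fresh u v huv).1
  have iv := im v (fresh u v huv).2
  have hg := (hw u v).glues
  rw [hl, hm] at hg
  generalize hA : a.shape (ℓ u) = A at hg
  generalize hB : b.shape (m v) = B at hg
  generalize hT : z.bi.shape z.lab = T at hg
  cases hg with
  | ofOpen s t M N C D =>
    refine Or.inl ⟨s, M, C, t, N, D, mk _ _ (fun u' => ?_) fun v' => ?_⟩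
    · have := Biarity.shape_openEnd iu w.left (fun j hj => el u' u j hj) (hA.trans (by rw [hl]; rfl))
      rwa [hl] at this
    · have := Biarity.shape_openEnd iv w.right (fun j hj => em v' v j hj) (hB.trans (by rw [hm]; rfl))
      rwa [hm] at this
  | ofClosed M N C D =>
    refine Or.inr ⟨M, C, N, D, mk _ _ (fun u' => ?_) fun v' => ?_⟩
    · have := Biarity.shape_closedEnd iu w.left (fun j hj => el u' u j hj) (hA.trans (by rw [hl]; rfl))
      rwa [hl] at this
    · have := Biarity.shape_closedEnd iv w.right (fun j hj => em v' v j hj) (hB.trans (by rw [hm]; rfl))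
      rwa [hm] at this

/-! ## Uniqueness of elements -/

/-- The shapes of the three generators. -/
inductive Shape.IsBase : Shape → Prop
  | mu (p q r : ℕ) : IsBase ⟨{(([p, q, r] : List ℕ) : Cycle ℕ)}, 0⟩
  | omega (d e f : ℕ) : IsBase ⟨0, d ::ₘ e ::ₘ {f}⟩
  | phi (p d : ℕ) : IsBase ⟨{(([p] : List ℕ) : Cycle ℕ)}, {d}⟩

/-- The hybrid is generated by one element of each base shape, and satisfies the four relations,
formulated as changes of decompositions. -/
structure CyclicHybrid.IsGenerated (H : CyclicHybrid.{u}) : Prop where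
  bounded : H.Bounded
  inhabits : ∀ T : Shape, T.IsBase → T.labels.Nodup → H.Inhabits T
  subsingle : ∀ T : Shape, T.IsBase → H.Subsingle T
  cut : ∀ z : LabelledElement H, ¬ z.shape.IsBase →
    (∃ s M C t N D, Cut z (openEnd s M C) (openEnd t N D)) ∨
    ∃ M C N D, Cut z (closedEnd M C) (closedEnd N D)
  open_assoc : ∀ (z : LabelledElement H) (p q t u : ℕ),
    Cut z (openEnd [p, q] 0 0) (openEnd [t, u] 0 0) →
    Cut z (openEnd [u, p] 0 0) (openEnd [q, t] 0 0)
  closed_assoc : ∀ (z : LabelledElement H) (d e h i : ℕ),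
    Cut z (closedEnd 0 (d ::ₘ {e})) (closedEnd 0 (h ::ₘ {i})) →
    Cut z (closedEnd 0 (d ::ₘ {i})) (closedEnd 0 (e ::ₘ {h}))
  morphism : ∀ (z : LabelledElement H) (p d e : ℕ), H.UniqueBelow z.shape.size →
    Cut z (openEnd [p] 0 {d}) (openEnd [] 0 {e}) →
    Cut z (closedEnd {(([p] : List ℕ) : Cycle ℕ)} 0) (closedEnd 0 (d ::ₘ {e}))
  centrality : ∀ (z : LabelledElement H) (p r d : ℕ),
    Cut z (openEnd [] 0 {d}) (openEnd [p, r] 0 0) → Cut z (openEnd [] 0 {d}) (openEnd [r, p] 0 0)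

/-- All elements of shape `T` admit the same decomposition into smaller pieces. -/
def CyclicHybrid.StandardCut (H : CyclicHybrid.{u}) (T : Shape) : Prop :=
  ∃ A B : ℕ → Shape, (∀ u v, Glues u v (A u) (B v) T) ∧ (∀ u, (A u).Valid) ∧ (∀ u, (B u).Valid) ∧
    ∀ z : LabelledElement H, z.shape = T → Cut z A B

/-! ### Standard cuts, case by case -/

theorem exists_cons_of_card_pos {α : Type} {C : Multiset α} (h : 0 < Multiset.card C) :
    ∃ x S, C = x ::ₘ S := by
  obtain ⟨x, hx⟩ := Multiset.card_pos_iff_exists_mem.1 h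
  obtain ⟨S, hS⟩ := Multiset.exists_cons_of_mem hx
  exact ⟨x, S, hS⟩

/-- Decides on which side of a cut `x` lies. The second alternative has its sum reversed so that it
fits the cut with its sides exchanged. -/
theorem add_eq_cons {α : Type} {A B R : Multiset α} {x : α} (h : A + B = x ::ₘ R) :
    (∃ A', A = x ::ₘ A' ∧ A' + B = R) ∨ (∃ B', B = x ::ₘ B' ∧ B' + A = R) := by
  have hx : x ∈ A + B := h ▸ Multiset.mem_cons_self x R
  rcases Multiset.mem_add.1 hx with hx | hx
  · obtain ⟨A', rfl⟩ := Multiset.exists_cons_of_mem hx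
    rw [Multiset.cons_add, Multiset.cons_inj_right] at h
    exact Or.inl ⟨A', rfl, h⟩
  · obtain ⟨B', rfl⟩ := Multiset.exists_cons_of_mem hx
    rw [Multiset.add_cons, Multiset.cons_inj_right] at h
    exact Or.inr ⟨B', rfl, (add_comm _ _).trans h⟩

theorem add_eq_zero_multiset {α : Type} {A B : Multiset α} (h : A + B = 0) : A = 0 ∧ B = 0 := by
  have h := congrArg Multiset.card h
  rw [Multiset.card_add, Multiset.card_zero] at h
  exact ⟨Multiset.card_eq_zero.1 (by omega), Multiset.card_eq_zero.1 (by omega)⟩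

/-- No boundaries. -/
theorem standardCut_sphere (hH : H.IsGenerated) {C : Multiset ℕ} (hb : ¬ (Shape.mk 0 C).IsBase)
    (ih : H.UniqueBelow (Shape.mk 0 C).size)
    (hC : 4 ≤ Multiset.card C) : H.StandardCut ⟨0, C⟩ := by
  obtain ⟨d, C', rfl⟩ := exists_cons_of_card_pos (C := C) (by omega)
  rw [Multiset.card_cons] at hC
  obtain ⟨e, R, rfl⟩ := exists_cons_of_card_pos (C := C') (by omega)
  rw [Multiset.card_cons] at hC
  refine ⟨closedEnd 0 (d ::ₘ {e}), closedEnd 0 R, fun u v => glues_closedEnd rfl (by simp),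
    fun u => by simp [valid_closedEnd], fun u => by rw [valid_closedEnd]; simp; omega, ?_⟩
  intro z hz
  rw [← hz] at ih
  have hB := hH.bounded
  -- If `d` and `e` lie on the same side, the remaining inputs `S` of that side are moved across.
  have together : ∀ S D, S + D = R → Cut z (closedEnd 0 (d ::ₘ e ::ₘ S)) (closedEnd 0 D) →
      Cut z (closedEnd 0 (d ::ₘ {e})) (closedEnd 0 R) := by
    intro S D hR h
    rcases Nat.eq_zero_or_pos (Multiset.card S) with h0 | h0
    · rw [Multiset.card_eq_zero] at h0
      subst h0
      rw [zero_add] at hR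
      exact hR ▸ h
    · exact h.closed_closed hB ih 0 0 (d ::ₘ {e}) S rfl (by simp) rfl hR
        (fun u => by simp [valid_closedEnd]) (fun _ => h0)
  have together' : ∀ S D, S + D = R → Cut z (closedEnd 0 (e ::ₘ d ::ₘ S)) (closedEnd 0 D) →
      Cut z (closedEnd 0 (d ::ₘ {e})) (closedEnd 0 R) := by
    intro S D hR h
    rw [Multiset.cons_swap] at h
    exact together S D hR h
  -- If `d` and `e` lie on different sides, a side with two further inputs can hand over its own
  -- letter. Otherwise both sides are closed pairs of pants, and closed associativity applies.
  have apart : ∀ S D, S + D = R → Cut z (closedEnd 0 (d ::ₘ S)) (closedEnd 0 (e ::ₘ D)) →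
      Cut z (closedEnd 0 (d ::ₘ {e})) (closedEnd 0 R) := by
    intro S D hR h
    obtain ⟨_, hv⟩ := h.valid_left hB
    obtain ⟨_, hv'⟩ := h.valid_right hB
    rw [valid_closedEnd, Multiset.card_cons, Multiset.card_zero] at hv hv'
    by_cases hS : 2 ≤ Multiset.card S
    · refine together D S (by rw [add_comm, hR]) ((h.closed_closed hB ih 0 0 S {d} rfl
        (by rw [add_comm]; rfl) rfl rfl (fun u => ?_) (fun _ => by simp)).symm hB)
      rw [valid_closedEnd]
      simp [hS]
    by_cases hD : 2 ≤ Multiset.card D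
    · refine together' S D hR (((h.symm hB).closed_closed hB ih 0 0 D {e} rfl
        (by rw [add_comm]; rfl) rfl rfl (fun u => ?_) (fun _ => by simp)).symm hB)
      rw [valid_closedEnd]
      simp [hD]
    · obtain ⟨a, rfl⟩ := Multiset.card_eq_one.1 (show Multiset.card S = 1 by omega)
      obtain ⟨b, rfl⟩ := Multiset.card_eq_one.1 (show Multiset.card D = 1 by omega)
      have h2 : Cut z (closedEnd 0 (d ::ₘ {a})) (closedEnd 0 (b ::ₘ {e})) := by
        rwa [← Multiset.cons_zero e, Multiset.cons_swap b e 0]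
      subst hR
      exact hH.closed_assoc z _ _ _ _ h2
  have main : ∀ S D, S + D = e ::ₘ R → Cut z (closedEnd 0 (d ::ₘ S)) (closedEnd 0 D) →
      Cut z (closedEnd 0 (d ::ₘ {e})) (closedEnd 0 R) := by
    intro S D hR h
    rcases add_eq_cons hR with ⟨S', rfl, hR'⟩ | ⟨D', rfl, hR'⟩
    · exact together _ _ hR' h
    · exact apart _ _ ((add_comm _ _).trans hR') h
  rcases hH.cut z (hz ▸ hb) with ⟨s, M, C, t, N, D, h⟩ | ⟨M, C, N, D, h⟩
  · have := hz.symm.trans (h.shape_eq fun u v => glues_openEnd rfl rfl rfl)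
    simp at this
  · have := hz.symm.trans (h.shape_eq fun u v => glues_closedEnd rfl rfl)
    simp only [Shape.mk.injEq] at this
    obtain ⟨rfl, rfl⟩ := add_eq_zero_multiset this.1.symm
    rcases add_eq_cons this.2.symm with ⟨S', rfl, hR⟩ | ⟨D', rfl, hR⟩
    · exact main _ _ hR h
    · exact main _ _ hR (h.symm hB)

/-- The merged cycle is the only boundary of the result, so that neither piece has another one. -/
theorem Cut.open_disc {z : LabelledElement H} {o : Cycle ℕ} {E : Multiset ℕ}
    (hz : z.shape = ⟨{o}, E⟩) {s t : List ℕ} {M N : Multiset (Cycle ℕ)} {C D : Multiset ℕ}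
    (h : Cut z (openEnd s M C) (openEnd t N D)) :
    M = 0 ∧ N = 0 ∧ ((s ++ t : List ℕ) : Cycle ℕ) = o ∧ C + D = E := by
  have := hz.symm.trans (h.shape_eq fun u v => glues_openEnd rfl rfl rfl)
  simp only [Shape.mk.injEq] at this
  obtain ⟨h1, h2⟩ := this
  have hc := congrArg Multiset.card h1
  rw [Multiset.card_cons, Multiset.card_singleton, Multiset.card_add] at hc
  have hM := Multiset.card_eq_zero.1 (show Multiset.card M = 0 by omega)
  have hN := Multiset.card_eq_zero.1 (show Multiset.card N = 0 by omega)
  subst hM hN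
  rw [add_zero, Multiset.cons_zero, Multiset.singleton_inj] at h1
  exact ⟨rfl, rfl, h1.symm, h2.symm⟩

theorem Cut.closed_disc {z : LabelledElement H} {o : Cycle ℕ} {E : Multiset ℕ}
    (hz : z.shape = ⟨{o}, E⟩) {M N : Multiset (Cycle ℕ)} {C D : Multiset ℕ}
    (h : Cut z (closedEnd M C) (closedEnd N D)) :
    (M = {o} ∧ N = 0 ∨ M = 0 ∧ N = {o}) ∧ C + D = E := by
  have := hz.symm.trans (h.shape_eq fun u v => glues_closedEnd rfl rfl)
  simp only [Shape.mk.injEq] at this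
  refine ⟨?_, this.2.symm⟩
  rcases add_eq_cons (this.1.symm.trans (Multiset.cons_zero o).symm) with
    ⟨A, rfl, h0⟩ | ⟨A, rfl, h0⟩
  · obtain ⟨rfl, rfl⟩ := add_eq_zero_multiset h0
    exact Or.inl ⟨rfl, rfl⟩
  · obtain ⟨rfl, rfl⟩ := add_eq_zero_multiset h0
    exact Or.inr ⟨rfl, rfl⟩

/-- One boundary, no closed inputs. -/
theorem standardCut_openDisc (hH : H.IsGenerated) {p q : ℕ} {R : List ℕ}
    (hb : ¬ (Shape.mk {((p :: q :: R : List ℕ) : Cycle ℕ)} 0).IsBase)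
    (ih : H.UniqueBelow (Shape.mk {((p :: q :: R : List ℕ) : Cycle ℕ)} 0).size)
    (hR : 2 ≤ R.length) : H.StandardCut ⟨{((p :: q :: R : List ℕ) : Cycle ℕ)}, 0⟩ := by
  refine ⟨openEnd [p, q] 0 0, openEnd R 0 0, fun u v => glues_openEnd rfl rfl rfl,
    fun u => by simp [valid_openEnd], fun u => by rw [valid_openEnd]; simp; omega, ?_⟩
  intro z hz
  have hn := z.nodup
  rw [hz, Shape.labels, add_zero] at hn
  simp only [Multiset.singleton_bind, Cycle.coe_toMultiset, Multiset.coe_nodup] at hn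
  rw [← hz] at ih
  have hB := hH.bounded
  -- Here `p` and `q` are adjacent in one piece. Since labels do not repeat, reading the cycle from
  -- `p` on identifies the remaining labels in order with `R`.
  have together : ∀ s₁ s₃ t, Cut z (openEnd (s₁ ++ p :: q :: s₃) 0 0) (openEnd t 0 0) →
      Cut z (openEnd [p, q] 0 0) (openEnd R 0 0) := by
    intro s₁ s₃ t h
    obtain ⟨-, -, ho, -⟩ := h.open_disc hz
    have hR' : q :: R = q :: (s₃ ++ t ++ s₁) := by
      refine eq_of_coe_cons_eq (u := p) hn (ho.symm.trans ?_)
      simpa using coe_append_comm s₁ (p :: q :: s₃ ++ t)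
    rw [List.cons_inj_right] at hR'
    rcases Nat.eq_zero_or_pos (s₁.length + s₃.length) with h0 | h0
    · obtain rfl := List.eq_nil_of_length_eq_zero (show s₁.length = 0 by omega)
      obtain rfl := List.eq_nil_of_length_eq_zero (show s₃.length = 0 by omega)
      rw [hR']
      simpa using h
    · exact h.open_open hB ih s₁ [p, q] s₃ 0 0 (by simp) rfl hR'.symm rfl (by simp) (by omega)
  -- The cut passes between `p` and `q`. If a piece has two further labels, these are cut off, and
  -- `p` and `q` come to share a piece. Two open pairs of pants are left to open associativity.
  have apart : ∀ s t, Cut z (openEnd (s ++ [p]) 0 0) (openEnd (q :: t) 0 0) →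
      Cut z (openEnd [p, q] 0 0) (openEnd R 0 0) := by
    intro s t h
    obtain ⟨_, hv⟩ := h.valid_left hB
    obtain ⟨_, hv'⟩ := h.valid_right hB
    have hv := (valid_openEnd.1 hv).2 rfl
    have hv' := (valid_openEnd.1 hv').2 rfl
    simp only [Multiset.card_zero, List.length_append, List.length_cons, List.length_nil] at hv hv'
    by_cases hs : 2 ≤ s.length
    · refine together [] t s ((h.open_open hB ih (s' := p :: q :: t) [] s [p] 0 0 (by simp)
        rfl (by simp) rfl (by omega) (by simp)).symm hB)
    by_cases ht : 2 ≤ t.length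
    · refine together s [] t (((h.symm hB).open_open hB ih (s' := s ++ [p, q]) [q] t [] 0 0 (by simp)
        rfl (by simp) rfl (by omega) (by simp)).symm hB)
    · obtain ⟨a, rfl⟩ := List.length_eq_one_iff.1 (show s.length = 1 by omega)
      obtain ⟨b, rfl⟩ := List.length_eq_one_iff.1 (show t.length = 1 by omega)
      have := hH.open_assoc z _ _ _ _ (h.symm hB)
      exact together [] [] _ this
  have main : ∀ s₁ s₂ t, Cut z (openEnd (s₁ ++ p :: s₂) 0 0) (openEnd t 0 0) →
      Cut z (openEnd [p, q] 0 0) (openEnd R 0 0) := by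
    intro s₁ s₂ t h
    obtain ⟨-, -, ho, -⟩ := h.open_disc hz
    have hR' : q :: R = s₂ ++ t ++ s₁ := by
      refine eq_of_coe_cons_eq (u := p) hn (ho.symm.trans ?_)
      simpa using coe_append_comm s₁ (p :: s₂ ++ t)
    obtain ⟨_, hv'⟩ := h.valid_right hB
    rw [valid_openEnd] at hv'
    simp only [Multiset.card_zero] at hv'
    -- The successor of `p` is the next label of its piece or, if `p` is last there, the first label
    -- of the other piece; this successor is `q`.
    rcases s₂ with _ | ⟨x, s₃⟩
    · rcases t with _ | ⟨x, t⟩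
      · simp at hv'
      · simp only [List.nil_append, List.cons_append, List.cons.injEq] at hR'
        obtain ⟨rfl, -⟩ := hR'
        exact apart _ _ h
    · simp only [List.cons_append, List.cons.injEq] at hR'
      obtain ⟨rfl, -⟩ := hR'
      exact together _ _ _ h
  rcases hH.cut z (hz ▸ hb) with ⟨s, M, C, t, N, D, h⟩ | ⟨M, C, N, D, h⟩
  · obtain ⟨rfl, rfl, ho, hC⟩ := h.open_disc hz
    obtain ⟨rfl, rfl⟩ := add_eq_zero_multiset hC
    have hp : p ∈ s ++ t := by
      have : p ∈ ((s ++ t : List ℕ) : Cycle ℕ) := by rw [ho]; simp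
      exact this
    rcases List.mem_append.1 hp with hp | hp
    · obtain ⟨s₁, s₂, rfl⟩ := List.append_of_mem hp
      exact main _ _ _ h
    · obtain ⟨s₁, s₂, rfl⟩ := List.append_of_mem hp
      exact main _ _ _ (h.symm hB)
  · obtain ⟨hM, hC⟩ := h.closed_disc hz
    obtain ⟨rfl, rfl⟩ := add_eq_zero_multiset hC
    obtain ⟨_, hv⟩ := h.valid_left hB
    obtain ⟨_, hv'⟩ := h.valid_right hB
    rw [valid_closedEnd] at hv hv'
    rcases hM with ⟨rfl, rfl⟩ | ⟨rfl, rfl⟩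
    · simp at hv'
    · simp at hv

/-- One boundary, one closed input. -/
theorem standardCut_disc_one (hH : H.IsGenerated) {l : List ℕ} {d : ℕ}
    (hb : ¬ (Shape.mk {(l : Cycle ℕ)} {d}).IsBase)
    (ih : H.UniqueBelow (Shape.mk {(l : Cycle ℕ)} {d}).size)
    (hl : 2 ≤ l.length) : H.StandardCut ⟨{(l : Cycle ℕ)}, {d}⟩ := by
  refine ⟨openEnd [] 0 {d}, openEnd l 0 0, fun u v => glues_openEnd rfl rfl rfl,
    fun u => by simp [valid_openEnd], fun u => by rw [valid_openEnd]; simp; omega, ?_⟩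
  intro z hz
  rw [← hz] at ih
  have hB := hH.bounded
  -- The place of the glued input in the cycle is immaterial. Splitting off a block of length at
  -- least two leaves `d` in a smaller disc with the other block; by uniqueness of that disc, φ can
  -- be pulled out on the opposite side of the block. Only two blocks of length one require
  -- centrality.
  have rotate : ∀ l₁ l₂, Cut z (openEnd [] 0 {d}) (openEnd (l₁ ++ l₂) 0 0) →
      Cut z (openEnd [] 0 {d}) (openEnd (l₂ ++ l₁) 0 0) := by
    intro l₁ l₂ h
    rcases Nat.eq_zero_or_pos l₁.length with h1 | h1
    · obtain rfl := List.eq_nil_of_length_eq_zero h1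
      simpa using h
    rcases Nat.eq_zero_or_pos l₂.length with h2 | h2
    · obtain rfl := List.eq_nil_of_length_eq_zero h2
      simpa using h
    by_cases h3 : 2 ≤ l₂.length
    · have h' := ((h.symm hB).open_open hB ih (s' := l₁) (D' := {d}) l₁ l₂ [] 0 0 (by simp) rfl
        (by simp) (by simp) (by omega) (by omega)).symm hB
      exact h'.open_open hB ih l₁ [] [] 0 {d} (by simp) (by simp) (by simp) rfl (by simp)
        (by omega)
    by_cases h4 : 2 ≤ l₁.length
    · have h' := ((h.symm hB).open_open hB ih (s' := l₂) (D' := {d}) [] l₁ l₂ 0 0 (by simp) rfl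
        (by simp) (by simp) (by omega) (by omega)).symm hB
      exact h'.open_open hB ih [] [] l₂ 0 {d} (by simp) (by simp) (by simp) rfl (by simp)
        (by omega)
    · obtain ⟨a, rfl⟩ := List.length_eq_one_iff.1 (show l₁.length = 1 by omega)
      obtain ⟨b, rfl⟩ := List.length_eq_one_iff.1 (show l₂.length = 1 by omega)
      exact hH.centrality z _ _ _ h
  have main : ∀ s t, Cut z (openEnd s 0 {d}) (openEnd t 0 0) →
      Cut z (openEnd [] 0 {d}) (openEnd l 0 0) := by
    intro s t h
    obtain ⟨-, -, ho, -⟩ := h.open_disc hz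
    have h' : Cut z (openEnd [] 0 {d}) (openEnd (s ++ t) 0 0) := by
      rcases Nat.eq_zero_or_pos s.length with h1 | h1
      · obtain rfl := List.eq_nil_of_length_eq_zero h1
        exact h
      · exact h.open_open hB ih [] [] s 0 {d} (by simp) (by simp) (by simp) rfl (by simp)
          (by omega)
    obtain ⟨n, hn, rfl⟩ := List.isRotated_iff_mod.1 (Cycle.coe_eq_coe.1 ho)
    rw [List.rotate_eq_drop_append_take hn]
    apply rotate
    rwa [List.take_append_drop]
  rcases hH.cut z (hz ▸ hb) with ⟨s, M, C, t, N, D, h⟩ | ⟨M, C, N, D, h⟩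
  · obtain ⟨rfl, rfl, ho, hC⟩ := h.open_disc hz
    rcases add_eq_cons (hC.trans (Multiset.cons_zero d).symm) with ⟨A, rfl, h0⟩ | ⟨A, rfl, h0⟩
    · obtain ⟨rfl, rfl⟩ := add_eq_zero_multiset h0
      exact main _ _ h
    · obtain ⟨rfl, rfl⟩ := add_eq_zero_multiset h0
      exact main _ _ (h.symm hB)
  · obtain ⟨hM, hC⟩ := h.closed_disc hz
    have hC := congrArg Multiset.card hC
    rw [Multiset.card_add, Multiset.card_singleton] at hC
    obtain ⟨_, hv⟩ := h.valid_left hB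
    obtain ⟨_, hv'⟩ := h.valid_right hB
    rw [valid_closedEnd] at hv hv'
    rcases hM with ⟨rfl, rfl⟩ | ⟨rfl, rfl⟩
    · have := hv'.2 rfl; omega
    · have := hv.2 rfl; omega

/-- One nonempty boundary, at least two closed inputs. -/
theorem standardCut_disc (hH : H.IsGenerated) {l : List ℕ} {E : Multiset ℕ}
    (hb : ¬ (Shape.mk {(l : Cycle ℕ)} E).IsBase)
    (ih : H.UniqueBelow (Shape.mk {(l : Cycle ℕ)} E).size)
    (hl : l ≠ []) (hE : 2 ≤ Multiset.card E) : H.StandardCut ⟨{(l : Cycle ℕ)}, E⟩ := by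
  have hl' : numNonempty ({(l : Cycle ℕ)} : Multiset (Cycle ℕ)) = 1 := by
    rw [← Multiset.cons_zero, numNonempty_cons, if_neg (by simpa using hl)]
    simp [numNonempty]
  have vl : ∀ C u, (closedEnd {(l : Cycle ℕ)} C u).Valid := fun C u => by
    simp [valid_closedEnd, hl']
  refine ⟨closedEnd {(l : Cycle ℕ)} 0, closedEnd 0 E, fun u v => glues_closedEnd rfl (by simp),
    vl 0, fun u => by rw [valid_closedEnd]; simp [hE], ?_⟩
  intro z hz
  rw [← hz] at ih
  have hB := hH.bounded
  have byClosed : ∀ C D, Cut z (closedEnd {(l : Cycle ℕ)} C) (closedEnd 0 D) →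
      Cut z (closedEnd {(l : Cycle ℕ)} 0) (closedEnd 0 E) := by
    intro C D h
    have hC := (h.closed_disc hz).2
    rcases Nat.eq_zero_or_pos (Multiset.card C) with h0 | h0
    · rw [Multiset.card_eq_zero] at h0
      subst h0
      rw [zero_add] at hC
      exact hC ▸ h
    · exact h.closed_closed hB ih _ 0 0 C (by simp) (by simp) rfl hC (vl 0) (fun _ => h0)
  -- Two closed inputs in the same piece can be cut off by a closed curve.
  have many : ∀ s C t D, 2 ≤ Multiset.card C → Cut z (openEnd s 0 C) (openEnd t 0 D) →
      Cut z (closedEnd {(l : Cycle ℕ)} 0) (closedEnd 0 E) := by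
    intro s C t D hC h
    have ho := (h.open_disc hz).2.2.1
    have h' := h.open_closed hB ih (fun u => by rw [valid_closedEnd]; simp [hC])
    rw [ho, Multiset.cons_zero] at h'
    exact byClosed _ _ (h'.symm hB)
  -- Cutting the block `s` away from `d` brings `d` and `e` into one piece.
  have long : ∀ s d t e, 2 ≤ s.length → Cut z (openEnd s 0 {d}) (openEnd t 0 {e}) →
      Cut z (closedEnd {(l : Cycle ℕ)} 0) (closedEnd 0 E) := by
    intro s d t e hs h
    have h' := h.open_open hB ih [] s [] {d} 0 (by simp) (by simp) rfl rfl (by omega) (by simp)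
    exact many _ _ _ _ (by simp) (h'.symm hB)
  -- The one configuration that requires the morphism property.
  have short : ∀ p d e, Cut z (openEnd [p] 0 {d}) (openEnd [] 0 {e}) →
      Cut z (closedEnd {(l : Cycle ℕ)} 0) (closedEnd 0 E) := by
    intro p d e h
    obtain ⟨-, -, ho, hC⟩ := h.open_disc hz
    have := hH.morphism z p d e ih h
    rw [← ho, ← hC]
    exact this
  rcases hH.cut z (hz ▸ hb) with ⟨s, M, C, t, N, D, h⟩ | ⟨M, C, N, D, h⟩
  · obtain ⟨rfl, rfl, ho, hC⟩ := h.open_disc hz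
    by_cases hC2 : 2 ≤ Multiset.card C
    · exact many _ _ _ _ hC2 h
    by_cases hD2 : 2 ≤ Multiset.card D
    · exact many _ _ _ _ hD2 (h.symm hB)
    have hc := congrArg Multiset.card hC
    rw [Multiset.card_add] at hc
    obtain ⟨d, rfl⟩ := Multiset.card_eq_one.1 (show Multiset.card C = 1 by omega)
    obtain ⟨e, rfl⟩ := Multiset.card_eq_one.1 (show Multiset.card D = 1 by omega)
    match s, t with
    | [], [] => exact (hl ((Cycle.coe_eq_nil _).1 ho.symm)).elim
    | [p], [] => exact short _ _ _ h
    | [], [q] => exact short _ _ _ (h.symm hB)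
    -- Neither block is long enough, but cutting off φ with `d` puts `p` and `q` together.
    | [p], [q] =>
      have h' := h.open_open hB ih (s' := [p, q]) (D' := {e}) [] [] [p] 0 {d} (by simp) (by simp)
        (by simp) (by simp) (by simp) (by simp)
      exact long _ _ _ _ (by simp) (h'.symm hB)
    | _ :: _ :: _, _ => exact long _ _ _ _ (by simp) h
    | _, _ :: _ :: _ => exact long _ _ _ _ (by simp) (h.symm hB)
  · obtain ⟨⟨rfl, rfl⟩ | ⟨rfl, rfl⟩, -⟩ := h.closed_disc hz
    · exact byClosed _ _ h
    · exact byClosed _ _ (h.symm hB)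

/-- One empty boundary. -/
theorem standardCut_emptyDisc (hH : H.IsGenerated) {E : Multiset ℕ}
    (hb : ¬ (Shape.mk {Cycle.nil} E).IsBase) (ih : H.UniqueBelow (Shape.mk {Cycle.nil} E).size)
    (hE : 2 ≤ Multiset.card E) : H.StandardCut ⟨{Cycle.nil}, E⟩ := by
  obtain ⟨d, R, rfl⟩ := exists_cons_of_card_pos (C := E) (by omega)
  rw [Multiset.card_cons] at hE
  refine ⟨openEnd [] 0 {d}, openEnd [] 0 R, fun u v => glues_openEnd rfl rfl (by simp),
    fun u => by simp [valid_openEnd], fun u => by rw [valid_openEnd]; simp; omega, ?_⟩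
  intro z hz
  rw [← hz] at ih
  have hB := hH.bounded
  have main : ∀ S D, S + D = R → Cut z (openEnd [] 0 (d ::ₘ S)) (openEnd [] 0 D) →
      Cut z (openEnd [] 0 {d}) (openEnd [] 0 R) := by
    intro S D hR h
    rcases Nat.eq_zero_or_pos (Multiset.card S) with h0 | h0
    · rw [Multiset.card_eq_zero] at h0
      subst h0
      rw [zero_add] at hR
      exact hR ▸ h
    · exact h.open_open hB ih [] [] [] S {d} rfl (by rw [add_comm]; rfl) rfl hR (by simp) (by simp [h0])
  have byOpen : ∀ C D, Cut z (openEnd [] 0 C) (openEnd [] 0 D) →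
      Cut z (openEnd [] 0 {d}) (openEnd [] 0 R) := by
    intro C D h
    rcases add_eq_cons (h.open_disc hz).2.2.2 with ⟨A, rfl, h0⟩ | ⟨A, rfl, h0⟩
    · exact main _ _ h0 h
    · exact main _ _ h0 (h.symm hB)
  -- Validity forces a further closed input next to the empty boundary, and `Cut.closed_open`
  -- replaces the closed cut by an open one.
  have byClosed : ∀ C D, Cut z (closedEnd {Cycle.nil} C) (closedEnd 0 D) →
      Cut z (openEnd [] 0 {d}) (openEnd [] 0 R) := by
    intro C D h
    obtain ⟨_, hv⟩ := h.valid_left hB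
    rw [valid_closedEnd, ← Cycle.coe_nil, ← Multiset.cons_zero, numNonempty_cons] at hv
    have hv := hv.1 (by simp)
    simp only [List.length_nil, if_true] at hv
    obtain ⟨x, S, rfl⟩ := exists_cons_of_card_pos (C := C) (by simp [numNonempty] at hv; omega)
    exact byOpen _ _ (h.closed_open hB ih)
  rcases hH.cut z (hz ▸ hb) with ⟨s, M, C, t, N, D, h⟩ | ⟨M, C, N, D, h⟩
  · obtain ⟨rfl, rfl, ho, hC⟩ := h.open_disc hz
    obtain ⟨rfl, rfl⟩ := List.append_eq_nil_iff.1 ((Cycle.coe_eq_nil _).1 ho)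
    exact byOpen _ _ h
  · obtain ⟨⟨rfl, rfl⟩ | ⟨rfl, rfl⟩, -⟩ := h.closed_disc hz
    · exact byClosed _ _ h
    · exact byClosed _ _ (h.symm hB)

/-- An open cut leaves a further boundary on at least one side. Validity of that side is just what
permits its part away from the glued cycle to be cut off by a closed curve. With several boundaries
only closed cuts remain to be compared. -/
theorem CyclicHybrid.IsGenerated.closed_cut (hH : H.IsGenerated) {z : LabelledElement H}
    {K : Multiset (Cycle ℕ)} {E : Multiset ℕ} (hz : z.shape = ⟨K, E⟩)
    (hb : ¬ (Shape.mk K E).IsBase) (ih : H.UniqueBelow (Shape.mk K E).size)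
    (hK : 2 ≤ Multiset.card K) :
    ∃ M C N D, M + N = K ∧ C + D = E ∧ Cut z (closedEnd M C) (closedEnd N D) := by
  rw [← hz] at ih
  have hB := hH.bounded
  have shape : ∀ {M C N D}, Cut z (closedEnd M C) (closedEnd N D) → M + N = K ∧ C + D = E := by
    intro M C N D h
    have := hz.symm.trans (h.shape_eq fun u v => glues_closedEnd rfl rfl)
    simp only [Shape.mk.injEq] at this
    exact ⟨this.1.symm, this.2.symm⟩
  have main : ∀ s M C t N D, 1 ≤ Multiset.card M → Cut z (openEnd s M C) (openEnd t N D) →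
      ∃ M C N D, M + N = K ∧ C + D = E ∧ Cut z (closedEnd M C) (closedEnd N D) := by
    intro s M C t N D hM h
    obtain ⟨_, hv⟩ := h.valid_left hB
    have hv := (valid_openEnd.1 hv).1 hM
    have h' := h.open_closed hB ih (fun u => by rw [valid_closedEnd]; omega)
    exact ⟨_, _, _, _, (shape h').1, (shape h').2, h'⟩
  rcases hH.cut z (hz ▸ hb) with ⟨s, M, C, t, N, D, h⟩ | ⟨M, C, N, D, h⟩
  · have := hz.symm.trans (h.shape_eq fun u v => glues_openEnd rfl rfl rfl)
    have hc := congrArg (fun T => Multiset.card T.cycles) this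
    simp only [Multiset.card_cons, Multiset.card_add] at hc
    rcases Nat.eq_zero_or_pos (Multiset.card M) with h0 | h0
    · exact main _ _ _ _ _ _ (by omega) (h.symm hB)
    · exact main _ _ _ _ _ _ h0 h
  · exact ⟨_, _, _, _, (shape h).1, (shape h).2, h⟩

/-- At least two boundaries, one of them nonempty. -/
theorem standardCut_nonempty (hH : H.IsGenerated) {o : Cycle ℕ} {K : Multiset (Cycle ℕ)}
    {E : Multiset ℕ} (hb : ¬ (Shape.mk (o ::ₘ K) E).IsBase)
    (ih : H.UniqueBelow (Shape.mk (o ::ₘ K) E).size) (ho : o ≠ Cycle.nil)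
    (hK : 1 ≤ Multiset.card K) (hE : 1 ≤ Multiset.card E + numNonempty K) :
    H.StandardCut ⟨o ::ₘ K, E⟩ := by
  have ho' : numNonempty {o} ≠ 0 := fun h => ho (by
    simpa using eq_replicate_of_numNonempty h)
  -- A nonempty boundary with one closed input is already stable, so `o` can be split off alone.
  have vo : ∀ C u, (closedEnd {o} C u).Valid := fun C u => by
    rw [valid_closedEnd, Multiset.card_singleton]
    omega
  refine ⟨closedEnd {o} 0, closedEnd K E, fun u v => glues_closedEnd rfl (by simp),
    vo 0, fun u => by rw [valid_closedEnd]; omega, ?_⟩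
  intro z hz
  have hB := hH.bounded
  obtain ⟨M, C, N, D, hM, hC, h⟩ := hH.closed_cut hz hb ih (by rw [Multiset.card_cons]; omega)
  rw [← hz] at ih
  have main : ∀ M C N D, M + N = K → C + D = E → Cut z (closedEnd (o ::ₘ M) C) (closedEnd N D) →
      Cut z (closedEnd {o} 0) (closedEnd K E) := by
    intro M C N D hM hC h
    by_cases h0 : Multiset.card M = 0 ∧ Multiset.card C = 0
    · rw [Multiset.card_eq_zero, Multiset.card_eq_zero] at h0
      obtain ⟨rfl, rfl⟩ := h0
      rw [zero_add] at hM hC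
      subst hM hC
      exact h
    · exact h.closed_closed hB ih {o} M 0 C rfl (by simp) hM hC (vo 0) (by omega)
  rcases add_eq_cons hM with ⟨A, rfl, h0⟩ | ⟨A, rfl, h0⟩
  · exact main _ _ _ _ h0 hC h
  · exact main _ _ _ _ h0 ((add_comm _ _).trans hC) (h.symm hB)

/-- At least two boundaries, all of them empty. -/
theorem standardCut_empty (hH : H.IsGenerated) {n : ℕ} {E : Multiset ℕ}
    (hb : ¬ (Shape.mk (Multiset.replicate n Cycle.nil) E).IsBase)
    (ih : H.UniqueBelow (Shape.mk (Multiset.replicate n Cycle.nil) E).size)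
    (hn : 2 ≤ n) (hE : 2 ≤ Multiset.card E) :
    H.StandardCut ⟨Multiset.replicate n Cycle.nil, E⟩ := by
  obtain ⟨d, R, rfl⟩ := exists_cons_of_card_pos (C := E) (by omega)
  rw [Multiset.card_cons] at hE
  obtain ⟨m, rfl⟩ : ∃ m, n = m + 1 := ⟨n - 1, by omega⟩
  have v : ∀ k C u, 1 ≤ Multiset.card C → 1 ≤ k →
      (closedEnd (Multiset.replicate k Cycle.nil) C u).Valid := fun k C u h h' => by
    rw [valid_closedEnd, Multiset.card_replicate]
    omega
  have v1 : ∀ C u, 1 ≤ Multiset.card C → (closedEnd {Cycle.nil} C u).Valid := fun C u h =>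
    v 1 C u h le_rfl
  -- An empty boundary with a single closed input is unstable, so the boundary that is split off
  -- takes `d` along.
  refine ⟨closedEnd {Cycle.nil} {d}, closedEnd (Multiset.replicate m Cycle.nil) R,
    fun u v => glues_closedEnd (Multiset.replicate_succ _ _).symm rfl, fun u => v1 _ _ (by simp),
    fun u => v _ _ _ (by omega) (by omega), ?_⟩
  intro z hz
  have hB := hH.bounded
  obtain ⟨M, C, N, D, hM, hC, h⟩ := hH.closed_cut hz hb ih (by rwa [Multiset.card_replicate])
  rw [← hz] at ih
  have rep : ∀ M N, M + N = Multiset.replicate (m + 1) (Cycle.nil : Cycle ℕ) →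
      ∃ i j, i + j = m + 1 ∧ M = Multiset.replicate i Cycle.nil ∧
        N = Multiset.replicate j Cycle.nil := by
    intro M N h
    have hc := congrArg Multiset.card h
    rw [Multiset.card_add, Multiset.card_replicate] at hc
    refine ⟨_, _, hc, Multiset.eq_replicate_card.2 fun c hc => ?_,
      Multiset.eq_replicate_card.2 fun c hc => ?_⟩
    · exact Multiset.eq_of_mem_replicate (h ▸ Multiset.mem_add.2 (Or.inl hc))
    · exact Multiset.eq_of_mem_replicate (h ▸ Multiset.mem_add.2 (Or.inr hc))
  have pos : ∀ i j C D, i + 1 + j = m + 1 → C + D = R →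
      Cut z (closedEnd (Multiset.replicate (i + 1) Cycle.nil) (d ::ₘ C))
        (closedEnd (Multiset.replicate j Cycle.nil) D) →
      Cut z (closedEnd {Cycle.nil} {d}) (closedEnd (Multiset.replicate m Cycle.nil) R) := by
    intro i j C D hij hC h
    obtain rfl : i + j = m := by omega
    rw [Multiset.replicate_succ] at h
    by_cases h0 : i = 0 ∧ Multiset.card C = 0
    · rw [Multiset.card_eq_zero] at h0
      obtain ⟨rfl, rfl⟩ := h0
      rw [zero_add] at hC ⊢
      subst hC
      exact h
    · refine h.closed_closed hB ih {Cycle.nil} (Multiset.replicate i Cycle.nil) {d} C rfl rfl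
        (Multiset.replicate_add _ _ _).symm hC (fun u => v1 _ _ (by simp)) ?_
      rw [Multiset.card_replicate]
      omega
  have main : ∀ M N C D, M + N = Multiset.replicate (m + 1) (Cycle.nil : Cycle ℕ) → C + D = R →
      Cut z (closedEnd M (d ::ₘ C)) (closedEnd N D) →
      Cut z (closedEnd {Cycle.nil} {d}) (closedEnd (Multiset.replicate m Cycle.nil) R) := by
    intro M N C D hM hC h
    obtain ⟨i, j, hij, rfl, rfl⟩ := rep M N hM
    -- If the side of `d` has no boundary, the other side has all `m + 1` of them and hands one
    -- over. Its validity supplies a closed input besides the glued one, which keeps the remainder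
    -- valid.
    rcases i with _ | i
    · obtain rfl : j = m + 1 := by omega
      obtain ⟨_, hv⟩ := h.valid_right hB
      rw [valid_closedEnd, Multiset.card_replicate, numNonempty_replicate] at hv
      have h' := ((h.symm hB).closed_closed hB ih (N' := {Cycle.nil}) (D' := d ::ₘ C)
        (Multiset.replicate m Cycle.nil) {Cycle.nil}
        D 0 (by rw [Multiset.replicate_succ, add_comm]; rfl) (by simp) rfl (by simp)
        (fun u => v _ _ _ (by omega) (by omega)) (by simp)).symm hB
      exact pos 0 m C D (by omega) hC h'
    · exact pos i j C D (by omega) hC h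
  rcases add_eq_cons hC with ⟨A, rfl, h0⟩ | ⟨A, rfl, h0⟩
  · exact main _ _ _ _ hM h0 h
  · exact main _ _ _ _ ((add_comm _ _).trans hM) h0 (h.symm hB)

/-- The cases are the number of boundaries, their being empty or not, and the number of closed
inputs. Shapes too small for a standard cut are invalid or belong to a generator. -/
theorem standardCut_of_valid (hH : H.IsGenerated) {T : Shape} (hT : T.Valid) (hb : ¬ T.IsBase)
    (ih : H.UniqueBelow T.size) : H.StandardCut T := by
  obtain ⟨K, E⟩ := T
  obtain ⟨h2, h1, h0⟩ := hT
  dsimp only at h2 h1 h0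
  rcases Nat.lt_or_ge (Multiset.card K) 2 with hK | hK
  · rcases Nat.eq_zero_or_pos (Multiset.card K) with hK0 | hK0
    · have h0 := h0 hK0
      rw [Multiset.card_eq_zero] at hK0
      subst hK0
      refine standardCut_sphere hH hb ih ?_
      by_contra hlt
      obtain ⟨d, e, f, rfl⟩ := Multiset.card_eq_three.1 (show Multiset.card E = 3 by omega)
      exact hb (.omega d e f)
    · have h1 := h1 (by omega)
      obtain ⟨o, rfl⟩ := Multiset.card_eq_one.1 (show Multiset.card K = 1 by omega)
      obtain ⟨l, rfl⟩ : ∃ l : List ℕ, o = l := ⟨_, (Quotient.out_eq o).symm⟩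
      have hl : numLabels ({(l : Cycle ℕ)} : Multiset (Cycle ℕ)) = l.length := by
        rw [← Multiset.cons_zero, numLabels_cons, numLabels_zero, add_zero]
      rw [hl] at h1
      rcases Nat.lt_or_ge (Multiset.card E) 2 with hE | hE
      · rcases Nat.eq_zero_or_pos (Multiset.card E) with hE0 | hE0
        · rw [Multiset.card_eq_zero] at hE0
          subst hE0
          rw [Multiset.card_zero] at h1
          match l with
          | [] | [_] | [_, _] => simp at h1
          | [p, q, r] => exact (hb (.mu p q r)).elim
          | p :: q :: r :: s :: R => exact standardCut_openDisc hH hb ih (by simp)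
        · obtain ⟨d, rfl⟩ := Multiset.card_eq_one.1 (show Multiset.card E = 1 by omega)
          rw [Multiset.card_singleton] at h1
          match l with
          | [] => simp at h1
          | [p] => exact (hb (.phi p d)).elim
          | p :: q :: R => exact standardCut_disc_one hH hb ih (by simp)
      · rcases eq_or_ne l [] with rfl | hne
        · exact standardCut_emptyDisc hH hb ih hE
        · exact standardCut_disc hH hb ih hne hE
  · have h2 := h2 hK
    rcases Nat.eq_zero_or_pos (numNonempty K) with hk | hk
    · have hrep := eq_replicate_of_numNonempty hk
      rw [hrep] at hb ih ⊢
      exact standardCut_empty hH hb ih hK (by omega)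
    · obtain ⟨o, N, ho, rfl, hc⟩ := exists_cons_of_numNonempty hk
      rw [Multiset.card_cons] at hK
      exact standardCut_nonempty hH hb ih ho (by omega) (by omega)

/-- There is exactly one element of each valid shape. -/
theorem CyclicHybrid.IsGenerated.exists_unique (hH : H.IsGenerated) (n : ℕ) : H.UniqueBelow n := by
  induction n with
  | zero => exact fun S hS => absurd hS (Nat.not_lt_zero _)
  | succ n ih =>
    intro T hT hn hv
    have ih : H.UniqueBelow T.size := fun S hS => ih S (by omega)
    by_cases hb : T.IsBase
    · exact ⟨hH.inhabits T hb hn, hH.subsingle T hb⟩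
    obtain ⟨A, B, hg, hA, hB, hc⟩ := standardCut_of_valid hH hv hb ih
    refine ⟨inhabits_of_glues hn hg hA hB fun S hS hS' hS'' => (ih S hS hS' hS'').1, ?_⟩
    intro z z' hz hz'
    refine Cut.same hH.bounded (hz.trans hz'.symm) (hc z hz) (hc z' hz') ?_
    -- `Cut.same` asks for uniqueness in all smaller shapes, but a shape that carries an element is
    -- automatically valid and free of repetitions.
    intro S hS x y hx hy
    rw [hz] at hS
    exact (ih S hS (hx ▸ x.nodup) (hx ▸ x.valid hH.bounded)).2 x y hx hy

/-! ## The presented hybrid -/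

theorem IsOpenPants.rotate {a : Biarity} {p q r : a.Open} (h : IsOpenPants a p q r) :
    IsOpenPants a q r p := by
  refine ⟨h.1.trans ?_, h.2⟩
  rw [Multiset.singleton_inj]
  exact Cycle.coe_eq_coe.2 ⟨1, rfl⟩

theorem IsClosedPants.rotate {a : Biarity} {d e f : a.Closed} (h : IsClosedPants a d e f) :
    IsClosedPants a e f d := by
  obtain ⟨h1, h2, h3, h4⟩ := h
  refine ⟨h1, ?_, fun x => ?_, h4⟩
  · simp only [List.nodup_cons, List.mem_cons, List.not_mem_nil] at h2 ⊢
    grind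
  · have := h3 x
    simp only [List.mem_cons] at this ⊢
    tauto

theorem IsClosedPants.swap {a : Biarity} {d e f : a.Closed} (h : IsClosedPants a d e f) :
    IsClosedPants a e d f := by
  obtain ⟨h1, h2, h3, h4⟩ := h
  refine ⟨h1, ?_, fun x => ?_, h4⟩
  · simp only [List.nodup_cons, List.mem_cons, List.not_mem_nil] at h2 ⊢
    grind
  · have := h3 x
    simp only [List.mem_cons] at this ⊢
    tauto

/-! ### Generators recognized by their shapes -/

section Shapes

variable {a : Biarity} {ℓ : a.Leg → ℕ}

theorem IsOpenPants.shape {p q r : a.Open} (h : IsOpenPants a p q r) :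
    a.shape ℓ = ⟨{(([ℓ (Sum.inl p), ℓ (Sum.inl q), ℓ (Sum.inl r)] : List ℕ) : Cycle ℕ)}, 0⟩ := by
  have := h.2.1
  refine Shape.ext ?_ ?_
  · rw [Biarity.shape, h.1]
    rfl
  · simp [Biarity.shape]

theorem IsClosedPants.shape {d e f : a.Closed} (h : IsClosedPants a d e f) :
    a.shape ℓ = ⟨0, ℓ (Sum.inr d) ::ₘ ℓ (Sum.inr e) ::ₘ {ℓ (Sum.inr f)}⟩ := by
  refine Shape.ext ?_ ?_
  · rw [Biarity.shape, h.1]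
    rfl
  · have : (Finset.univ : Finset a.Closed).val = (([d, e, f] : List a.Closed) : Multiset a.Closed) :=
      (Multiset.Nodup.ext Finset.univ.nodup (Multiset.coe_nodup.2 h.2.1)).2
        fun x => by simpa using h.2.2.1 x
    rw [Biarity.shape, this]
    rfl

theorem IsMorphism.shape {p : a.Open} {d : a.Closed} (h : IsMorphism a p d) :
    a.shape ℓ = ⟨{(([ℓ (Sum.inl p)] : List ℕ) : Cycle ℕ)}, {ℓ (Sum.inr d)}⟩ := by
  refine Shape.ext ?_ ?_
  · rw [Biarity.shape, h.1]
    rfl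
  · have : (Finset.univ : Finset a.Closed).val = {d} :=
      (Multiset.Nodup.ext Finset.univ.nodup (Multiset.nodup_singleton d)).2
        fun x => by simpa using h.2.1 x
    rw [Biarity.shape, this]
    rfl

theorem Generator.HasBiarity.isBase {g : Generator} (h : g.HasBiarity a) : (a.shape ℓ).IsBase := by
  cases g with
  | mu =>
    obtain ⟨p, q, r, h⟩ := h
    rw [h.shape]
    exact .mu _ _ _
  | omega =>
    obtain ⟨d, e, f, h⟩ := h
    rw [h.shape]
    exact .omega _ _ _
  | phi =>
    obtain ⟨p, d, h⟩ := h
    rw [h.shape]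
    exact .phi _ _

theorem Shape.IsBase.valid {T : Shape} (h : T.IsBase) : T.Valid := by
  cases h with
  | mu p q r =>
    have : numLabels ({(([p, q, r] : List ℕ) : Cycle ℕ)} : Multiset (Cycle ℕ)) = 3 := by
      rw [← Multiset.cons_zero, numLabels_cons, numLabels_zero]; rfl
    simp [Shape.Valid, this]
  | omega d e f => simp [Shape.Valid]
  | phi p d =>
    have : numLabels ({(([p] : List ℕ) : Cycle ℕ)} : Multiset (Cycle ℕ)) = 1 := by
      rw [← Multiset.cons_zero, numLabels_cons, numLabels_zero]; rfl
    simp [Shape.Valid, this]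

theorem Generator.HasBiarity.mem_kaufmannPennerSet {g : Generator} (h : g.HasBiarity a) :
    0 ∈ kaufmannPennerSet a := by
  obtain ⟨ℓ, -⟩ := a.exists_labelling
  refine (a.mem_kaufmannPennerSet_iff ℓ).2 ⟨(h.isBase (ℓ := ℓ)).valid, ?_⟩
  cases g with
  | mu =>
    obtain ⟨p, q, r, h⟩ := h
    rw [h.shape, h.2.2]
    simp
  | omega =>
    obtain ⟨d, e, f, h⟩ := h
    rw [h.shape, h.2.2.2]
    simp
    norm_num
  | phi =>
    obtain ⟨p, d, h⟩ := h
    rw [h.shape, h.2.2]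
    simp

theorem Generator.HasBiarity.unique {g g' : Generator} (h : g.HasBiarity a)
    (h' : g'.HasBiarity a) : g = g' := by
  obtain ⟨ℓ, -⟩ := a.exists_labelling
  cases g <;> cases g' <;> first
  | rfl
  | exfalso
    simp only [Generator.HasBiarity] at h h'
    casesm* ∃ _, _
    have h1 := ‹IsOpenPants _ _ _ _›.shape (ℓ := ℓ)
    first
    | rw [‹IsClosedPants _ _ _ _›.shape] at h1
      simp at h1
    | rw [‹IsMorphism _ _ _›.shape] at h1
      simp at h1
  | exfalso
    simp only [Generator.HasBiarity] at h h'
    casesm* ∃ _, _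
    have h1 := ‹IsClosedPants _ _ _ _›.shape (ℓ := ℓ)
    rw [‹IsMorphism _ _ _›.shape] at h1
    simp at h1

theorem exists_coe_of_map_eq {A : Type} {f : A → ℕ} {c : Cycle A} {l : List ℕ}
    (h : Cycle.map f c = l) : ∃ l' : List A, c = l' ∧ l'.map f = l := by
  obtain ⟨k, rfl⟩ : ∃ k : List A, c = k := ⟨_, (Quotient.out_eq c).symm⟩
  obtain ⟨n, hn⟩ := Cycle.coe_eq_coe.1 ((Cycle.map_coe f k).symm.trans h)
  rw [← List.map_rotate] at hn
  exact ⟨k.rotate n, Cycle.coe_eq_coe.2 ⟨n, rfl⟩, hn⟩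

theorem exists_isOpenPants {p q r : ℕ}
    (h : a.shape ℓ = ⟨{(([p, q, r] : List ℕ) : Cycle ℕ)}, 0⟩) (hg : a.genus = 0) :
    ∃ p' q' r', IsOpenPants a p' q' r' ∧ ℓ (Sum.inl p') = p ∧ ℓ (Sum.inl q') = q ∧
      ℓ (Sum.inl r') = r := by
  obtain ⟨c, hc, hc'⟩ := Multiset.map_eq_singleton.1 (congrArg Shape.cycles h)
  obtain ⟨l, rfl, hl⟩ := exists_coe_of_map_eq hc'
  match l, hl with
  | [p', q', r'], hl =>
    simp only [List.map_cons, List.map_nil, List.cons.injEq, and_true] at hl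
    refine ⟨p', q', r', ⟨hc, ⟨fun x => ?_⟩, hg⟩, hl⟩
    have := (a.mem_closedLabels ℓ _).2 ⟨x, rfl⟩
    rw [h] at this
    simp at this

theorem exists_isMorphism (hℓ : Function.Injective ℓ) {p d : ℕ}
    (h : a.shape ℓ = ⟨{(([p] : List ℕ) : Cycle ℕ)}, {d}⟩) (hg : a.genus = 1 / 2) :
    ∃ p' d', IsMorphism a p' d' ∧ ℓ (Sum.inl p') = p ∧ ℓ (Sum.inr d') = d := by
  obtain ⟨c, hc, hc'⟩ := Multiset.map_eq_singleton.1 (congrArg Shape.cycles h)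
  obtain ⟨l, rfl, hl⟩ := exists_coe_of_map_eq hc'
  obtain ⟨d', hd'⟩ := (a.mem_closedLabels ℓ d).1 (by rw [h]; simp)
  match l, hl with
  | [p'], hl =>
    simp only [List.map_cons, List.map_nil, List.cons.injEq, and_true] at hl
    refine ⟨p', d', ⟨hc, fun x => ?_, hg⟩, hl, hd'⟩
    have := (a.mem_closedLabels ℓ _).2 ⟨x, rfl⟩
    rw [h, Multiset.mem_singleton, ← hd'] at this
    exact Sum.inr_injective (hℓ this)

theorem exists_isClosedPants (hℓ : Function.Injective ℓ) {d e f : ℕ}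
    (h : a.shape ℓ = ⟨0, d ::ₘ e ::ₘ {f}⟩) (hg : a.genus = 1 / 2) :
    ∃ d' e' f', IsClosedPants a d' e' f' ∧ ℓ (Sum.inr d') = d ∧ ℓ (Sum.inr e') = e ∧
      ℓ (Sum.inr f') = f := by
  have hn := (Multiset.nodup_add.1 (a.nodup_labels hℓ)).2.1
  obtain ⟨d', rfl⟩ := (a.mem_closedLabels ℓ d).1 (by rw [h]; simp)
  obtain ⟨e', rfl⟩ := (a.mem_closedLabels ℓ e).1 (by rw [h]; simp)
  obtain ⟨f', rfl⟩ := (a.mem_closedLabels ℓ f).1 (by rw [h]; simp)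
  refine ⟨d', e', f', ⟨Multiset.map_eq_zero.1 (congrArg Shape.cycles h), ?_, fun x => ?_, hg⟩,
    rfl, rfl, rfl⟩
  · rw [h] at hn
    have hn : (([d', e', f'].map fun x => ℓ (Sum.inr x) : List ℕ) : Multiset ℕ).Nodup := hn
    exact List.Nodup.of_map _ (Multiset.coe_nodup.1 hn)
  · have := (a.mem_closedLabels ℓ _).2 ⟨x, rfl⟩
    rw [h] at this
    simp only [Multiset.mem_cons, Multiset.mem_singleton, hℓ.eq_iff, Sum.inr.injEq] at this
    simpa using this

end Shapes

/-- The class of a generator in the presented hybrid. -/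
def generatorClass {a : Biarity} (e : generators.obj a) : presentedHybrid.obj a :=
  Quotient.mk (relationIdeal.setoid a) ((freeGen generators).app a e)

theorem map_generatorClass {a b : Biarity} (f : Biarity.Iso a b) (e : generators.obj a) :
    presentedHybrid.map f (generatorClass e) = generatorClass (generators.map f e) :=
  congrArg (Quotient.mk (relationIdeal.setoid b)) ((freeGen generators).map_app f e).symm

theorem Gluing.exists_relabelled {a b r r' : Biarity} (w : Gluing a b r) (f : Biarity.Iso r r') :
    ∃ w' : Gluing a b r', Gluing.Relabelled (Biarity.Iso.refl a) (Biarity.Iso.refl b) f w w' := by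
  have hid : ∀ c : Biarity, (Biarity.Iso.refl c).leg = id := fun c => by
    funext x
    rcases x with x | x <;> rfl
  obtain ⟨w', h1, h2, h3⟩ := w.exists_mapResult f
  exact ⟨w', by rw [hid, h1]; rfl, by rw [hid, h2]; rfl, fun x => by
    rw [hid, hid, h3, Sum.map_id_id]; rfl⟩

/-- An isomorphism applied to a composite is absorbed into the identification of the inputs of the
result, and one applied to a generator gives a generator. No outer isomorphism remains. -/
theorem presentedHybrid_cases {a : Biarity} (x : presentedHybrid.obj a) :
    (∃ e, x = generatorClass e) ∨
    ∃ (b c : Biarity) (w : Gluing b c a) (y : presentedHybrid.obj b) (z : presentedHybrid.obj c),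
      x = presentedHybrid.comp w y z := by
  induction x using Quotient.inductionOn with
  | h x =>
    induction x using Quotient.inductionOn with
    | h x =>
      induction x with
      | gen e => exact Or.inl ⟨e, rfl⟩
      | map f x ih =>
        rcases ih with ⟨e, he⟩ | ⟨b, c, w, y, z, he⟩
        · refine Or.inl ⟨generators.map f e, ?_⟩
          rw [← map_generatorClass, ← he]
          rfl
        · obtain ⟨w', hw'⟩ := w.exists_relabelled f
          refine Or.inr ⟨b, c, w', y, z, ?_⟩
          have := presentedHybrid.equivariant _ _ _ _ _ hw' y z
          rw [← he, presentedHybrid.map_refl, presentedHybrid.map_refl] at this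
          exact this
      | comp w x y _ _ =>
        exact Or.inr ⟨_, _, w, Quotient.mk _ (Quotient.mk _ x), Quotient.mk _ (Quotient.mk _ y), rfl⟩

/-- Induction over formal expressions: the Kaufmann-Penner components contain those of the
generators and are closed under isomorphisms and gluings. The relations play no role. -/
theorem presentedHybrid_bounded : presentedHybrid.Bounded := by
  intro a x
  induction x using Quotient.inductionOn with
  | h x =>
    induction x using Quotient.inductionOn with
    | h x =>
      induction x with
      | gen e => exact e.2.mem_kaufmannPennerSet
      | map f x ih => exact kaufmannPennerSet_map f ih
      | comp w x y ih ih' => exact kaufmannPennerSet_comp w ih ih'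

/-- A composite cannot lie in the biarity of a generator. For μ and φ, of size 5, the two pieces
would have total size 9, although each has size at least 5. For ω, of size 6, this count is not
enough; but two spheres with at least three closed inputs each glue to one with at least four. -/
theorem eq_generatorClass (z : LabelledElement presentedHybrid) (g : Generator)
    (hg : g.HasBiarity z.bi) : z.el = generatorClass ⟨g, hg⟩ := by
  have hB := presentedHybrid_bounded
  have hb : z.shape.IsBase := hg.isBase
  rcases presentedHybrid_cases z.el with ⟨⟨g', hg'⟩, he⟩ | ⟨b, c, w, x, y, he⟩
  · obtain rfl := hg.unique hg'
    exact he
  · exfalso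
    have disc : ∀ o E, z.shape = ⟨{o}, E⟩ → z.shape.size = 5 → False := by
      intro o E hz h5
      have key : ∀ A B : ℕ → Shape, Cut z A B → False := by
        intro A B h
        obtain ⟨u, v, huv⟩ := exists_fresh _ z.nodup
        obtain ⟨x, y, -, -, hc⟩ := h u v huv
        have := hc.glues.size
        have := (x.valid hB).five_le_size
        have := (y.valid hB).five_le_size
        omega
      rcases exists_cut z w he with ⟨s, M, C, t, N, D, h⟩ | ⟨M, C, N, D, h⟩
      · exact key _ _ h
      · exact key _ _ h
    generalize hT : z.shape = T at hb
    cases hb with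
    | mu p q r =>
      refine disc _ _ hT ?_
      rw [hT, Shape.size, ← Multiset.cons_zero, numLabels_cons, numLabels_zero]
      simp
    | phi p d =>
      refine disc _ _ hT ?_
      rw [hT, Shape.size, ← Multiset.cons_zero (Cycle.ofList _), numLabels_cons, numLabels_zero]
      simp
    | omega d e f =>
      rcases exists_cut z w he with ⟨s, M, C, t, N, D, h⟩ | ⟨M, C, N, D, h⟩
      · have := hT.symm.trans (h.shape_eq fun u v => glues_openEnd rfl rfl rfl)
        simp at this
      · have := hT.symm.trans (h.shape_eq fun u v => glues_closedEnd rfl rfl)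
        simp only [Shape.mk.injEq] at this
        obtain ⟨rfl, rfl⟩ := add_eq_zero_multiset this.1.symm
        have hc := congrArg Multiset.card this.2
        obtain ⟨_, hv⟩ := h.valid_left hB
        obtain ⟨_, hv'⟩ := h.valid_right hB
        have hv := (valid_closedEnd.1 hv).2 rfl
        have hv' := (valid_closedEnd.1 hv').2 rfl
        simp only [Multiset.card_cons, Multiset.card_add, Multiset.card_singleton] at hc
        omega

theorem genus_eq_of_shape (z : LabelledElement presentedHybrid) {T : Shape} (hT : z.shape = T) :
    z.bi.genus = Multiset.card T.cycles - 1 + (Multiset.card T.closed : ℚ) / 2 := by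
  rw [((z.bi.mem_kaufmannPennerSet_iff z.lab).1 (presentedHybrid_bounded _ z.el)).2, ← hT]
  rfl

theorem Shape.IsBase.exists_generator {T : Shape} (hb : T.IsBase) :
    ∃ (n : ℕ) (g : Generator),
      (Multiset.card T.cycles - 1 + (Multiset.card T.closed : ℚ) / 2 = n / 2) ∧
      ∀ (a : Biarity) (ℓ : a.Leg → ℕ), Function.Injective ℓ → a.shape ℓ = T → a.genus = n / 2 →
        g.HasBiarity a := by
  cases hb with
  | mu p q r =>
    refine ⟨0, .mu, by simp, fun a ℓ hℓ hT hg => ?_⟩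
    obtain ⟨p', q', r', h, -⟩ := exists_isOpenPants hT (by simpa using hg)
    exact ⟨p', q', r', h⟩
  | omega d e f =>
    refine ⟨1, .omega, by simp; norm_num, fun a ℓ hℓ hT hg => ?_⟩
    obtain ⟨d', e', f', h, -⟩ := exists_isClosedPants hℓ hT (by simpa using hg)
    exact ⟨d', e', f', h⟩
  | phi p d =>
    refine ⟨1, .phi, by simp, fun a ℓ hℓ hT hg => ?_⟩
    obtain ⟨p', d', h, -⟩ := exists_isMorphism hℓ hT (by simpa using hg)
    exact ⟨p', d', h⟩

theorem presentedHybrid_inhabits {T : Shape} (hb : T.IsBase) (hn : T.labels.Nodup) :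
    presentedHybrid.Inhabits T := by
  obtain ⟨n, g, -, h⟩ := hb.exists_generator
  obtain ⟨a, ℓ, hℓ, hT, hg⟩ := T.exists_biarity hn n
  exact ⟨⟨a, ℓ, hℓ, generatorClass ⟨g, h a ℓ hℓ hT hg⟩⟩, hT⟩

theorem presentedHybrid_subsingle {T : Shape} (hb : T.IsBase) : presentedHybrid.Subsingle T := by
  intro z z' hz hz'
  obtain ⟨n, g, hn, h⟩ := hb.exists_generator
  have hg := h z.bi z.lab z.inj hz ((genus_eq_of_shape z hz).trans hn)
  obtain ⟨f, hf⟩ := exists_iso presentedHybrid_bounded (hz.trans hz'.symm)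
  refine ⟨f, hf, ?_⟩
  rw [eq_generatorClass z g hg, eq_generatorClass z' g (hg.map f)]
  exact map_generatorClass f _

/-! ### Labels determine the maps of a gluing -/

section Maps

variable {a b r : Biarity} {w : Gluing a b r} {ℓ : a.Leg → ℕ} {m : b.Leg → ℕ} {k : r.Leg → ℕ}

theorem Gluing.IsLabelled.openMap_inl (hw : w.IsLabelled ℓ m k) (hd : DisjointLabels ℓ m)
    {p : r.Open} {i : a.Open} (h : k (Sum.inl p) = ℓ (Sum.inl i)) : w.openMap p = Sum.inl i := by
  have := @hd (w.leg (Sum.inl p)) (Sum.inl (Sum.inl i)) ((hw _).trans h)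
  rw [w.leg_inl] at this
  rcases hp : w.openMap p with j | j
  · simpa [hp] using this
  · simp [hp] at this

theorem Gluing.IsLabelled.openMap_inr (hw : w.IsLabelled ℓ m k) (hd : DisjointLabels ℓ m)
    {p : r.Open} {i : b.Open} (h : k (Sum.inl p) = m (Sum.inl i)) : w.openMap p = Sum.inr i := by
  have := @hd (w.leg (Sum.inl p)) (Sum.inr (Sum.inl i)) ((hw _).trans h)
  rw [w.leg_inl] at this
  rcases hp : w.openMap p with j | j
  · simp [hp] at this
  · simpa [hp] using this

theorem Gluing.IsLabelled.closedMap_inl (hw : w.IsLabelled ℓ m k) (hd : DisjointLabels ℓ m)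
    {p : r.Closed} {i : a.Closed} (h : k (Sum.inr p) = ℓ (Sum.inr i)) :
    w.closedMap p = Sum.inl i := by
  have := @hd (w.leg (Sum.inr p)) (Sum.inl (Sum.inr i)) ((hw _).trans h)
  rw [w.leg_inr] at this
  rcases hp : w.closedMap p with j | j
  · simpa [hp] using this
  · simp [hp] at this

theorem Gluing.IsLabelled.closedMap_inr (hw : w.IsLabelled ℓ m k) (hd : DisjointLabels ℓ m)
    {p : r.Closed} {i : b.Closed} (h : k (Sum.inr p) = m (Sum.inr i)) :
    w.closedMap p = Sum.inr i := by
  have := @hd (w.leg (Sum.inr p)) (Sum.inr (Sum.inr i)) ((hw _).trans h)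
  rw [w.leg_inr] at this
  rcases hp : w.closedMap p with j | j
  · simp [hp] at this
  · simpa [hp] using this

end Maps

/-- An automorphism that preserves an injective labelling is the identity, so on a fixed labelled
biarity `Same` is equality. -/
theorem LabelledElement.el_eq_of_same {H : CyclicHybrid} {a : Biarity} {ℓ : a.Leg → ℕ}
    (hℓ : Function.Injective ℓ) {x y : H.obj a}
    (h : Same (H := H) ⟨a, ℓ, hℓ, x⟩ ⟨a, ℓ, hℓ, y⟩) : x = y := by
  obtain ⟨⟨f, g, h1, h2⟩, hf, e⟩ := h
  obtain rfl : f = Equiv.refl _ := Equiv.ext fun i => Sum.inl_injective (hℓ (hf (Sum.inl i)))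
  obtain rfl : g = Equiv.refl _ := Equiv.ext fun i => Sum.inr_injective (hℓ (hf (Sum.inr i)))
  exact (H.map_refl x).symm.trans e

/-! ### The four relations as moves of cuts -/

theorem presentedHybrid_sound {a : Biarity} {x y : (freeHybrid generators).obj a}
    (h : Relation a x y) : Quotient.mk (relationIdeal.setoid a) x = Quotient.mk _ y :=
  Quotient.sound (Generated.rel h)

theorem exists_mu (z : LabelledElement presentedHybrid) {p q r : ℕ}
    (h : z.shape = ⟨{(([p, q, r] : List ℕ) : Cycle ℕ)}, 0⟩) :
    ∃ p' q' r', IsOpenPants z.bi p' q' r' ∧ z.lab (Sum.inl p') = p ∧ z.lab (Sum.inl q') = q ∧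
      z.lab (Sum.inl r') = r :=
  exists_isOpenPants h (by simp [genus_eq_of_shape z h])

theorem exists_phi (z : LabelledElement presentedHybrid) {p d : ℕ}
    (h : z.shape = ⟨{(([p] : List ℕ) : Cycle ℕ)}, {d}⟩) :
    ∃ p' d', IsMorphism z.bi p' d' ∧ z.lab (Sum.inl p') = p ∧ z.lab (Sum.inr d') = d :=
  exists_isMorphism z.inj h (by simp [genus_eq_of_shape z h])

theorem exists_omega (z : LabelledElement presentedHybrid) {d e f : ℕ}
    (h : z.shape = ⟨0, d ::ₘ e ::ₘ {f}⟩) :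
    ∃ d' e' f', IsClosedPants z.bi d' e' f' ∧ z.lab (Sum.inr d') = d ∧ z.lab (Sum.inr e') = e ∧
      z.lab (Sum.inr f') = f :=
  exists_isClosedPants z.inj h (by rw [genus_eq_of_shape z h]; simp; norm_num)

theorem eq_mu (z : LabelledElement presentedHybrid) {p q r : z.bi.Open}
    (h : IsOpenPants z.bi p q r) : z.el = Quotient.mk _ (mu p q r h) :=
  eq_generatorClass z .mu ⟨p, q, r, h⟩

theorem eq_phi (z : LabelledElement presentedHybrid) {p : z.bi.Open} {d : z.bi.Closed}
    (h : IsMorphism z.bi p d) : z.el = Quotient.mk _ (phi p d h) :=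
  eq_generatorClass z .phi ⟨p, d, h⟩

theorem eq_omega (z : LabelledElement presentedHybrid) {d e f : z.bi.Closed}
    (h : IsClosedPants z.bi d e f) : z.el = Quotient.mk _ (omega d e f h) :=
  eq_generatorClass z .omega ⟨d, e, f, h⟩

/-- A decomposition into generators, with prescribed labels of the glued inputs. -/
theorem exists_pieces {z : LabelledElement presentedHybrid} {A B : Shape} {u v : ℕ}
    (hg : Glues u v A B z.shape) (hA : A.IsBase) (hB : B.IsBase)
    (huv : (u ::ₘ v ::ₘ z.shape.labels).Nodup) :
    ∃ (x y : LabelledElement presentedHybrid) (w : Gluing x.bi y.bi z.bi),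
      x.shape = A ∧ y.shape = B ∧ DisjointLabels x.lab y.lab ∧ x.lab w.left = u ∧
      y.lab w.right = v ∧ w.IsLabelled x.lab y.lab z.lab := by
  rw [← hg.labels] at huv
  have hn := Multiset.nodup_add.1 huv
  obtain ⟨x, rfl⟩ := presentedHybrid_inhabits hA hn.1
  obtain ⟨y, rfl⟩ := presentedHybrid_inhabits hB hn.2.1
  obtain ⟨w, hw⟩ := exists_gluing presentedHybrid_bounded huv hg
  exact ⟨x, y, w, rfl, rfl, disjointLabels huv, hw⟩

theorem LabelledElement.exists_open (z : LabelledElement presentedHybrid) {n : ℕ}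
    (h : n ∈ z.shape.cycles.bind Cycle.toMultiset) : ∃ p, z.lab (Sum.inl p) = n :=
  (z.bi.mem_openLabels z.lab n).1 h

theorem LabelledElement.exists_closed (z : LabelledElement presentedHybrid) {n : ℕ}
    (h : n ∈ z.shape.closed) : ∃ p, z.lab (Sum.inr p) = n :=
  (z.bi.mem_closedLabels z.lab n).1 h

/-- All four pieces have base shape and hence are generators, so no induction is needed. Rotations
bring the glued inputs into the places prescribed by the defining relation. -/
theorem presentedHybrid_open_assoc (z : LabelledElement presentedHybrid) (p q t u : ℕ)
    (h : Cut z (openEnd [p, q] 0 0) (openEnd [t, u] 0 0)) :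
    Cut z (openEnd [u, p] 0 0) (openEnd [q, t] 0 0) := by
  intro r s hrs
  have hz := h.shape_eq fun u v => glues_openEnd rfl rfl rfl
  obtain ⟨x, y, hx, hy, hc⟩ := h r s hrs
  have hd := disjointLabels (hc.glues.labels ▸ hrs)
  obtain ⟨w, hl, hr, hw, e⟩ := hc
  obtain ⟨x', y', w', hx', hy', hd', hl', hr', hw'⟩ := exists_pieces (z := z) (u := r) (v := s)
    (A := openEnd [u, p] 0 0 r) (B := openEnd [q, t] 0 0 s)
    (hz ▸ glues_openEnd (Cycle.coe_eq_coe.2 ⟨1, rfl⟩) rfl rfl) (.mu _ _ _) (.mu _ _ _) hrs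
  refine ⟨x', y', hx', hy', w', hl', hr', hw', ?_⟩
  obtain ⟨r₁, p₁, q₁, ha, er₁, ep₁, eq₁⟩ := exists_mu x hx
  obtain ⟨s₁, t₁, u₁, hb, es₁, et₁, eu₁⟩ := exists_mu y hy
  obtain ⟨r₂, u₂, p₂, ha', er₂, eu₂, ep₂⟩ := exists_mu x' hx'
  obtain ⟨s₂, q₂, t₂, hb', es₂, eq₂, et₂⟩ := exists_mu y' hy'
  obtain ⟨p₀, ep₀⟩ := z.exists_open (n := p) (by rw [hz]; simp)
  obtain ⟨q₀, eq₀⟩ := z.exists_open (n := q) (by rw [hz]; simp)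
  obtain ⟨t₀, et₀⟩ := z.exists_open (n := t) (by rw [hz]; simp)
  obtain ⟨u₀, eu₀⟩ := z.exists_open (n := u) (by rw [hz]; simp)
  rw [e, eq_mu x ha.rotate, eq_mu y hb, eq_mu x' ha'.rotate.rotate, eq_mu y' hb'.rotate]
  exact presentedHybrid_sound (.open_assoc w w' (p := p₀) (q := q₀) (t := t₀) (u := u₀) _ _ _ _
    ⟨x.inj (hl.trans er₁.symm), y.inj (hr.trans es₁.symm)⟩
    (hw.openMap_inl hd (ep₀.trans ep₁.symm)) (hw.openMap_inl hd (eq₀.trans eq₁.symm))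
    (hw.openMap_inr hd (et₀.trans et₁.symm)) (hw.openMap_inr hd (eu₀.trans eu₁.symm))
    ⟨x'.inj (hl'.trans er₂.symm), y'.inj (hr'.trans es₂.symm)⟩
    (hw'.openMap_inl hd' (ep₀.trans ep₂.symm)) (hw'.openMap_inr hd' (eq₀.trans eq₂.symm))
    (hw'.openMap_inr hd' (et₀.trans et₂.symm)) (hw'.openMap_inl hd' (eu₀.trans eu₂.symm)))

theorem presentedHybrid_closed_assoc (z : LabelledElement presentedHybrid) (d e h i : ℕ)
    (hz : Cut z (closedEnd 0 (d ::ₘ {e})) (closedEnd 0 (h ::ₘ {i}))) :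
    Cut z (closedEnd 0 (d ::ₘ {i})) (closedEnd 0 (e ::ₘ {h})) := by
  intro f g hfg
  obtain ⟨x, y, hx, hy, hc⟩ := hz f g hfg
  have hz := hz.shape_eq fun u v => glues_closedEnd rfl rfl
  have hd := disjointLabels (hc.glues.labels ▸ hfg)
  obtain ⟨w, hl, hr, hw, eq⟩ := hc
  obtain ⟨x', y', w', hx', hy', hd', hl', hr', hw'⟩ := exists_pieces (z := z) (u := f) (v := g)
    (A := closedEnd 0 (d ::ₘ {i}) f) (B := closedEnd 0 (e ::ₘ {h}) g)
    (hz ▸ glues_closedEnd rfl (by simp only [← Multiset.singleton_add]; abel))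
    (.omega _ _ _) (.omega _ _ _) hfg
  refine ⟨x', y', hx', hy', w', hl', hr', hw', ?_⟩
  obtain ⟨f₁, d₁, e₁, ha, ef₁, ed₁, ee₁⟩ := exists_omega x hx
  obtain ⟨g₁, h₁, i₁, hb, eg₁, eh₁, ei₁⟩ := exists_omega y hy
  obtain ⟨f₂, d₂, i₂, ha', ef₂, ed₂, ei₂⟩ := exists_omega x' hx'
  obtain ⟨g₂, e₂, h₂, hb', eg₂, ee₂, eh₂⟩ := exists_omega y' hy'
  obtain ⟨d₀, ed₀⟩ := z.exists_closed (n := d) (by rw [hz]; simp)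
  obtain ⟨e₀, ee₀⟩ := z.exists_closed (n := e) (by rw [hz]; simp)
  obtain ⟨h₀, eh₀⟩ := z.exists_closed (n := h) (by rw [hz]; simp)
  obtain ⟨i₀, ei₀⟩ := z.exists_closed (n := i) (by rw [hz]; simp)
  rw [eq, eq_omega x ha.rotate, eq_omega y hb, eq_omega x' ha'.swap, eq_omega y' hb'.rotate]
  exact presentedHybrid_sound (.closed_assoc w w' (d := d₀) (e := e₀) (h := h₀) (i := i₀) _ _ _ _
    ⟨x.inj (hl.trans ef₁.symm), y.inj (hr.trans eg₁.symm)⟩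
    (hw.closedMap_inl hd (ed₀.trans ed₁.symm)) (hw.closedMap_inl hd (ee₀.trans ee₁.symm))
    (hw.closedMap_inr hd (eh₀.trans eh₁.symm)) (hw.closedMap_inr hd (ei₀.trans ei₁.symm))
    ⟨x'.inj (hl'.trans ef₂.symm), y'.inj (hr'.trans eg₂.symm)⟩
    (hw'.closedMap_inl hd' (ed₀.trans ed₂.symm)) (hw'.closedMap_inr hd' (ee₀.trans ee₂.symm))
    (hw'.closedMap_inr hd' (eh₀.trans eh₂.symm)) (hw'.closedMap_inl hd' (ei₀.trans ei₂.symm)))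

theorem presentedHybrid_centrality (z : LabelledElement presentedHybrid) (p r d : ℕ)
    (h : Cut z (openEnd [] 0 {d}) (openEnd [p, r] 0 0)) :
    Cut z (openEnd [] 0 {d}) (openEnd [r, p] 0 0) := by
  have hB := presentedHybrid_bounded
  have h := h.symm hB
  refine Cut.symm hB fun q s hqs => ?_
  have hz := h.shape_eq fun u v => glues_openEnd rfl rfl rfl
  obtain ⟨x, y, hx, hy, hc⟩ := h q s hqs
  have hd := disjointLabels (hc.glues.labels ▸ hqs)
  obtain ⟨w, hl, hr, hw, e⟩ := hc
  obtain ⟨x', y', w', hx', hy', hd', hl', hr', hw'⟩ := exists_pieces (z := z) (u := q) (v := s)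
    (A := openEnd [r, p] 0 0 q) (B := openEnd [] 0 {d} s)
    (hz ▸ glues_openEnd (Cycle.coe_eq_coe.2 ⟨1, rfl⟩) rfl rfl) (.mu _ _ _) (.phi _ _) hqs
  refine ⟨x', y', hx', hy', w', hl', hr', hw', ?_⟩
  obtain ⟨q₁, p₁, r₁, ha, eq₁, ep₁, er₁⟩ := exists_mu x hx
  obtain ⟨s₁, d₁, hb, es₁, ed₁⟩ := exists_phi y hy
  obtain ⟨q₂, r₂, p₂, ha', eq₂, er₂, ep₂⟩ := exists_mu x' hx'
  obtain ⟨s₂, d₂, hb', es₂, ed₂⟩ := exists_phi y' hy'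
  obtain ⟨p₀, ep₀⟩ := z.exists_open (n := p) (by rw [hz]; simp)
  obtain ⟨r₀, er₀⟩ := z.exists_open (n := r) (by rw [hz]; simp)
  obtain ⟨d₀, ed₀⟩ := z.exists_closed (n := d) (by rw [hz]; simp)
  rw [e, eq_mu x ha.rotate.rotate, eq_phi y hb, eq_mu x' ha'.rotate, eq_phi y' hb']
  -- The cycle (q, p, r) equals (r, q, p), so the relation applies with the roles of `p` and `r`
  -- exchanged.
  exact presentedHybrid_sound (.centrality w w' (p := r₀) (r := p₀) (d := d₀) _ _ _ _
    ⟨x.inj (hl.trans eq₁.symm), y.inj (hr.trans es₁.symm)⟩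
    (hw.openMap_inl hd (er₀.trans er₁.symm)) (hw.openMap_inl hd (ep₀.trans ep₁.symm))
    (hw.closedMap_inr hd (ed₀.trans ed₁.symm))
    ⟨x'.inj (hl'.trans eq₂.symm), y'.inj (hr'.trans es₂.symm)⟩
    (hw'.openMap_inl hd' (er₀.trans er₂.symm)) (hw'.openMap_inl hd' (ep₀.trans ep₂.symm))
    (hw'.closedMap_inr hd' (ed₀.trans ed₂.symm)))

/-- The relation contains a threefold composite, whereas the given cut has two pieces. Its left
piece, the disc with cycle (r, p) and closed input `d`, has to be recognized as μ glued to φ; this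
is the one relation that needs uniqueness of smaller elements. -/
theorem presentedHybrid_morphism (z : LabelledElement presentedHybrid) (p d e : ℕ)
    (ih : presentedHybrid.UniqueBelow z.shape.size)
    (h : Cut z (openEnd [p] 0 {d}) (openEnd [] 0 {e})) :
    Cut z (closedEnd {(([p] : List ℕ) : Cycle ℕ)} 0) (closedEnd 0 (d ::ₘ {e})) := by
  intro g f hgf
  have hB := presentedHybrid_bounded
  have hz := h.shape_eq fun u v => glues_openEnd rfl rfl rfl
  obtain ⟨x, y, w, hx, hy, hd, hl, hr, hw⟩ := exists_pieces (z := z) (u := g) (v := f)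
    (A := closedEnd {(([p] : List ℕ) : Cycle ℕ)} 0 g) (B := closedEnd 0 (d ::ₘ {e}) f)
    (hz ▸ glues_closedEnd (by simp) (by simp)) (.phi _ _) (.omega _ _ _) hgf
  refine ⟨x, y, hx, hy, w, hl, hr, hw, ?_⟩
  obtain ⟨r, t, hrt⟩ := exists_fresh _ z.nodup
  obtain ⟨X, Y, hX, hY, hc⟩ := h r t hrt
  have hD := disjointLabels (hc.glues.labels ▸ hrt)
  have hs := hc.glues.size
  have hs' := (Y.valid hB).five_le_size
  obtain ⟨w₂, hl₂, hr₂, hw₂, e₂⟩ := hc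
  obtain ⟨q, s, hqs⟩ := exists_fresh _ X.nodup
  obtain ⟨x', y', w', hx', hy', hd', hl', hr', hw'⟩ := exists_pieces (z := X) (u := q) (v := s)
    (A := openEnd [r, p] 0 0 q) (B := openEnd [] 0 {d} s)
    (hX ▸ glues_openEnd rfl rfl rfl) (.mu _ _ _) (.phi _ _) hqs
  have eX : X.el = presentedHybrid.comp w' x'.el y'.el :=
    LabelledElement.el_eq_of_same X.inj
      ((ih X.shape (by omega) X.nodup (X.valid hB)).2 ⟨X.bi, X.lab, X.inj, X.el⟩
        ⟨X.bi, X.lab, X.inj, _⟩ rfl rfl)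
  obtain ⟨p₁, g₁, ha, ep₁, eg₁⟩ := exists_phi x hx
  obtain ⟨f₁, d₁, e₁, hb, ef₁, ed₁, ee₁⟩ := exists_omega y hy
  obtain ⟨q₂, r₂, p₂, ha', eq₂, er₂, ep₂⟩ := exists_mu x' hx'
  obtain ⟨s₂, d₂, hb', es₂, ed₂⟩ := exists_phi y' hy'
  obtain ⟨t₂, e₃, hc', et₂, ee₃⟩ := exists_phi Y hY
  obtain ⟨p₃, ep₃⟩ := X.exists_open (n := p) (by rw [hX]; simp [openEnd])
  obtain ⟨r₃, er₃⟩ := X.exists_open (n := r) (by rw [hX]; simp [openEnd])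
  obtain ⟨d₃, ed₃⟩ := X.exists_closed (n := d) (by rw [hX]; simp [openEnd])
  obtain ⟨p₀, ep₀⟩ := z.exists_open (n := p) (by rw [hz]; simp)
  obtain ⟨d₀, ed₀⟩ := z.exists_closed (n := d) (by rw [hz]; simp)
  obtain ⟨e₀, ee₀⟩ := z.exists_closed (n := e) (by rw [hz]; simp)
  rw [e₂, eX, eq_phi x ha, eq_omega y hb.rotate, eq_mu x' ha'.rotate.rotate, eq_phi y' hb',
    eq_phi Y hc']
  exact (presentedHybrid_sound (.morphism w w' w₂ (p := p₀) (d := d₀) (e := e₀) (p₃ := p₃)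
    (r₃ := r₃) (d₃ := d₃) _ _ _ _ _
    ⟨x.inj (hl.trans eg₁.symm), y.inj (hr.trans ef₁.symm)⟩
    (hw.openMap_inl hd (ep₀.trans ep₁.symm)) (hw.closedMap_inr hd (ed₀.trans ed₁.symm))
    (hw.closedMap_inr hd (ee₀.trans ee₁.symm))
    ⟨x'.inj (hl'.trans eq₂.symm), y'.inj (hr'.trans es₂.symm)⟩
    (hw'.openMap_inl hd' (ep₃.trans ep₂.symm)) (hw'.openMap_inl hd' (er₃.trans er₂.symm))
    (hw'.closedMap_inr hd' (ed₃.trans ed₂.symm))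
    ⟨X.inj (hl₂.trans er₃.symm), Y.inj (hr₂.trans et₂.symm)⟩
    (hw₂.openMap_inl hD (ep₀.trans ep₃.symm)) (hw₂.closedMap_inl hD (ed₀.trans ed₃.symm))
    (hw₂.closedMap_inr hD (ee₀.trans ee₃.symm)))).symm

theorem presentedHybrid_isGenerated : presentedHybrid.IsGenerated where
  bounded := presentedHybrid_bounded
  inhabits _ := presentedHybrid_inhabits
  subsingle _ := presentedHybrid_subsingle
  cut z hz := by
    rcases presentedHybrid_cases z.el with ⟨e, -⟩ | ⟨b, c, w, x, y, he⟩
    · exact (hz e.2.isBase).elim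
    · exact exists_cut z w he
  open_assoc := presentedHybrid_open_assoc
  closed_assoc := presentedHybrid_closed_assoc
  morphism := presentedHybrid_morphism
  centrality := presentedHybrid_centrality

end OpenClosed

/-! ### The isomorphism -/

theorem mainTheorem10 :
    Nonempty (OpenClosed.CyclicHybrid.Iso OpenClosed.presentedHybrid OpenClosed.kaufmannPenner) := by
  open OpenClosed LabelledElement in
  have hB := presentedHybrid_bounded
  have hu := presentedHybrid_isGenerated.exists_unique
  -- The element 0 is present by boundedness, and all compatibilities hold because the target
  -- components have at most one element.
  refine ⟨⟨⟨⟨fun a x => ⟨0, hB a x⟩, fun _ _ => kaufmannPenner_ext _ _⟩,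
    fun _ _ _ => kaufmannPenner_ext _ _⟩, fun a => ⟨fun x y _ => ?_, fun g => ?_⟩⟩⟩
  · obtain ⟨ℓ, hℓ⟩ := a.exists_labelling
    have hv := ((a.mem_kaufmannPennerSet_iff ℓ).1 (hB a x)).1
    -- Both elements carry the same labelling, so uniqueness up to `Same` means equality.
    exact el_eq_of_same hℓ ((hu _ _ (Nat.lt_succ_self _) (a.nodup_labels hℓ) hv).2
      ⟨a, ℓ, hℓ, x⟩ ⟨a, ℓ, hℓ, y⟩ rfl rfl)
  · obtain ⟨ℓ, hℓ⟩ := a.exists_labelling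
    have hg : 0 ∈ kaufmannPennerSet a := g.2.2.1 ▸ g.2
    have ha := (a.mem_kaufmannPennerSet_iff ℓ).1 hg
    obtain ⟨z, hz⟩ := (hu _ _ (Nat.lt_succ_self _) (a.nodup_labels hℓ) ha.1).1
    -- The element found has the shape of `a`, hence also its genus, and is transported to `a` by an
    -- isomorphism.
    obtain ⟨f, -⟩ := Biarity.exists_iso z.inj hℓ hz ((genus_eq_of_shape z hz).trans ha.2.symm)
    exact ⟨presentedHybrid.map f z.el, kaufmannPenner_ext _ _⟩
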